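/- Let $r>0$, $m\ge 1$, and let $\mu$ be the law of a stationary ergodic $m$-coloured $r$-uniformly discrete point process on $\mathbb R^d$: a probability measure on the space $X$ of point measures $\lambda$ on $\mathbb R^d\times\{1,\dots,m\}$ having at most one atom (all colours together, counted with multiplicity) over each translate of the open cube $C_r$ of edge length $r$, with the $\sigma$-algebra generated by $\lambda\mapsto\lambda(A)$ (the Borel $\sigma$-algebra of the vague topology), such that $\mu$ is invariant and ergodic under the translations $(T_t\lambda)(A)=\lambda(-t+A)$. Assume that every colour has positive intensity. Let $\lambda^i$ be the part of $\lambda$ of colour $i$, let $w\in\mathbb R^m$, $\lambda^w=\sum_i w_i\lambda^i$ and $N^w_f(\lambda)=\lambda^w(f)$. Let $\chi_k(x)=e^{2\pi i k\cdot x}$, let $\hat f(k)=\int e^{-2\pi i k\cdot x}f(x)\,dx$, and define the Fourier transform of a measure by $\hat\gamma(\varphi)=\gamma(\hat\varphi)$ for rapidly decreasing $\varphi$. Inner products are linear in the first variable, and $(T_tF)(\lambda)=F(T_{-t}\lambda)$ on $L^2(X,\mu)$. (1) (Dworkin's theorem.) Let $f\in C_c(\mathbb R^d)$. Then $N^w_f\in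 L^2(X,\mu)$ has a unique spectral measure, that is, a unique finite positive measure $\sigma$ on $\mathbb R^d$ with $(N^w_f,T_tN^w_f)=\int e^{2\pi i x\cdot t}\,d\sigma(x)$ for all $t$. For $\mu$-almost every $\lambda$ the autocorrelation $\gamma^w_{f*\lambda}$ exists, where, with $g=f*\lambda^w$, it is the vague limit as $R\to\infty$ of $\frac1{\ell(C_R)}\,g|_{C_R}*\widetilde{g|_{C_R}}$ (here $\ell$ is Lebesgue measure, $C_R$ the open cube of edge length $R$ about $0$, and $\tilde h(x)=\overline{h(-x)}$), and its Fourier transform, the diffraction $\widehat{\gamma^w_{f*\lambda}}$, exists and is equal to $\sigma$. Let $\dot\mu^i(D)=\frac1{\ell(C_1)}\int\sum_{x\in C_1}\lambda^i(\{x\})\mathbf 1_D(T_{-x}\lambda)\,d\mu(\lambda)$ be the Palm measure of colour $i$, and let $\dot\mu^w_1(f)=\sum_i w_i\int N^w_f\,d\dot\mu^i$. Its Fourier transform is a unique positive Radon measure $\omega=\widehat{\dot\mu^w_1}$, and there is a unique linear isometric embedding $\theta^w:L^2(\mathbb R^d,\omega)\to L^2(X,\mu)$ with $\theta^w(\hat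 f)=N^w_f$ for all rapidly decreasing $f$; it intertwines $T$ with the representation $(U_tf)(x)=e^{-2\pi i t\cdot x}f(x)$ on $L^2(\mathbb R^d,\omega)$. Moreover: (2) For all $f,g\in L^2(\mathbb R^d,\omega)$, the spectral measures $\langle U_tf,g\rangle^\vee$ and $(T_t\theta^w(f),\theta^w(g))^\vee$ exist and are equal (hence of the same spectral type): there is one complex measure $\rho$ on $\mathbb R^d$ which is the unique complex measure with $\langle U_tf,g\rangle=\int e^{-2\pi i x\cdot t}\,d\rho(x)$ for all $t$, and also the unique one with $(T_t\theta^w(f),\theta^w(g))=\int e^{-2\pi i x\cdot t}\,d\rho(x)$ for all $t$. (3) For $k\in\mathbb R^d$, $\chi_k$ is in the point spectrum of $U$ (there is $f\ne0$ with $U_tf=\chi_k(t)f$ for all $t$) if and only if $\omega(\{k\})\ne0$, and this holds if and only if $\theta^w(\mathbf 1_{\{-k\}})$ is an eigenfunction of $T$ for $\chi_k$ (in particular is nonzero). In this case the eigenfunctions of $U$ for $\chi_k$ are exactly the nonzero multiples of $\mathbf 1_{\{-k\}}$, those of $T$ are exactly the nonzero multiples of $\theta^w(\mathbf 1_{\{-k\}})$,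 and $\|\theta^w(\mathbf 1_{\{-k\}})\|=\omega(\{k\})^{1/2}$. -/

import Mathlib

open MeasureTheory Filter Topology SchwartzMap FourierTransform CompactlySupported ComplexConjugate

noncomputable section

/-! ### Coloured uniformly discrete point measures and their translations -/

/-- The ambient space `ℝ^d` with its Euclidean structure. -/
abbrev Space (d : ℕ) : Type := EuclideanSpace ℝ (Fin d)

/-- The open cube `C_R` of edge length `R` about `0`. -/
def cube (d : ℕ) (R : ℝ) : Set (Space d) := {x | ∀ i, |x i| < R / 2}

/-- Translation of the coloured space `ℝ^d × {1, …, m}` by `t`; colours are kept. -/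
def shift {d m : ℕ} (t : Space d) : Space d × Fin m ≃ₜ Space d × Fin m :=
  (Homeomorph.addLeft t).prodCongr (Homeomorph.refl _)

/-- `lam` is a point measure on `ℝ^d × {1, …, m}` (its value on every relatively compact Borel set
is a natural number) which has at most one atom, counted over all colours, over every translate
of the open cube of edge length `r`. -/
structure IsUniformlyDiscrete {d m : ℕ} (r : ℝ) (lam : Measure (Space d × Fin m)) : Prop where
  natural : ∀ A : Set (Space d × Fin m), MeasurableSet A → IsCompact (closure A) →
    ∃ n : ℕ, lam A = n
  le_one : ∀ a : Space d, lam {p | p.1 - a ∈ cube d r} ≤ 1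

/-- The space of `m`-coloured `r`-uniformly discrete point measures. It carries the trace of the
σ-algebra that is generated by the evaluations `lam ↦ lam A`, which is the Borel σ-algebra of the
vague topology. -/
def Config (d m : ℕ) (r : ℝ) : Type :=
  {lam : Measure (Space d × Fin m) // IsUniformlyDiscrete r lam}

instance (d m : ℕ) (r : ℝ) : MeasurableSpace (Config d m r) :=
  inferInstanceAs (MeasurableSpace {lam : Measure (Space d × Fin m) // IsUniformlyDiscrete r lam})

theorem IsUniformlyDiscrete.map_shift {d m : ℕ} {r : ℝ} {lam : Measure (Space d × Fin m)}
    (h : IsUniformlyDiscrete r lam) (t : Space d) :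
    IsUniformlyDiscrete r (lam.map (shift t)) := by
  constructor
  · intro A hA hc
    rw [Measure.map_apply (shift t).measurable hA]
    refine h.natural _ ((shift t).measurable hA) ?_
    rw [← (shift t).preimage_closure]
    exact (shift t).isCompact_preimage.2 hc
  · intro a
    have hcube : MeasurableSet {p : Space d × Fin m | p.1 - a ∈ cube d r} := by
      have : {p : Space d × Fin m | p.1 - a ∈ cube d r} =
          ⋂ i, {p : Space d × Fin m | |(p.1 - a) i| < r / 2} := by
        ext p; simp [cube]
      rw [this]
      refine MeasurableSet.iInter fun i => (isOpen_lt ?_ continuous_const).measurableSet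
      fun_prop
    rw [Measure.map_apply (shift t).measurable hcube]
    have : (shift t) ⁻¹' {p : Space d × Fin m | p.1 - a ∈ cube d r} =
        {p : Space d × Fin m | p.1 - (a - t) ∈ cube d r} := by
      ext p
      have e : t + p.1 - a = p.1 - (a - t) := by abel
      simp [shift, e]
    rw [this]
    exact h.le_one (a - t)

/-- The translation action `(T_t lam)(A) = lam (-t + A)` of `ℝ^d`. -/
instance (d m : ℕ) (r : ℝ) : AddAction (Space d) (Config d m r) where
  vadd t lam := ⟨lam.1.map (shift t), lam.2.map_shift t⟩
  zero_vadd lam := by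
    refine Subtype.ext ?_
    change lam.1.map (shift 0) = lam.1
    have : ⇑(shift (m := m) (0 : Space d)) = id := by
      ext p <;> simp [shift]
    rw [this, Measure.map_id]
  add_vadd s t lam := by
    refine Subtype.ext ?_
    change lam.1.map (shift (s + t)) = (lam.1.map (shift t)).map (shift s)
    rw [Measure.map_map (shift s).measurable (shift t).measurable]
    congr 1
    ext p <;> simp [shift, add_assoc]

instance (d m : ℕ) (r : ℝ) : MeasurableConstVAdd (Space d) (Config d m r) where
  measurable_const_vadd t :=
    ((Measure.measurable_map _ (shift t).measurable).comp measurable_subtype_coe).subtype_mk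

/-- The restriction `lam^i` of `lam` to the colour `i`, as a measure on `ℝ^d`. -/
def colour {d m : ℕ} {r : ℝ} (i : Fin m) (lam : Config d m r) : Measure (Space d) :=
  lam.1.comap fun x => (x, i)

/-- The intensity `I^{(i)}` of the colour `i`: the expected number of points of colour `i` in the
unit cube. -/
def intensity {d m : ℕ} {r : ℝ} (μ : Measure (Config d m r)) (i : Fin m) : ENNReal :=
  ∫⁻ lam, colour i lam (cube d 1) ∂μ

/-- The weighted counting function `N^w_f(lam) = lam^w(f)` with `lam^w = ∑ i, w i • lam^i`. -/
def countingFn {d m : ℕ} {r : ℝ} (w : Fin m → ℝ) (f : Space d → ℂ) (lam : Config d m r) : ℂ :=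
  ∑ i, (w i : ℂ) * ∫ x, f x ∂colour i lam

/-- The function `f * lam^w` on `ℝ^d`. -/
def weightedConv {d m : ℕ} {r : ℝ} (w : Fin m → ℝ) (f : Space d → ℂ) (lam : Config d m r)
    (x : Space d) : ℂ :=
  ∑ i, (w i : ℂ) * ∫ y, f (x - y) ∂colour i lam

/-- The Palm measure of the colour `i`:
`D ↦ (1 / ℓ(C)) ∫ ∑_{x ∈ C} lam^i({x}) 1_D(T_{-x} lam) dμ(lam)` with `C` the unit cube. -/
def palm {d m : ℕ} {r : ℝ} (μ : Measure (Config d m r)) (i : Fin m) : Measure (Config d m r) :=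
  μ.bind fun lam => ((colour i lam).restrict (cube d 1)).map fun x : Space d => (-x) +ᵥ lam

/-- The weighted first moment `f ↦ ∫ N^w_f` of the weighted Palm measure `∑ i, w i • palm μ i`. -/
def palmMoment {d m : ℕ} {r : ℝ} (μ : Measure (Config d m r)) (w : Fin m → ℝ)
    (f : Space d → ℂ) : ℂ :=
  ∑ i, (w i : ℂ) * ∫ lam, countingFn w f lam ∂palm μ i

/-! ### Autocorrelation, Fourier transform and diffraction -/

/-- A complex Radon measure on `ℝ^d` in polar form: total variation and phase. -/
structure ComplexRadon (d : ℕ) where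
  /-- The total variation. -/
  variation : Measure (Space d)
  locallyFinite : IsLocallyFiniteMeasure variation
  /-- The phase. -/
  phase : Space d → ℂ
  measurable_phase : Measurable phase
  norm_phase : ∀ x, ‖phase x‖ = 1

/-- The integral of a function against a complex Radon measure. -/
def ComplexRadon.integral {d : ℕ} (γ : ComplexRadon d) (φ : Space d → ℂ) : ℂ :=
  ∫ x, γ.phase x * φ x ∂γ.variation

/-- `γ` is the autocorrelation of the locally integrable function `g`, that is of the measure with
density `g`: the vague limit of `(1 / ℓ(C_R)) g|_{C_R} * (g|_{C_R})~` as `R → ∞`, where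
`h~(x) = conj (h (-x))`. -/
def IsAutocorrelation {d : ℕ} (g : Space d → ℂ) (γ : ComplexRadon d) : Prop :=
  LocallyIntegrable g volume ∧
  ∀ φ : C_c(Space d, ℂ),
    Tendsto (fun R : ℝ => ((volume (cube d R)).toReal : ℂ)⁻¹ *
        ∫ x in cube d R, ∫ y in cube d R, g x * conj (g y) * φ (x - y))
      atTop (𝓝 (γ.integral φ))

/-- The positive measure `ω` is the Fourier transform of the measure that is given by the linear
functional `L`: `ω(φ) = L(φ^)` for all rapidly decreasing `φ`. -/
def IsFourierTransform {d : ℕ} (L : (Space d → ℂ) → ℂ) (ω : Measure (Space d)) : Prop :=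
  ∀ φ : 𝓢(Space d, ℂ), Integrable φ ω ∧ ∫ k, φ k ∂ω = L (𝓕 φ : 𝓢(Space d, ℂ))

/-- `ω` is the diffraction of (the measure with density) `g`: the autocorrelation of `g` exists and
the positive Radon measure `ω` is its Fourier transform. -/
def IsDiffraction {d : ℕ} (g : Space d → ℂ) (ω : Measure (Space d)) : Prop :=
  ∃ γ : ComplexRadon d, IsAutocorrelation g γ ∧
    (∀ φ : 𝓢(Space d, ℂ), Integrable (𝓕 φ : 𝓢(Space d, ℂ)) γ.variation) ∧
    IsLocallyFiniteMeasure ω ∧ IsFourierTransform γ.integral ω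

/-! ### Representations of `ℝ^d` and their spectral measures -/

/-- The character `χ_k(x) = exp(2πi k·x)`. -/
def chi {d : ℕ} (k x : Space d) : ℂ := (Real.fourierChar (inner ℝ k x) : ℂ)

/-- The translation representation `(T_t F)(lam) = F(T_{-t} lam)` on `L²(X, μ)`. -/
def translationRep {d m : ℕ} {r : ℝ} (μ : Measure (Config d m r))
    [VAddInvariantMeasure (Space d) (Config d m r) μ] (t : Space d) (F : Lp ℂ 2 μ) : Lp ℂ 2 μ :=
  Lp.compMeasurePreserving (fun lam => (-t) +ᵥ lam) (measurePreserving_vadd (-t) μ) F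

theorem memLp_chi_mul {d : ℕ} (ω : Measure (Space d)) (t : Space d) (f : Lp ℂ 2 ω) :
    MemLp (fun x => chi (-t) x * f x) 2 ω := by
  have hc : Continuous (chi (-t)) :=
    continuous_subtype_val.comp (Real.continuous_fourierChar.comp (by fun_prop))
  refine (Lp.memLp f).of_le
    (hc.aestronglyMeasurable.mul (Lp.memLp f).aestronglyMeasurable) (ae_of_all _ fun x => ?_)
  rw [norm_mul, chi, Circle.norm_coe, one_mul]

/-- The multiplication representation `(U_t f)(x) = exp(-2πi t·x) f(x)` on `L²(ℝ^d, ω)`. -/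
def multiplicationRep {d : ℕ} (ω : Measure (Space d)) (t : Space d) (f : Lp ℂ 2 ω) : Lp ℂ 2 ω :=
  (memLp_chi_mul ω t f).toLp _

/-- The finite positive measure `σ` is the spectral measure of `u` for the representation `S`:
`(u, S_t u) = ∫ exp(2πi x·t) dσ(x)`, where `(·,·)` is linear in its first variable
(so that `(u, v)` is `inner ℂ v u`). -/
def IsSpectralMeasure {d : ℕ} {H : Type*} [NormedAddCommGroup H] [InnerProductSpace ℂ H]
    (S : Space d → H → H) (u : H) (σ : Measure (Space d)) : Prop :=
  IsFiniteMeasure σ ∧ ∀ t : Space d, inner ℂ (S t u) u = ∫ x, chi x t ∂σ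

/-- The complex measure `ρ` is the spectral measure of the pair `u, v` for the representation `S`,
that is the inverse Fourier transform of `t ↦ (S_t u, v)`:
`(S_t u, v) = ∫ exp(-2πi x·t) dρ(x)`, where `(·,·)` is linear in its first variable. -/
def IsCrossSpectralMeasure {d : ℕ} {H : Type*} [NormedAddCommGroup H] [InnerProductSpace ℂ H]
    (S : Space d → H → H) (u v : H) (ρ : ComplexMeasure (Space d)) : Prop :=
  ∀ t : Space d, inner ℂ v (S t u) =
    VectorMeasure.integral ρ (fun x => chi (-x) t) (ContinuousLinearMap.mul ℝ ℂ)

/-- `u` is an eigenfunction of the representation `S` for the character `χ_k`. -/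
def IsEigenfunction {d : ℕ} {H : Type*} [NormedAddCommGroup H] [InnerProductSpace ℂ H]
    (S : Space d → H → H) (k : Space d) (u : H) : Prop :=
  u ≠ 0 ∧ ∀ t : Space d, S t u = chi k t • u

/-- `θ` is an isometric embedding of `L²(ℝ^d, ω)` into `L²(X, μ)` that sends `f^` to `N^w_f` for
every rapidly decreasing `f`. -/
def IsCountingEmbedding {d m : ℕ} {r : ℝ} (μ : Measure (Config d m r)) (w : Fin m → ℝ)
    (ω : Measure (Space d)) (θ : Lp ℂ 2 ω →ₗᵢ[ℂ] Lp ℂ 2 μ) : Prop :=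
  ∀ f : 𝓢(Space d, ℂ),
    ∃ (h₁ : MemLp (𝓕 f : 𝓢(Space d, ℂ)) 2 ω) (h₂ : MemLp (countingFn w f) 2 μ),
      θ (h₁.toLp _) = h₂.toLp _

/-- The indicator function of the point `{x}` in `L²(ℝ^d, ω)`. -/
def pointIndicator {d : ℕ} (ω : Measure (Space d)) [IsLocallyFiniteMeasure ω] (x : Space d) :
    Lp ℂ 2 ω :=
  indicatorConstLp 2 (measurableSet_singleton x) isCompact_singleton.measure_ne_top (1 : ℂ)

end

/-!
Campbell's formula, a consequence of the uniqueness of Haar measure, turns the inner product of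
`N^w_f` and `N^w_g` into the value of the weighted first Palm moment at `f * g~`. The moment is
therefore of positive type: if `g = h * h~`, then `k ↦ palmMoment (chi_{-k} g)` is nonnegative. For
a sequence of such `g` that tends to `1` these functions are densities of uniformly translation
bounded measures, and every vague limit of them is the Fourier transform `ω` of the moment.

Now `f^ ↦ N^w_f` is isometric on a dense subspace of `L²(ω)`, and its extension `θ` intertwines the
multiplication representation with the translations. Spectral measures and eigenfunctions of the
multiplication representation are found directly and transported by `θ`; the eigenvalues of the
translations are simple by ergodicity.

For Dworkin's theorem, `f * lam` is the function `x ↦ N(-x + lam)` with `N` the counting function of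
the reflection of `f`. Wiener's ergodic theorem, applied to countably many test functions that are
dense in `L¹`, shows that almost surely its autocorrelation has the density
`z ↦ ∫ N(lam) conj (N(z + lam)) dμ`. This is a matrix coefficient of the translations, hence the
inverse Fourier transform of the spectral measure `|f^|² ω` of `N^w_f`, because `ω` is invariant
under `x ↦ -x`.
-/

noncomputable section

/-! ### Translation bounded measures -/

section TranslationBounded

open Module (finrank)
open scoped ENNReal

section Weight

variable {E : Type*} [NormedAddCommGroup E]

/-- The weight `(1 + ‖x‖)⁻ⁿ`, which measures the decay of test functions. -/
def decayWeight (n : ℕ) (x : E) : ℝ := ((1 + ‖x‖) ^ n)⁻¹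

lemma decayWeight_pos (n : ℕ) (x : E) : 0 < decayWeight n x := by
  unfold decayWeight; positivity

lemma continuous_decayWeight (n : ℕ) : Continuous (decayWeight n : E → ℝ) := by
  unfold decayWeight
  exact Continuous.inv₀ (by fun_prop) fun x => by positivity

lemma le_mul_decayWeight_iff (n : ℕ) (x : E) {a A : ℝ} :
    a ≤ A * decayWeight n x ↔ a * (1 + ‖x‖) ^ n ≤ A := by
  rw [decayWeight, ← div_eq_mul_inv, le_div_iff₀ (by positivity)]

lemma decayWeight_antitone {k n : ℕ} (h : k ≤ n) (x : E) : decayWeight n x ≤ decayWeight k x :=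
  inv_anti₀ (by positivity) (pow_le_pow_right₀ (by linarith [norm_nonneg x]) h)

lemma pow_mul_decayWeight_add (k n : ℕ) (x : E) :
    (1 + ‖x‖) ^ k * decayWeight (n + k) x = decayWeight n x := by
  have : 1 + ‖x‖ ≠ 0 := by positivity
  rw [decayWeight, decayWeight, pow_add]
  field_simp

lemma decayWeight_le_mul (n : ℕ) (x y : E) :
    decayWeight n x ≤ (1 + ‖x - y‖) ^ n * decayWeight n y := by
  rw [decayWeight, decayWeight, ← div_eq_mul_inv, inv_eq_one_div,
    div_le_div_iff₀ (by positivity) (by positivity), one_mul, ← mul_pow]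
  gcongr
  have htri : ‖y‖ ≤ ‖x‖ + ‖x - y‖ := by simpa [norm_sub_rev] using norm_add_le x (y - x)
  nlinarith [norm_nonneg x, norm_nonneg (x - y)]

lemma decayWeight_mul_le (n : ℕ) (x y : E) :
    decayWeight (n + n) y * decayWeight n (x + y) ≤ decayWeight n y * decayWeight n x := by
  calc decayWeight (n + n) y * decayWeight n (x + y)
      ≤ decayWeight (n + n) y * ((1 + ‖y‖) ^ n * decayWeight n x) := by
        have := (decayWeight_pos (n + n) y).le
        gcongr
        simpa using decayWeight_le_mul n (x + y) x
    _ = decayWeight n y * decayWeight n x := by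
        rw [← pow_mul_decayWeight_add n n y]; ring

variable {F : Type*} [NormedAddCommGroup F]

lemma exists_norm_le_decayWeight_of_hasCompactSupport {f : E → F} (hf : Continuous f)
    (hs : HasCompactSupport f) (n : ℕ) :
    ∃ A : ℝ, 0 ≤ A ∧ ∀ x, ‖f x‖ ≤ A * decayWeight n x := by
  obtain ⟨A, hA⟩ := (hs.norm.mul_right (f' := fun x => (1 + ‖x‖) ^ n)).exists_bound_of_continuous
    (hf.norm.mul (by fun_prop))
  refine ⟨A, (norm_nonneg _).trans (hA 0), fun x => (le_mul_decayWeight_iff n x).2 ?_⟩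
  exact (le_abs_self _).trans (hA x)

lemma exists_norm_schwartzMap_le_decayWeight [NormedSpace ℝ E] [NormedSpace ℝ F] (f : 𝓢(E, F))
    (n : ℕ) : ∃ A : ℝ, 0 ≤ A ∧ ∀ x, ‖f x‖ ≤ A * decayWeight n x := by
  refine ⟨2 ^ n * ((Finset.Iic (n, 0)).sup fun m => SchwartzMap.seminorm ℝ m.1 m.2) f,
    by positivity, fun x => (le_mul_decayWeight_iff n x).2 ?_⟩
  simpa only [norm_iteratedFDeriv_zero, mul_comm] using
    SchwartzMap.one_add_le_sup_seminorm_apply (𝕜 := ℝ) (m := (n, 0)) (k := n) (n := 0)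
      le_rfl le_rfl f x

end Weight

/-- The mass that `τ` gives to balls of radius `ρ` is at most `M`. For `0 < ρ` and `M < ∞` this says
that `τ` is translation bounded; the constants are kept because limits of such measures need bounds
that are uniform. -/
def TranslationBounded {X : Type*} [PseudoMetricSpace X] [MeasurableSpace X] (τ : Measure X)
    (ρ : ℝ) (M : ℝ≥0∞) : Prop :=
  ∀ x, τ (Metric.ball x ρ) ≤ M

section Metric

variable {X : Type*} [PseudoMetricSpace X] [MeasurableSpace X] {τ : Measure X} {ρ : ℝ} {M : ℝ≥0∞}

lemma TranslationBounded.isLocallyFiniteMeasure (h : TranslationBounded τ ρ M) (hρ : 0 < ρ)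
    (hM : M ≠ ⊤) : IsLocallyFiniteMeasure τ :=
  ⟨fun x => ⟨_, Metric.ball_mem_nhds x hρ, (h x).trans_lt hM.lt_top⟩⟩

variable [OpensMeasurableSpace X] [SecondCountableTopology X]

lemma lintegral_setLIntegral_ball (τ ν : Measure X) [SFinite τ] [SFinite ν] {f : X → ℝ≥0∞}
    (hf : Measurable f) (ρ : ℝ) :
    ∫⁻ x, (∫⁻ y in Metric.ball x ρ, f y ∂ν) ∂τ = ∫⁻ y, f y * τ (Metric.ball y ρ) ∂ν := by
  have hs : MeasurableSet {p : X × X | p.2 ∈ Metric.ball p.1 ρ} := by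
    simp only [Metric.mem_ball]
    exact (isOpen_lt (by fun_prop) continuous_const).measurableSet
  have hm : Measurable fun p : X × X => (Metric.ball p.1 ρ).indicator f p.2 :=
    (hf.comp measurable_snd).indicator hs
  simp_rw [← lintegral_indicator measurableSet_ball, ← setLIntegral_const,
    ← lintegral_indicator (measurableSet_ball (α := X))]
  rw [lintegral_lintegral_swap hm.aemeasurable]
  refine lintegral_congr fun y => lintegral_congr fun x => ?_
  simp only [Set.indicator, Metric.mem_ball, dist_comm]

end Metric

variable {E : Type*} [NormedAddCommGroup E] [MeasureSpace E] [BorelSpace E]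
  [(volume : Measure E).IsAddHaarMeasure]

lemma ofReal_decayWeight_mul_volume_ball_le (n : ℕ) (x : E) (ρ : ℝ) :
    ENNReal.ofReal (decayWeight n x) * volume (Metric.ball (0 : E) ρ) ≤
      ∫⁻ y in Metric.ball x ρ, ENNReal.ofReal ((1 + ρ) ^ n * decayWeight n y) := by
  rw [← Measure.addHaar_ball_center volume x, ← setLIntegral_const]
  refine setLIntegral_mono' measurableSet_ball fun y hy => ENNReal.ofReal_le_ofReal ?_
  have hxy : ‖x - y‖ ≤ ρ := by rw [← dist_eq_norm, dist_comm]; exact (Metric.mem_ball.1 hy).le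
  refine (decayWeight_le_mul n x y).trans ?_
  have := (decayWeight_pos n y).le
  gcongr

variable [NormedSpace ℝ E] [FiniteDimensional ℝ E]

variable (E) in
/-- The bound for the integral of `decayWeight n` against a measure that gives mass at most `1` to
the balls of radius `ρ`. -/
def weightConst (ρ : ℝ) (n : ℕ) : ℝ≥0∞ :=
  ENNReal.ofReal ((1 + ρ) ^ n) * (∫⁻ y : E, ENNReal.ofReal (decayWeight n y)) *
    (volume (Metric.ball (0 : E) ρ))⁻¹

lemma integrable_decayWeight {n : ℕ} (hn : finrank ℝ E < n) :
    Integrable (decayWeight n : E → ℝ) := by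
  refine (integrable_one_add_norm (r := n) (by exact_mod_cast hn)).congr (ae_of_all _ fun x => ?_)
  simp only [decayWeight, Real.rpow_neg (add_nonneg zero_le_one (norm_nonneg x)), Real.rpow_natCast]

lemma weightConst_lt_top {ρ : ℝ} (hρ : 0 < ρ) {n : ℕ} (hn : finrank ℝ E < n) :
    weightConst E ρ n < ⊤ :=
  ENNReal.mul_lt_top
    (ENNReal.mul_lt_top ENNReal.ofReal_lt_top (integrable_decayWeight hn).lintegral_lt_top)
    (ENNReal.inv_lt_top.2 (Metric.measure_ball_pos _ _ hρ))

variable {τ : Measure E} {ρ : ℝ} {M : ℝ≥0∞}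

/-- The weight is comparable to its means over balls of radius `ρ`, so its integral against `τ`
is controlled by that of `y ↦ τ (ball y ρ) * decayWeight n y` against Lebesgue measure. -/
theorem TranslationBounded.lintegral_decayWeight_le (h : TranslationBounded τ ρ M) (hρ : 0 < ρ)
    (hM : M ≠ ⊤) (n : ℕ) :
    ∫⁻ x, ENNReal.ofReal (decayWeight n x) ∂τ ≤ M * weightConst E ρ n := by
  have := h.isLocallyFiniteMeasure hρ hM
  have hw : Measurable fun y : E => ENNReal.ofReal (decayWeight n y) :=
    (continuous_decayWeight n).measurable.ennreal_ofReal
  set V := volume (Metric.ball (0 : E) ρ)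
  have hV0 : V ≠ 0 := (Metric.measure_ball_pos _ _ hρ).ne'
  have hVt : V ≠ ⊤ := measure_ball_lt_top.ne
  have key : (∫⁻ x, ENNReal.ofReal (decayWeight n x) ∂τ) * V ≤
      M * (ENNReal.ofReal ((1 + ρ) ^ n) * ∫⁻ y : E, ENNReal.ofReal (decayWeight n y)) := by
    calc (∫⁻ x, ENNReal.ofReal (decayWeight n x) ∂τ) * V
        = ∫⁻ x, ENNReal.ofReal (decayWeight n x) * V ∂τ := (lintegral_mul_const _ hw).symm
      _ ≤ ∫⁻ x, (∫⁻ y in Metric.ball x ρ, ENNReal.ofReal ((1 + ρ) ^ n * decayWeight n y)) ∂τ :=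
          lintegral_mono fun x => ofReal_decayWeight_mul_volume_ball_le n x ρ
      _ = ∫⁻ y, ENNReal.ofReal ((1 + ρ) ^ n * decayWeight n y) * τ (Metric.ball y ρ) :=
          lintegral_setLIntegral_ball τ volume
            ((continuous_decayWeight n).measurable.const_mul _).ennreal_ofReal ρ
      _ ≤ ∫⁻ y : E, M * (ENNReal.ofReal ((1 + ρ) ^ n) * ENNReal.ofReal (decayWeight n y)) := by
          refine lintegral_mono fun y => ?_
          rw [ENNReal.ofReal_mul (by positivity), mul_comm M]
          gcongr
          exact h y
      _ = _ := by rw [lintegral_const_mul _ (hw.const_mul _), lintegral_const_mul _ hw]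
  rw [weightConst, ← mul_assoc, ← div_eq_mul_inv,
    ENNReal.le_div_iff_mul_le (Or.inl hV0) (Or.inl hVt)]
  exact key

lemma TranslationBounded.integrable_decayWeight (h : TranslationBounded τ ρ M) (hρ : 0 < ρ)
    (hM : M ≠ ⊤) {n : ℕ} (hn : finrank ℝ E < n) : Integrable (decayWeight n : E → ℝ) τ := by
  refine ⟨(continuous_decayWeight n).aestronglyMeasurable, ?_⟩
  rw [hasFiniteIntegral_iff_ofReal (ae_of_all _ fun x => (decayWeight_pos n x).le)]
  exact (h.lintegral_decayWeight_le hρ hM n).trans_lt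
    (ENNReal.mul_lt_top hM.lt_top (weightConst_lt_top hρ hn))

lemma TranslationBounded.integral_decayWeight_le (h : TranslationBounded τ ρ M) (hρ : 0 < ρ)
    (hM : M ≠ ⊤) {n : ℕ} (hn : finrank ℝ E < n) :
    ∫ x, decayWeight n x ∂τ ≤ (M * weightConst E ρ n).toReal := by
  rw [integral_eq_lintegral_of_nonneg_ae (ae_of_all _ fun x => (decayWeight_pos n x).le)
    (continuous_decayWeight n).aestronglyMeasurable]
  exact ENNReal.toReal_mono (ENNReal.mul_lt_top hM.lt_top (weightConst_lt_top hρ hn)).ne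
    (h.lintegral_decayWeight_le hρ hM n)

variable {F : Type*} [NormedAddCommGroup F] {n : ℕ} {f : E → F} {A : ℝ}

lemma TranslationBounded.integrable_of_le (h : TranslationBounded τ ρ M) (hρ : 0 < ρ)
    (hM : M ≠ ⊤) (hn : finrank ℝ E < n) (hf : AEStronglyMeasurable f τ)
    (hA : ∀ x, ‖f x‖ ≤ A * decayWeight n x) : Integrable f τ :=
  ((h.integrable_decayWeight hρ hM hn).const_mul A).mono' hf (ae_of_all _ hA)

lemma TranslationBounded.integral_norm_le (h : TranslationBounded τ ρ M) (hρ : 0 < ρ)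
    (hM : M ≠ ⊤) (hn : finrank ℝ E < n) (h0 : 0 ≤ A) (hA : ∀ x, ‖f x‖ ≤ A * decayWeight n x) :
    ∫ x, ‖f x‖ ∂τ ≤ A * (M * weightConst E ρ n).toReal := by
  calc ∫ x, ‖f x‖ ∂τ ≤ ∫ x, A * decayWeight n x ∂τ :=
        integral_mono_of_nonneg (ae_of_all _ fun x => norm_nonneg _)
          ((h.integrable_decayWeight hρ hM hn).const_mul A) (ae_of_all _ hA)
    _ = A * ∫ x, decayWeight n x ∂τ := integral_const_mul _ _
    _ ≤ A * (M * weightConst E ρ n).toReal :=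
        mul_le_mul_of_nonneg_left (h.integral_decayWeight_le hρ hM hn) h0

end TranslationBounded

/-! ### Measurability on the space of configurations -/

section Config

open ProbabilityTheory
open scoped ENNReal

lemma isSFiniteKernel_of_lintegral_le {X Y : Type*} [MeasurableSpace X] [MeasurableSpace Y]
    {κ : Kernel X Y} {v : Y → ℝ≥0∞} (hv : Measurable v) (hv0 : ∀ y, v y ≠ 0) (hvt : ∀ y, v y ≠ ⊤)
    {C : ℝ≥0∞} (hC : C ≠ ⊤) (h : ∀ x, ∫⁻ y, v y ∂κ x ≤ C) : IsSFiniteKernel κ := by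
  let η : Kernel X Y :=
    ⟨fun x => (κ x).withDensity v, by
      refine Measure.measurable_of_measurable_coe _ fun s hs => ?_
      simp_rw [withDensity_apply _ hs, ← lintegral_indicator hs]
      exact (Measure.measurable_lintegral (hv.indicator hs)).comp κ.measurable⟩
  have hη : IsFiniteKernel η := by
    refine ⟨⟨C, hC.lt_top, fun x => ?_⟩⟩
    change (κ x).withDensity v Set.univ ≤ C
    rw [withDensity_apply _ MeasurableSet.univ, Measure.restrict_univ]
    exact h x
  have hκη : κ = η.withDensity fun _ y => (v y)⁻¹ := by
    ext1 x
    rw [Kernel.withDensity_apply _ (by exact hv.inv.comp measurable_snd)]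
    exact (withDensity_inv_same hv (ae_of_all _ hv0) (ae_of_all _ hvt)).symm
  rw [hκη]
  exact Kernel.IsSFiniteKernel.withDensity η fun _ y => ENNReal.inv_ne_top.2 (hv0 y)

variable {d m : ℕ} {r : ℝ}

lemma colour_apply (i : Fin m) (lam : Config d m r) (s : Set (Space d)) :
    colour i lam s = lam.1 ((fun x => (x, i)) '' s) :=
  (measurableEmbedding_prod_mk_right i).comap_apply _ _

lemma measurable_colour (i : Fin m) :
    Measurable (colour i : Config d m r → Measure (Space d)) := by
  refine Measure.measurable_of_measurable_coe _ fun s hs => ?_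
  simp_rw [colour_apply]
  exact (Measure.measurable_coe
    ((measurableEmbedding_prod_mk_right i).measurableSet_image.2 hs)).comp measurable_subtype_coe

lemma translationBounded_colour (i : Fin m) (lam : Config d m r) :
    TranslationBounded (colour i lam) (r / 2) 1 := by
  intro x
  rw [colour_apply]
  refine le_trans (measure_mono ?_) (lam.2.le_one x)
  rintro _ ⟨y, hy, rfl⟩ j
  have hj : |(y - x) j| ≤ ‖y - x‖ := PiLp.norm_apply_le (y - x) j
  exact hj.trans_lt (by rwa [← dist_eq_norm])

/-- The map `lam ↦ lam^i` as a kernel, so that joint measurability and Fubini are available. -/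
def colourKernel (i : Fin m) : Kernel (Config d m r) (Space d) := ⟨colour i, measurable_colour i⟩

lemma colour_vadd (i : Fin m) (t : Space d) (lam : Config d m r) :
    colour i (t +ᵥ lam) = (colour i lam).map (t + ·) := by
  ext s hs
  have hmap : (t +ᵥ lam).1 ((fun x => (x, i)) '' s) =
      lam.1 (shift t ⁻¹' ((fun x => (x, i)) '' s)) :=
    (shift t).toMeasurableEquiv.measurableEmbedding.map_apply _ _
  rw [Measure.map_apply (measurable_const_add t) hs, colour_apply, colour_apply, hmap]
  congr 1
  ext ⟨x, j⟩
  simp [shift, Prod.ext_iff, eq_comm]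

lemma integral_colour_vadd {F : Type*} [NormedAddCommGroup F] [NormedSpace ℝ F] (i : Fin m)
    (t : Space d) (lam : Config d m r) (f : Space d → F) :
    ∫ x, f x ∂colour i (t +ᵥ lam) = ∫ x, f (t + x) ∂colour i lam := by
  rw [colour_vadd]
  exact (measurableEmbedding_addLeft t).integral_map f

lemma countingFn_vadd (w : Fin m → ℝ) (f : Space d → ℂ) (t : Space d) (lam : Config d m r) :
    countingFn w f (t +ᵥ lam) = countingFn w (fun x => f (t + x)) lam := by
  simp only [countingFn, integral_colour_vadd]

lemma val_eq_sum_colour (lam : Config d m r) {s : Set (Space d × Fin m)} (hs : MeasurableSet s) :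
    lam.1 s = ∑ i, colour i lam {x | (x, i) ∈ s} := by
  have hunion : s = ⋃ i ∈ Finset.univ (α := Fin m), (fun x => (x, i)) '' {x | (x, i) ∈ s} := by
    ext ⟨x, j⟩
    simp
  conv_lhs => rw [hunion]
  rw [measure_biUnion_finset]
  · simp_rw [colour_apply]
  · intro i _ j _ hij
    refine Set.disjoint_left.2 ?_
    rintro _ ⟨x, _, rfl⟩ ⟨y, _, h⟩
    exact hij (Prod.mk.inj h).2.symm
  · intro i _
    exact (measurableEmbedding_prod_mk_right i).measurableSet_image.2 (measurable_prodMk_right hs)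

lemma measurable_countingFn (w : Fin m → ℝ) {f : Space d → ℂ} (hf : Measurable f) :
    Measurable (countingFn w f : Config d m r → ℂ) :=
  Finset.measurable_sum _ fun i _ =>
    (hf.stronglyMeasurable.integral_kernel (κ := colourKernel i)).measurable.const_mul _

-- A `Fact`, so that the local finiteness of the colours is found by instance search.
variable [hr : Fact (0 < r)]

lemma lintegral_colour_decayWeight_le (i : Fin m) (lam : Config d m r) (n : ℕ) :
    ∫⁻ x, ENNReal.ofReal (decayWeight n x) ∂colour i lam ≤ weightConst (Space d) (r / 2) n := by
  simpa using (translationBounded_colour i lam).lintegral_decayWeight_le (half_pos hr.out)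
    ENNReal.one_ne_top n

lemma weightConst_colour_lt_top : weightConst (Space d) (r / 2) (d + 1) < ⊤ :=
  weightConst_lt_top (half_pos hr.out) (by simp)

instance (i : Fin m) (lam : Config d m r) : IsLocallyFiniteMeasure (colour i lam) :=
  (translationBounded_colour i lam).isLocallyFiniteMeasure (half_pos hr.out) ENNReal.one_ne_top

instance (i : Fin m) : IsSFiniteKernel (colourKernel i : Kernel (Config d m r) (Space d)) :=
  isSFiniteKernel_of_lintegral_le (continuous_decayWeight (d + 1)).measurable.ennreal_ofReal
    (fun x => (ENNReal.ofReal_pos.2 (decayWeight_pos _ x)).ne') (fun _ => ENNReal.ofReal_ne_top)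
    weightConst_colour_lt_top.ne fun lam => lintegral_colour_decayWeight_le i lam (d + 1)

instance : MeasurableVAdd₂ (Space d) (Config d m r) where
  measurable_vadd := by
    refine Measurable.subtype_mk (f := fun p : Space d × Config d m r => p.2.1.map (shift p.1))
      (Measure.measurable_of_measurable_coe _ fun s hs => ?_)
    have hsum : (fun p : Space d × Config d m r => p.2.1.map (shift p.1) s) =
        fun p => ∑ i, ((colourKernel i).comap Prod.snd measurable_snd :
            Kernel (Space d × Config d m r) (Space d)) p
          (Prod.mk p ⁻¹' {q : (Space d × Config d m r) × Space d | (q.1.1 + q.2, i) ∈ s}) := by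
      ext p
      rw [Measure.map_apply (shift p.1).measurable hs,
        val_eq_sum_colour _ ((shift p.1).measurable hs)]
      rfl
    rw [hsum]
    refine Finset.measurable_sum _ fun i _ => Kernel.measurable_kernel_prodMk_left ?_
    exact (Measurable.prodMk (by fun_prop) measurable_const) hs

variable {F : Type*} [NormedAddCommGroup F] {f : Space d → F} {A : ℝ}

lemma integrable_colour (hf : StronglyMeasurable f) (hA : ∀ x, ‖f x‖ ≤ A * decayWeight (d + 1) x)
    (i : Fin m) (lam : Config d m r) : Integrable f (colour i lam) :=
  (translationBounded_colour i lam).integrable_of_le (half_pos hr.out) ENNReal.one_ne_top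
    (by simp) hf.aestronglyMeasurable hA

lemma norm_integral_colour_le [NormedSpace ℝ F] (hA0 : 0 ≤ A)
    (hA : ∀ x, ‖f x‖ ≤ A * decayWeight (d + 1) x) (i : Fin m) (lam : Config d m r) :
    ‖∫ x, f x ∂colour i lam‖ ≤ A * (weightConst (Space d) (r / 2) (d + 1)).toReal := by
  refine (norm_integral_le_integral_norm _).trans ?_
  simpa using (translationBounded_colour i lam).integral_norm_le (half_pos hr.out)
    ENNReal.one_ne_top (by simp) hA0 hA

lemma norm_countingFn_le (w : Fin m → ℝ) {f : Space d → ℂ} (hA0 : 0 ≤ A)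
    (hA : ∀ x, ‖f x‖ ≤ A * decayWeight (d + 1) x) (lam : Config d m r) :
    ‖countingFn w f lam‖ ≤
      A * ((∑ i, |w i|) * (weightConst (Space d) (r / 2) (d + 1)).toReal) := by
  refine (norm_sum_le _ _).trans ?_
  rw [Finset.sum_mul, Finset.mul_sum]
  refine Finset.sum_le_sum fun i _ => ?_
  rw [norm_mul, Complex.norm_real, Real.norm_eq_abs, mul_left_comm]
  gcongr
  exact norm_integral_colour_le hA0 hA i lam

end Config

/-! ### Averages over cubes -/

section Cubes

variable {d : ℕ}

lemma measurableSet_cube (R : ℝ) : MeasurableSet (cube d R) := by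
  have : cube d R = ⋂ i, {x : Space d | |x i| < R / 2} := by
    ext x
    simp [cube]
  rw [this]
  exact MeasurableSet.iInter fun i => (isOpen_lt (by fun_prop) continuous_const).measurableSet

lemma volume_cube {R : ℝ} (hR : 0 ≤ R) : volume (cube d R) = ENNReal.ofReal (R ^ d) := by
  have hpre : (MeasurableEquiv.toLp 2 (Fin d → ℝ)).symm ⁻¹'
      (Set.univ.pi fun _ => Set.Ioo (-(R / 2)) (R / 2)) = cube d R := by
    ext x
    simp [cube, abs_lt]
  rw [← hpre, (EuclideanSpace.volume_preserving_symm_measurableEquiv_toLp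
    (Fin d)).measure_preimage_equiv, Real.volume_pi_Ioo]
  simp [ENNReal.ofReal_pow hR]

lemma measureReal_cube {R : ℝ} (hR : 0 ≤ R) : volume.real (cube d R) = R ^ d := by
  rw [measureReal_def, volume_cube hR, ENNReal.toReal_ofReal (by positivity)]

lemma cube_mono {R S : ℝ} (h : R ≤ S) : cube d R ⊆ cube d S := fun _ hx i =>
  (hx i).trans_le (by linarith)

lemma volume_cube_lt_top (R : ℝ) : volume (cube d R) < ⊤ := by
  refine (measure_mono (cube_mono (le_max_left R 0))).trans_lt ?_
  rw [volume_cube (le_max_right R 0)]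
  exact ENNReal.ofReal_lt_top

lemma measureReal_cube_pos {R : ℝ} (hR : 0 < R) : 0 < volume.real (cube d R) := by
  rw [measureReal_cube hR.le]
  positivity

lemma cube_subset_closedBall {R : ℝ} (hR : 0 ≤ R) :
    cube d R ⊆ Metric.closedBall 0 ((d + 1) * R) := by
  intro x hx
  rw [mem_closedBall_zero_iff]
  calc ‖x‖ ≤ ∑ i, |x i| := by
        rw [EuclideanSpace.norm_eq]
        refine Real.sqrt_le_iff.2 ⟨by positivity, ?_⟩
        exact Finset.sum_sq_le_sq_sum_of_nonneg fun i _ => abs_nonneg (x i)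
    _ ≤ ∑ _i : Fin d, R := Finset.sum_le_sum fun i _ => by linarith [hx i]
    _ = d * R := by simp
    _ ≤ (d + 1) * R := by nlinarith

lemma add_mem_cube {R : ℝ} {x t : Space d} (hx : x ∈ cube d (R - 2 * ‖t‖)) : x + t ∈ cube d R := by
  intro i
  have hti : |t i| ≤ ‖t‖ := PiLp.norm_apply_le t i
  calc |(x + t) i| ≤ |x i| + |t i| := abs_add_le _ _
    _ < R / 2 := by linarith [hx i]

lemma tendsto_measureReal_cube_boundary (a : ℝ) :
    Tendsto (fun R : ℝ => (volume.real (cube d R))⁻¹ *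
      (volume.real (cube d R) - volume.real (cube d (R - a)))) atTop (𝓝 0) := by
  have hlim : Tendsto (fun R : ℝ => 1 - (1 - a * R⁻¹) ^ d) atTop (𝓝 (1 - (1 - a * 0) ^ d)) :=
    ((tendsto_inv_atTop_zero.const_mul a).const_sub 1).pow d |>.const_sub 1
  simp only [mul_zero, sub_zero, one_pow, sub_self] at hlim
  refine hlim.congr' ?_
  filter_upwards [eventually_gt_atTop 0, eventually_gt_atTop a] with R hR hRa
  rw [measureReal_cube hR.le, measureReal_cube (by linarith), mul_sub,
    inv_mul_cancel₀ (by positivity), ← inv_pow, ← mul_pow]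
  congr 2
  field_simp

lemma setAverage_complex (s : Set (Space d)) (F : Space d → ℂ) :
    ⨍ x in s, F x = ((volume s).toReal : ℂ)⁻¹ * ∫ x in s, F x := by
  rw [setAverage_eq, Complex.real_smul, Complex.ofReal_inv, measureReal_def]

variable {G : Type*} [NormedAddCommGroup G] [NormedSpace ℝ G]

lemma tendsto_inv_measureReal_cube_smul_of_boundary {H : ℝ → G} {K a : ℝ}
    (h : ∀ R, ‖H R‖ ≤ K * (volume.real (cube d R) - volume.real (cube d (R - a)))) :
    Tendsto (fun R : ℝ => (volume.real (cube d R))⁻¹ • H R) atTop (𝓝 0) := by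
  have hlim := (tendsto_measureReal_cube_boundary (d := d) a).const_mul K
  rw [mul_zero] at hlim
  refine squeeze_zero_norm (fun R => ?_) hlim
  rw [norm_smul, norm_inv, Real.norm_of_nonneg measureReal_nonneg, mul_left_comm]
  gcongr
  exact h R

lemma norm_setIntegral_sub_setIntegral_le {Y : Type*} [MeasurableSpace Y] {ν : Measure Y}
    {F : Y → G} (hF : AEStronglyMeasurable F ν) {C : ℝ} (hC : ∀ x, ‖F x‖ ≤ C) {s t u : Set Y}
    (hs : ν s ≠ ⊤) (ht : ν t ≠ ⊤) (hu : MeasurableSet u) (hus : u ⊆ s) (hut : u ⊆ t) :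
    ‖(∫ x in s, F x ∂ν) - ∫ x in t, F x ∂ν‖ ≤
      C * ((ν.real s - ν.real u) + (ν.real t - ν.real u)) := by
  have hint : ∀ {v : Set Y}, ν v ≠ ⊤ → IntegrableOn F v ν := fun hv =>
    Measure.integrableOn_of_bounded hv hF (ae_of_all _ hC)
  have hnorm : ∀ {v : Set Y}, ν v ≠ ⊤ → u ⊆ v →
      ‖∫ x in v \ u, F x ∂ν‖ ≤ C * (ν.real v - ν.real u) := fun hv huv => by
    rw [← measureReal_sdiff huv hu hv]
    exact norm_setIntegral_le_of_norm_le_const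
      (measure_ne_top_of_subset Set.sdiff_subset hv).lt_top fun x _ => hC x
  have hsub : (∫ x in s, F x ∂ν) - ∫ x in t, F x ∂ν =
      (∫ x in s \ u, F x ∂ν) - ∫ x in t \ u, F x ∂ν := by
    rw [setIntegral_sdiff hu (hint hs) hus, setIntegral_sdiff hu (hint ht) hut,
      sub_sub_sub_cancel_right]
  rw [hsub, mul_add]
  exact (norm_sub_le _ _).trans (add_le_add (hnorm hs hus) (hnorm ht hut))

lemma tendsto_setAverage_cube_sub_translate {F : Space d → G}
    (hF : AEStronglyMeasurable F volume) {C : ℝ} (hC : ∀ x, ‖F x‖ ≤ C) (t : Space d) :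
    Tendsto (fun R => ⨍ x in cube d R, (F x - F (x - t))) atTop (𝓝 0) := by
  simp only [setAverage_eq]
  refine tendsto_inv_measureReal_cube_smul_of_boundary (K := 2 * C) (a := 2 * ‖t‖) fun R => ?_
  have hmp := measurePreserving_add_right (volume : Measure (Space d)) t
  have htranslate : ∫ x in cube d R, F (x - t) = ∫ x in (· + t) ⁻¹' cube d R, F x := by
    rw [← hmp.setIntegral_preimage_emb (measurableEmbedding_addRight t) (fun x => F (x - t))]
    simp only [add_sub_cancel_right]
  have hvol : volume ((· + t) ⁻¹' cube d R) = volume (cube d R) :=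
    measure_preimage_add_right volume t _
  have hfin : volume (cube d R) ≠ ⊤ := (volume_cube_lt_top R).ne
  have hFt : IntegrableOn (fun x => F (x - t)) (cube d R) :=
    Measure.integrableOn_of_bounded hfin
      (hF.comp_measurePreserving (measurePreserving_sub_right volume t))
      (ae_of_all _ fun x => hC _)
  rw [integral_sub (Measure.integrableOn_of_bounded hfin hF (ae_of_all _ hC)) hFt, htranslate]
  refine (norm_setIntegral_sub_setIntegral_le hF hC hfin (hvol.trans_ne hfin)
    (measurableSet_cube (R - 2 * ‖t‖)) (cube_mono (by linarith [norm_nonneg t]))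
    fun x hx => add_mem_cube hx).trans_eq ?_
  rw [measureReal_def (s := _ ⁻¹' _), hvol, ← measureReal_def]
  ring

end Cubes

/-! ### Integrals along orbits -/

section Orbit

open scoped ENNReal

variable {E X : Type*} [AddGroup E] [MeasurableSpace E] [MeasurableNeg E] [MeasurableSpace X]
  [AddAction E X] [MeasurableVAdd₂ E X] {ν : Measure E} [SFinite ν]

lemma measurable_neg_vadd : Measurable fun p : X × E => -p.2 +ᵥ p.1 :=
  measurable_snd.neg.vadd measurable_fst

lemma measurable_neg_vadd_right (lam : X) : Measurable fun x : E => -x +ᵥ lam :=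
  measurable_neg_vadd.comp measurable_prodMk_left

lemma measurable_lintegral_orbit {e : X → ℝ≥0∞} (he : Measurable e) (s : Set E) :
    Measurable fun lam => ∫⁻ x in s, e (-x +ᵥ lam) ∂ν :=
  (he.comp measurable_neg_vadd).lintegral_prod_right'

lemma lintegral_setLIntegral_orbit {μ : Measure X} [SFinite μ] [VAddInvariantMeasure E X μ]
    {e : X → ℝ≥0∞} (he : Measurable e) (s : Set E) :
    ∫⁻ lam, (∫⁻ x in s, e (-x +ᵥ lam) ∂ν) ∂μ = ν s * ∫⁻ lam, e lam ∂μ := by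
  rw [lintegral_lintegral_swap (f := fun lam (x : E) => e (-x +ᵥ lam))
    (he.comp measurable_neg_vadd).aemeasurable]
  have hinv : ∀ x : E, ∫⁻ lam, e (-x +ᵥ lam) ∂μ = ∫⁻ lam, e lam ∂μ := fun x =>
    (measurePreserving_vadd (-x) μ).lintegral_comp he
  simp_rw [hinv]
  rw [setLIntegral_const, mul_comm]

end Orbit

/-! ### The maximal inequality -/

section Maximal

open Metric Module
open scoped ENNReal

lemma setLIntegral_closedBall_zero_add {E : Type*} [NormedAddCommGroup E] [MeasurableSpace E]
    [BorelSpace E] {ν : Measure E} [ν.IsAddLeftInvariant] (G : E → ℝ≥0∞) (x : E)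
    (ρ : ℝ) :
    ∫⁻ z in closedBall 0 ρ, G (x + z) ∂ν = ∫⁻ y in closedBall x ρ, G y ∂ν := by
  rw [← (measurePreserving_add_left ν x).setLIntegral_comp_preimage_emb
    (measurableEmbedding_addLeft x) G, preimage_add_closedBall, sub_self]

variable {E : Type*} [NormedAddCommGroup E] [NormedSpace ℝ E] [FiniteDimensional ℝ E]
  [MeasurableSpace E] [BorelSpace E] {ν : Measure E} [ν.IsAddHaarMeasure]

lemma hardyLittlewood_maximal {G : E → ℝ≥0∞} {α : ℝ≥0∞} {S L : ℝ} {A : Set E}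
    (hA : A ⊆ closedBall 0 L) {ρ : E → ℝ} (hρ : ∀ x ∈ A, 0 < ρ x) (hS : ∀ x ∈ A, ρ x ≤ S)
    (h : ∀ x ∈ A, α * ν (closedBall x (ρ x)) ≤ ∫⁻ y in closedBall x (ρ x), G y ∂ν) :
    α * ν A ≤ ENNReal.ofReal (4 ^ finrank ℝ E) * ∫⁻ y in closedBall 0 (L + S), G y ∂ν := by
  obtain ⟨u, huA, hdisj, hcov⟩ := Vitali.exists_disjoint_subfamily_covering_enlargement_closedBall
    A id ρ S hS 4 (by norm_num)
  simp only [id] at hdisj hcov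
  have hcount : u.Countable := hdisj.countable_of_nonempty_interior fun x hx =>
    ⟨x, ball_subset_interior_closedBall (mem_ball_self (hρ x (huA hx)))⟩
  have hsub : A ⊆ ⋃ x ∈ u, closedBall x (4 * ρ x) := fun x hx => by
    obtain ⟨y, hy, hxy⟩ := hcov x hx
    exact Set.mem_biUnion hy (hxy (mem_closedBall_self (hρ x hx).le))
  have hscale : ∀ x : u, ν (closedBall (x : E) (4 * ρ x)) =
      ENNReal.ofReal (4 ^ finrank ℝ E) * ν (closedBall (x : E) (ρ x)) := fun x => by
    rw [Measure.addHaar_closedBall_mul _ _ (by norm_num) (hρ x (huA x.2)).le,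
      Measure.addHaar_closedBall_center ν (x : E)]
  calc α * ν A ≤ α * ∑' x : u, ν (closedBall (x : E) (4 * ρ x)) := by
        gcongr
        exact (measure_mono hsub).trans (measure_biUnion_le _ hcount _)
    _ = ENNReal.ofReal (4 ^ finrank ℝ E) * ∑' x : u, α * ν (closedBall (x : E) (ρ x)) := by
        simp_rw [hscale, ENNReal.tsum_mul_left]
        ring
    _ ≤ ENNReal.ofReal (4 ^ finrank ℝ E) * ∑' x : u, ∫⁻ y in closedBall (x : E) (ρ x), G y ∂ν := by
        gcongr with x
        exact h x (huA x.2)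
    _ = ENNReal.ofReal (4 ^ finrank ℝ E) * ∫⁻ y in ⋃ x ∈ u, closedBall x (ρ x), G y ∂ν := by
        rw [lintegral_biUnion hcount (fun x _ => isClosed_closedBall.measurableSet) hdisj]
    _ ≤ ENNReal.ofReal (4 ^ finrank ℝ E) * ∫⁻ y in closedBall 0 (L + S), G y ∂ν := by
        gcongr
        refine Set.iUnion₂_subset fun x hx => closedBall_subset_closedBall' ?_
        linarith [mem_closedBall.1 (hA (huA hx)), hS x (huA hx)]

variable {X : Type*} [AddAction E X]

/-- The set where the average of `e` along the orbit, over a ball about `0` with one of the first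
`M` radii, exceeds `α`. -/
def maximalSet (ν : Measure E) (e : X → ℝ≥0∞) (α : ℝ≥0∞) (ρ : ℕ → ℝ) (M : ℕ) : Set X :=
  {lam | ∃ n < M, α * ν (closedBall 0 (ρ n)) < ∫⁻ x in closedBall 0 (ρ n), e (-x +ᵥ lam) ∂ν}

lemma mul_measure_orbit_maximalSet_le {e : X → ℝ≥0∞} {α : ℝ≥0∞} {ρ : ℕ → ℝ} (hρ : ∀ n, 0 < ρ n)
    {M : ℕ} {S : ℝ} (hS : ∀ n < M, ρ n ≤ S) (L : ℝ) (lam : X) :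
    α * ν ({x | -x +ᵥ lam ∈ maximalSet ν e α ρ M} ∩ closedBall 0 L) ≤
      ENNReal.ofReal (4 ^ finrank ℝ E) * ∫⁻ x in closedBall 0 (L + S), e (-x +ᵥ lam) ∂ν := by
  choose! n hnM hn using fun x (hx : x ∈ {x : E | -x +ᵥ lam ∈ maximalSet ν e α ρ M}) => hx
  refine hardyLittlewood_maximal (ρ := fun x => ρ (n x)) Set.inter_subset_right
    (fun x _ => hρ _) (fun x hx => hS _ (hnM x hx.1)) fun x hx => ?_
  rw [Measure.addHaar_closedBall_center, ← setLIntegral_closedBall_zero_add]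
  simpa only [vadd_vadd, neg_add_rev] using (hn x hx.1).le

variable [MeasurableSpace X] [MeasurableVAdd₂ E X]

lemma measurableSet_maximalSet {e : X → ℝ≥0∞} (he : Measurable e) (α : ℝ≥0∞) (ρ : ℕ → ℝ)
    (M : ℕ) : MeasurableSet (maximalSet ν e α ρ M) := by
  have hunion : maximalSet ν e α ρ M = ⋃ n ∈ Finset.range M,
      {lam | α * ν (closedBall 0 (ρ n)) < ∫⁻ x in closedBall 0 (ρ n), e (-x +ᵥ lam) ∂ν} := by
    ext lam
    simp [maximalSet]
  rw [hunion]
  exact Finset.measurableSet_biUnion _ fun n _ =>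
    measurableSet_lt measurable_const (measurable_lintegral_orbit he _)

variable {μ : Measure X} [SFinite μ] [VAddInvariantMeasure E X μ]

-- Integrating the inequality on orbits over a ball with the largest of the radii, the volume of
-- that ball cancels (transference).
lemma mul_measure_maximalSet_le {e : X → ℝ≥0∞} (he : Measurable e) (α : ℝ≥0∞) {ρ : ℕ → ℝ}
    (hρ : ∀ n, 0 < ρ n) (M : ℕ) :
    α * μ (maximalSet ν e α ρ M) ≤ ENNReal.ofReal (8 ^ finrank ℝ E) * ∫⁻ lam, e lam ∂μ := by
  obtain ⟨S, hS, hρS⟩ : ∃ S : ℝ, 0 < S ∧ ∀ n < M, ρ n ≤ S :=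
    ⟨1 + ∑ n ∈ Finset.range M, ρ n,
      add_pos_of_pos_of_nonneg one_pos (Finset.sum_nonneg fun n _ => (hρ n).le), fun n hn =>
      (Finset.single_le_sum (fun i _ => (hρ i).le) (Finset.mem_range.2 hn)).trans (by simp)⟩
  have hmeas : MeasurableSet (maximalSet ν e α ρ M) := measurableSet_maximalSet he α ρ M
  have horbit : ∀ lam : X, ∫⁻ x in closedBall (0 : E) S,
      (maximalSet ν e α ρ M).indicator 1 (-x +ᵥ lam) ∂ν =
        ν ({x | -x +ᵥ lam ∈ maximalSet ν e α ρ M} ∩ closedBall 0 S) := fun lam => by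
    have hpre : MeasurableSet {x : E | -x +ᵥ lam ∈ maximalSet ν e α ρ M} :=
      measurable_neg_vadd_right lam hmeas
    rw [← Measure.restrict_apply hpre, ← lintegral_indicator_one hpre]
    rfl
  have hvol : ν (closedBall (0 : E) (S + S)) =
      ENNReal.ofReal (2 ^ finrank ℝ E) * ν (closedBall 0 S) := by
    rw [← two_mul, Measure.addHaar_closedBall_mul _ _ (by norm_num) hS.le]
  rw [← ENNReal.mul_le_mul_iff_right (measure_closedBall_pos ν 0 hS).ne'
    measure_closedBall_lt_top.ne]
  calc ν (closedBall 0 S) * (α * μ (maximalSet ν e α ρ M))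
      = ∫⁻ lam, α * ν ({x | -x +ᵥ lam ∈ maximalSet ν e α ρ M} ∩ closedBall 0 S) ∂μ := by
        simp_rw [← horbit]
        rw [lintegral_const_mul _ (measurable_lintegral_orbit (measurable_one.indicator hmeas) _),
          lintegral_setLIntegral_orbit (measurable_one.indicator hmeas),
          lintegral_indicator_one hmeas, mul_left_comm]
    _ ≤ ∫⁻ lam, ENNReal.ofReal (4 ^ finrank ℝ E) *
          ∫⁻ x in closedBall (0 : E) (S + S), e (-x +ᵥ lam) ∂ν ∂μ :=
        lintegral_mono fun lam => mul_measure_orbit_maximalSet_le hρ hρS S lam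
    _ = ν (closedBall 0 S) * (ENNReal.ofReal (8 ^ finrank ℝ E) * ∫⁻ lam, e lam ∂μ) := by
        rw [lintegral_const_mul _ (measurable_lintegral_orbit he _),
          lintegral_setLIntegral_orbit he, hvol, show (8 : ℝ) = 4 * 2 by norm_num, mul_pow,
          ENNReal.ofReal_mul (by positivity)]
        ring

theorem mul_measure_iUnion_maximalSet_le {e : X → ℝ≥0∞} (he : Measurable e) (α : ℝ≥0∞)
    {ρ : ℕ → ℝ} (hρ : ∀ n, 0 < ρ n) :
    α * μ (⋃ M, maximalSet ν e α ρ M) ≤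
      ENNReal.ofReal (8 ^ finrank ℝ E) * ∫⁻ lam, e lam ∂μ := by
  have hmono : Monotone (maximalSet (X := X) ν e α ρ) := fun M N h lam ⟨n, hn, hl⟩ =>
    ⟨n, hn.trans_le h, hl⟩
  rw [hmono.measure_iUnion, ENNReal.mul_iSup]
  exact iSup_le fun M => mul_measure_maximalSet_le he α hρ M

end Maximal

/-! ### The pointwise ergodic theorem over cubes -/

section Ergodic

open scoped ENNReal

lemma exists_ae_eq_const_of_forall_vadd_ae_eq {G X Y : Type*} [AddGroup G] [AddAction G X]
    [MeasurableSpace X] {μ : Measure X} [ErgodicVAdd G X μ] [TopologicalSpace Y]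
    [TopologicalSpace.PseudoMetrizableSpace Y] [MeasurableSpace Y] [BorelSpace Y]
    [MeasurableSpace.CountablySeparated Y] [Nonempty Y] {u : X → Y} (hu : AEStronglyMeasurable u μ)
    (h : ∀ t : G, (fun lam => u (t +ᵥ lam)) =ᵐ[μ] u) : ∃ c, u =ᵐ[μ] fun _ => c := by
  refine exists_eventuallyEq_const_of_forall_separating MeasurableSet fun U hU => ?_
  have hinv : ∀ t : G, (t +ᵥ ·) ⁻¹' (u ⁻¹' U) =ᵐ[μ] u ⁻¹' U := fun t => by
    filter_upwards [h t] with lam hl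
    exact congrArg (· ∈ U) hl
  exact eventuallyConst_set.1 (aeconst_of_forall_preimage_vadd_ae_eq G
    (hu.aemeasurable.nullMeasurableSet_preimage hU) hinv)

lemma setLIntegral_cube_orbit_le_of_notMem_maximalSet {d : ℕ} {X : Type*}
    [AddAction (Space d) X] {e : X → ℝ≥0∞} {α : ℝ≥0∞} {lam : X}
    (h : lam ∉ ⋃ M, maximalSet (volume : Measure (Space d)) e α (fun n => (d + 1) * (n + 1)) M)
    {R : ℝ} (hR : 1 ≤ R) :
    ∫⁻ x in cube d R, e (-x +ᵥ lam) ≤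
      α * (ENNReal.ofReal ((2 * R) ^ d) * volume (Metric.closedBall (0 : Space d) (d + 1))) := by
  have hR0 : 0 < R := by linarith
  have hsub : cube d R ⊆ Metric.closedBall 0 ((d + 1) * ((⌊R⌋₊ : ℝ) + 1)) :=
    (cube_subset_closedBall hR0.le).trans (Metric.closedBall_subset_closedBall (by
      have := (Nat.lt_floor_add_one R).le
      gcongr))
  have hball : ∫⁻ x in Metric.closedBall (0 : Space d) ((d + 1) * ((⌊R⌋₊ : ℝ) + 1)),
      e (-x +ᵥ lam) ≤
        α * volume (Metric.closedBall (0 : Space d) ((d + 1) * ((⌊R⌋₊ : ℝ) + 1))) := by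
    by_contra hcon
    exact h (Set.mem_iUnion.2 ⟨⌊R⌋₊ + 1, ⌊R⌋₊, Nat.lt_succ_self _, not_le.1 hcon⟩)
  have hvol : volume (Metric.closedBall (0 : Space d) ((d + 1) * ((⌊R⌋₊ : ℝ) + 1))) ≤
      ENNReal.ofReal ((2 * R) ^ d) * volume (Metric.closedBall (0 : Space d) (d + 1)) := by
    rw [mul_comm, Measure.addHaar_closedBall_mul _ _ (by positivity) (by positivity),
      finrank_euclideanSpace_fin]
    have := Nat.floor_le hR0.le
    gcongr
    linarith
  exact (lintegral_mono_set hsub).trans (hball.trans (by gcongr))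

/-- The factor by which an average over a cube may exceed the supremum of the averages over the
balls of radii `(d + 1) * n`, `n ≥ 1`. -/
def maximalConst (d : ℕ) : ℝ := 2 ^ d * volume.real (Metric.closedBall (0 : Space d) (d + 1))

lemma maximalConst_pos (d : ℕ) : 0 < maximalConst d :=
  mul_pos (by positivity) (ENNReal.toReal_pos
    (Metric.measure_closedBall_pos _ _ (by positivity)).ne' measure_closedBall_lt_top.ne)

lemma norm_setAverage_cube_le_of_notMem_maximalSet {d : ℕ} {X : Type*}
    [AddAction (Space d) X] {e : X → ℂ} {a : ℝ} (ha : 0 ≤ a) {lam : X}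
    (h : lam ∉ ⋃ M, maximalSet (volume : Measure (Space d)) (fun lam => ‖e lam‖ₑ)
      (ENNReal.ofReal a) (fun n => (d + 1) * (n + 1)) M) {R : ℝ} (hR : 1 ≤ R) :
    ‖⨍ x in cube d R, e (-x +ᵥ lam)‖ ≤ maximalConst d * a := by
  have hR0 : 0 < R := by linarith
  have hint : ‖∫ x in cube d R, e (-x +ᵥ lam)‖ₑ ≤
      ENNReal.ofReal (R ^ d * (maximalConst d * a)) := by
    refine (enorm_integral_le_lintegral_enorm _).trans
      ((setLIntegral_cube_orbit_le_of_notMem_maximalSet h hR).trans_eq ?_)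
    rw [← ENNReal.ofReal_toReal (measure_closedBall_lt_top (x := (0 : Space d))).ne,
      ← ENNReal.ofReal_mul (by positivity), ← ENNReal.ofReal_mul ha, maximalConst, mul_pow,
      measureReal_def]
    ring_nf
  rw [← ofReal_norm, ENNReal.ofReal_le_ofReal_iff
    (mul_nonneg (by positivity) (mul_nonneg (maximalConst_pos d).le ha))] at hint
  rw [setAverage_eq, norm_smul, norm_inv, Real.norm_of_nonneg measureReal_nonneg,
    measureReal_cube hR0.le]
  exact (inv_mul_le_iff₀ (by positivity)).2 hint

variable {d : ℕ} {X : Type*} [MeasurableSpace X] [AddAction (Space d) X]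

/-- `b` is a bounded function whose averages over cubes tend to `0` along every orbit. These are
the functions for which the ergodic theorem with limit `0` needs no proof. -/
structure HasZeroOrbitMean (d : ℕ) {X : Type*} [MeasurableSpace X] [AddAction (Space d) X]
    (b : X → ℂ) : Prop where
  measurable : Measurable b
  bounded : ∃ C, ∀ lam, ‖b lam‖ ≤ C
  tendsto : ∀ lam, Tendsto (fun R => ⨍ x in cube d R, b (-x +ᵥ lam)) atTop (𝓝 0)

lemma hasZeroOrbitMean_zero : HasZeroOrbitMean d (0 : X → ℂ) :=
  ⟨measurable_zero, ⟨0, fun lam => by simp⟩, fun lam => by simp⟩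

lemma HasZeroOrbitMean.memLp {b : X → ℂ} (hb : HasZeroOrbitMean d b) {μ : Measure X}
    [IsFiniteMeasure μ] : MemLp b 2 μ := by
  obtain ⟨B, hB⟩ := hb.bounded
  exact MemLp.of_bound hb.measurable.aestronglyMeasurable B (ae_of_all _ hB)

lemma HasZeroOrbitMean.const_smul {b : X → ℂ} (hb : HasZeroOrbitMean d b) (c : ℂ) :
    HasZeroOrbitMean d (c • b) := by
  obtain ⟨B, hB⟩ := hb.bounded
  refine ⟨hb.measurable.const_smul c, ⟨‖c‖ * B, fun lam => ?_⟩, fun lam => ?_⟩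
  · rw [Pi.smul_apply, norm_smul]
    gcongr
    exact hB lam
  · simpa [average, integral_const_mul] using (hb.tendsto lam).const_mul c

variable [MeasurableVAdd₂ (Space d) X]

lemma integrableOn_orbit {F : X → ℂ} (hF : Measurable F) {C : ℝ} (hC : ∀ lam, ‖F lam‖ ≤ C)
    (lam : X) (R : ℝ) : IntegrableOn (fun x : Space d => F (-x +ᵥ lam)) (cube d R) :=
  Measure.integrableOn_of_bounded (volume_cube_lt_top R).ne
    (hF.comp (measurable_neg_vadd_right lam)).aestronglyMeasurable (ae_of_all _ fun _ => hC _)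

lemma setAverage_orbit_add {F G : X → ℂ} (hF : Measurable F) (hG : Measurable G) {A B : ℝ}
    (hA : ∀ lam, ‖F lam‖ ≤ A) (hB : ∀ lam, ‖G lam‖ ≤ B) (lam : X) (R : ℝ) :
    ⨍ x in cube d R, (F (-x +ᵥ lam) + G (-x +ᵥ lam)) =
      (⨍ x in cube d R, F (-x +ᵥ lam)) + ⨍ x in cube d R, G (-x +ᵥ lam) := by
  simp_rw [setAverage_eq, ← smul_add]
  rw [integral_add (integrableOn_orbit hF hA lam R) (integrableOn_orbit hG hB lam R)]

lemma HasZeroOrbitMean.add {b c : X → ℂ} (hb : HasZeroOrbitMean d b)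
    (hc : HasZeroOrbitMean d c) : HasZeroOrbitMean d (b + c) := by
  obtain ⟨B, hB⟩ := hb.bounded
  obtain ⟨C, hC⟩ := hc.bounded
  refine ⟨hb.measurable.add hc.measurable, ⟨B + C, fun lam => (norm_add_le _ _).trans
    (add_le_add (hB lam) (hC lam))⟩, fun lam => ?_⟩
  simpa only [Pi.add_apply, add_zero, setAverage_orbit_add hb.measurable hc.measurable hB hC]
    using (hb.tendsto lam).add (hc.tendsto lam)

lemma hasZeroOrbitMean_sub_vadd {h : X → ℂ} (hh : Measurable h) {C : ℝ}
    (hC : ∀ lam, ‖h lam‖ ≤ C) (t : Space d) :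
    HasZeroOrbitMean d fun lam => h lam - h (t +ᵥ lam) := by
  refine ⟨hh.sub (hh.comp (measurable_const_vadd t)), ⟨C + C, fun lam =>
    (norm_sub_le _ _).trans (add_le_add (hC _) (hC _))⟩, fun lam => ?_⟩
  refine (tendsto_setAverage_cube_sub_translate
    (hh.comp (measurable_neg_vadd_right lam)).aestronglyMeasurable (fun x => hC _) t).congr
    fun R => ?_
  simp only [Function.comp_apply, vadd_vadd, neg_sub]
  simp only [sub_eq_add_neg]

/-- The subspace of `L²` of the classes of functions with vanishing orbit means. -/
def zeroOrbitMeanSubmodule (d : ℕ) {X : Type*} [MeasurableSpace X] [AddAction (Space d) X]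
    [MeasurableVAdd₂ (Space d) X] (μ : Measure X) : Submodule ℂ (Lp ℂ 2 μ) where
  carrier := {u | ∃ b, HasZeroOrbitMean d b ∧ u =ᵐ[μ] b}
  add_mem' := by
    rintro u v ⟨b, hb, hub⟩ ⟨c, hc, hvc⟩
    exact ⟨b + c, hb.add hc, (Lp.coeFn_add u v).trans (hub.add hvc)⟩
  zero_mem' := ⟨0, hasZeroOrbitMean_zero, Lp.coeFn_zero _ _ _⟩
  smul_mem' := by
    rintro c u ⟨b, hb, hub⟩
    exact ⟨c • b, hb.const_smul c, (Lp.coeFn_smul c u).trans (hub.const_smul c)⟩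

lemma eventually_norm_setAverage_orbit_le {F b : X → ℂ} (hF : Measurable F) {C : ℝ}
    (hC : ∀ lam, ‖F lam‖ ≤ C) (hb : HasZeroOrbitMean d b) {a δ : ℝ} (ha : 0 ≤ a)
    (hδ : maximalConst d * a < δ) {lam : X}
    (h : lam ∉ ⋃ M, maximalSet (volume : Measure (Space d)) (fun lam => ‖F lam - b lam‖ₑ)
      (ENNReal.ofReal a) (fun n => (d + 1) * (n + 1)) M) :
    ∀ᶠ R in atTop, ‖⨍ x in cube d R, F (-x +ᵥ lam)‖ ≤ δ := by
  obtain ⟨B, hB⟩ := hb.bounded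
  have hFb : ∀ l, ‖F l - b l‖ ≤ C + B := fun l => (norm_sub_le _ _).trans
    (add_le_add (hC l) (hB l))
  have hsmall : ∀ᶠ R in atTop, ‖⨍ x in cube d R, b (-x +ᵥ lam)‖ ≤ δ - maximalConst d * a := by
    simpa using (hb.tendsto lam).norm.eventually (ge_mem_nhds (by simpa using hδ))
  filter_upwards [hsmall, eventually_ge_atTop 1] with R hR hR1
  have hsplit := setAverage_orbit_add (d := d) hb.measurable (hF.sub hb.measurable) hB hFb lam R
  simp only [Pi.sub_apply, add_sub_cancel] at hsplit
  rw [hsplit]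
  have hmax := norm_setAverage_cube_le_of_notMem_maximalSet ha h hR1
  linarith [norm_add_le (⨍ x in cube d R, b (-x +ᵥ lam))
    (⨍ x in cube d R, (F (-x +ᵥ lam) - b (-x +ᵥ lam)))]

variable {μ : Measure X} [IsProbabilityMeasure μ] [ErgodicVAdd (Space d) X μ]

-- Orthogonality to `1_s - 1_s(-t + ·)` says that `u` and `u (t + ·)` have the same integral
-- over `s`.
lemma exists_ae_eq_const_of_mem_orthogonal {u : Lp ℂ 2 μ}
    (hu : u ∈ (zeroOrbitMeanSubmodule d μ)ᗮ) : ∃ c : ℂ, u =ᵐ[μ] fun _ => c := by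
  have hui : Integrable u μ := (Lp.memLp u).integrable (by norm_num)
  refine exists_ae_eq_const_of_forall_vadd_ae_eq (G := Space d) (Lp.aestronglyMeasurable u)
    fun t => ?_
  have hmp := measurePreserving_vadd t μ
  refine (hmp.integrable_comp_of_integrable hui).ae_eq_of_forall_setIntegral_eq _ _ hui
    fun s hs _ => ?_
  have hst : MeasurableSet ((-t +ᵥ ·) ⁻¹' s : Set X) := measurable_const_vadd (-t) hs
  have hb : HasZeroOrbitMean d fun lam : X => s.indicator (1 : X → ℂ) lam -
      s.indicator 1 (-t +ᵥ lam) :=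
    hasZeroOrbitMean_sub_vadd (measurable_one.indicator hs) (C := 1)
      (fun lam => (norm_indicator_le_norm_self _ _).trans (by simp)) (-t)
  have horth := (Submodule.mem_orthogonal _ _).1 hu (hb.memLp.toLp _)
    ⟨_, hb, hb.memLp.coeFn_toLp⟩
  have hinner : (fun lam => inner ℂ ((hb.memLp (μ := μ)).toLp _ lam) (u lam)) =ᵐ[μ]
      fun lam => s.indicator u lam - ((-t +ᵥ ·) ⁻¹' s).indicator u lam := by
    filter_upwards [(hb.memLp (μ := μ)).coeFn_toLp] with lam hl
    rw [hl]
    by_cases h1 : lam ∈ s <;> by_cases h2 : -t +ᵥ lam ∈ s <;> simp [h1, h2]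
  rw [L2.inner_def, integral_congr_ae hinner, integral_sub (hui.indicator hs)
    (hui.indicator hst), integral_indicator hs, integral_indicator hst, sub_eq_zero] at horth
  rw [horth, ← hmp.setIntegral_preimage_emb (measurableEmbedding_const_vadd t) u
    ((-t +ᵥ ·) ⁻¹' s), ← Set.preimage_comp]
  simp only [Function.comp_def, neg_vadd_vadd, Set.preimage_id']

lemma mem_topologicalClosure_zeroOrbitMeanSubmodule {u : Lp ℂ 2 μ} (hu : ∫ lam, u lam ∂μ = 0) :
    u ∈ (zeroOrbitMeanSubmodule d μ).topologicalClosure := by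
  rw [← Submodule.orthogonal_orthogonal_eq_closure, Submodule.mem_orthogonal]
  intro v hv
  obtain ⟨c, hc⟩ := exists_ae_eq_const_of_mem_orthogonal hv
  have hinner : (fun lam => inner ℂ (v lam) (u lam)) =ᵐ[μ] fun lam => conj c * u lam := by
    filter_upwards [hc] with lam hl
    rw [hl, RCLike.inner_apply, mul_comm]
  rw [L2.inner_def, integral_congr_ae hinner, integral_const_mul, hu, mul_zero]

lemma exists_hasZeroOrbitMean_lintegral_sub_le {F : X → ℂ} (hF : MemLp F 2 μ)
    (hF0 : ∫ lam, F lam ∂μ = 0) {ε : ℝ} (hε : 0 < ε) :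
    ∃ b : X → ℂ, HasZeroOrbitMean d b ∧ ∫⁻ lam, ‖F lam - b lam‖ₑ ∂μ ≤ ENNReal.ofReal ε := by
  have hmem : hF.toLp F ∈ (zeroOrbitMeanSubmodule d μ).topologicalClosure :=
    mem_topologicalClosure_zeroOrbitMeanSubmodule
      ((integral_congr_ae hF.coeFn_toLp).trans hF0)
  obtain ⟨v, ⟨b, hb, hvb⟩, hdist⟩ := Metric.mem_closure_iff.1 hmem ε hε
  refine ⟨b, hb, ?_⟩
  calc ∫⁻ lam, ‖F lam - b lam‖ₑ ∂μ = eLpNorm (F - b) 1 μ :=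
        eLpNorm_one_eq_lintegral_enorm.symm
    _ ≤ eLpNorm (F - b) 2 μ :=
        eLpNorm_le_eLpNorm_of_exponent_le (by norm_num) (hF.sub hb.memLp).aestronglyMeasurable
    _ = eLpNorm (hF.toLp F - v : Lp ℂ 2 μ) 2 μ := by
        refine eLpNorm_congr_ae ?_
        filter_upwards [Lp.coeFn_sub (hF.toLp F) v, hF.coeFn_toLp, hvb] with lam h1 h2 h3
        rw [h1, Pi.sub_apply, Pi.sub_apply, h2, h3]
    _ = ENNReal.ofReal (dist (hF.toLp F) v) := by
        rw [dist_eq_norm, Lp.norm_def, ENNReal.ofReal_toReal (Lp.eLpNorm_ne_top _)]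
    _ ≤ ENNReal.ofReal ε := ENNReal.ofReal_le_ofReal hdist.le

lemma ae_eventually_norm_setAverage_cube_le {F : X → ℂ} (hF : Measurable F) {C : ℝ}
    (hC : ∀ lam, ‖F lam‖ ≤ C) (hF0 : ∫ lam, F lam ∂μ = 0) {δ : ℝ} (hδ : 0 < δ) :
    ∀ᵐ lam ∂μ, ∀ᶠ R in atTop, ‖⨍ x in cube d R, F (-x +ᵥ lam)‖ ≤ δ := by
  obtain ⟨a, ha, haδ⟩ : ∃ a : ℝ, 0 < a ∧ maximalConst d * a < δ := by
    refine ⟨δ / 2 / maximalConst d, div_pos (half_pos hδ) (maximalConst_pos d), ?_⟩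
    rw [mul_div_cancel₀ _ (maximalConst_pos d).ne']
    exact half_lt_self hδ
  set bad : Set X := {lam | ¬ ∀ᶠ R in atTop, ‖⨍ x in cube d R, F (-x +ᵥ lam)‖ ≤ δ}
  have hbad : ∀ ε : ℝ, 0 < ε → ENNReal.ofReal a * μ bad ≤ ENNReal.ofReal (8 ^ d * ε) := by
    intro ε hε
    obtain ⟨b, hb, hbε⟩ := exists_hasZeroOrbitMean_lintegral_sub_le (d := d)
      (MemLp.of_bound hF.aestronglyMeasurable C (ae_of_all μ hC)) hF0 hε
    have hmax := mul_measure_iUnion_maximalSet_le (ν := (volume : Measure (Space d))) (μ := μ)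
      (hF.sub hb.measurable).enorm (ENNReal.ofReal a) (ρ := fun n => (d + 1) * (n + 1))
      fun n => by positivity
    refine (mul_le_mul_right (measure_mono fun lam hlam => ?_) _).trans (hmax.trans ?_)
    · by_contra hnot
      exact hlam (eventually_norm_setAverage_orbit_le hF hC hb ha.le haδ hnot)
    · rw [ENNReal.ofReal_mul (by positivity), finrank_euclideanSpace_fin]
      gcongr
      exact hbε
  have hzero : ENNReal.ofReal a * μ bad = 0 := by
    refine le_antisymm (ENNReal.le_of_forall_pos_le_add fun ε hε _ => ?_) bot_le
    have h := hbad (ε / 8 ^ d) (by positivity)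
    rw [mul_div_cancel₀ _ (by positivity)] at h
    simpa using h
  exact (mul_eq_zero.1 hzero).resolve_left (ENNReal.ofReal_pos.2 ha).ne'

lemma ae_tendsto_setAverage_cube_zero {F : X → ℂ} (hF : Measurable F) {C : ℝ}
    (hC : ∀ lam, ‖F lam‖ ≤ C) (hF0 : ∫ lam, F lam ∂μ = 0) :
    ∀ᵐ lam ∂μ, Tendsto (fun R => ⨍ x in cube d R, F (-x +ᵥ lam)) atTop (𝓝 0) := by
  have h := ae_all_iff.2 fun n : ℕ => ae_eventually_norm_setAverage_cube_le (d := d) (μ := μ) hF hC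
    hF0 (δ := 1 / ((n : ℝ) + 1)) (by positivity)
  filter_upwards [h] with lam hl
  refine Metric.tendsto_nhds.2 fun ε hε => ?_
  obtain ⟨n, hn⟩ := exists_nat_one_div_lt hε
  filter_upwards [hl n] with R hR
  simpa using hR.trans_lt hn

theorem ae_tendsto_setAverage_cube {F : X → ℂ} (hF : Measurable F) {C : ℝ}
    (hC : ∀ lam, ‖F lam‖ ≤ C) :
    ∀ᵐ lam ∂μ, Tendsto (fun R => ⨍ x in cube d R, F (-x +ᵥ lam)) atTop
      (𝓝 (∫ lam, F lam ∂μ)) := by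
  set c := ∫ lam, F lam ∂μ with hc
  have hF0 : ∫ lam, (F lam - c) ∂μ = 0 := by
    rw [integral_sub (Integrable.of_bound hF.aestronglyMeasurable C (ae_of_all μ hC))
      (integrable_const c)]
    simp [hc]
  have hbound : ∀ lam, ‖F lam - c‖ ≤ C + ‖c‖ := fun lam =>
    (norm_sub_le _ _).trans (by gcongr; exact hC lam)
  filter_upwards [ae_tendsto_setAverage_cube_zero (d := d) (hF.sub_const c) hbound hF0]
    with lam hl
  rw [← zero_add c]
  refine (hl.add_const c).congr' ?_
  filter_upwards [eventually_gt_atTop 0] with R hR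
  have hconst : ⨍ _ in cube d R, c = c :=
    setAverage_const (ENNReal.toReal_pos_iff.1 (measureReal_cube_pos hR)).1.ne'
      (volume_cube_lt_top R).ne c
  nth_rewrite 2 [← hconst]
  have hsplit := setAverage_orbit_add (d := d) (hF.sub_const c) measurable_const hbound
    (fun _ => le_refl ‖c‖) lam R
  simpa only [sub_add_cancel] using hsplit.symm

end Ergodic

/-! ### Characters and densities -/

section Characters

variable {d : ℕ}

lemma continuous_chi_uncurry : Continuous fun p : Space d × Space d => chi p.1 p.2 :=
  continuous_subtype_val.comp (Real.continuous_fourierChar.comp (by fun_prop))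

lemma continuous_chi_neg_uncurry : Continuous fun p : Space d × Space d => chi (-p.1) p.2 :=
  continuous_subtype_val.comp (Real.continuous_fourierChar.comp (by fun_prop))

lemma continuous_chi (k : Space d) : Continuous (chi k) :=
  continuous_chi_uncurry.along_snd

lemma norm_chi (k x : Space d) : ‖chi k x‖ = 1 := Circle.norm_coe _

lemma chi_comm (k x : Space d) : chi k x = chi x k := by rw [chi, chi, real_inner_comm]

lemma chi_add_right (k x y : Space d) : chi k (x + y) = chi k x * chi k y := by
  simp [chi, inner_add_right, AddChar.map_add_eq_mul]

lemma chi_add_left (k l x : Space d) : chi (k + l) x = chi k x * chi l x := by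
  rw [chi_comm, chi_add_right, chi_comm x, chi_comm x]

lemma chi_zero_right (k : Space d) : chi k 0 = 1 := by simp [chi]

lemma chi_neg_left (k x : Space d) : chi (-k) x = conj (chi k x) := by
  simp [chi, inner_neg_left, AddChar.map_neg_eq_inv]

lemma chi_neg_right (k x : Space d) : chi k (-x) = conj (chi k x) := by
  rw [chi_comm, chi_neg_left, chi_comm]

lemma chi_neg_mul (k x : Space d) : chi (-k) x * chi k x = 1 := by
  rw [← chi_add_left, neg_add_cancel, chi_comm, chi_zero_right]

lemma fourier_eq_integral_chi (f : Space d → ℂ) (w : Space d) :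
    𝓕 f w = ∫ v, chi (-v) w * f v := by
  rw [Real.fourier_eq]
  simp only [chi, inner_neg_left, Circle.smul_def, smul_eq_mul]

lemma fourierInv_eq_integral_chi (f : Space d → ℂ) (w : Space d) :
    𝓕⁻ f w = ∫ v, chi v w * f v := by
  rw [Real.fourierInv_eq]
  simp only [chi, Circle.smul_def, smul_eq_mul]

lemma norm_fourier_comp_sub (f : Space d → ℂ) (a w : Space d) :
    ‖𝓕 (fun x => f (x - a)) w‖ = ‖𝓕 f w‖ := by
  rw [fourier_eq_integral_chi, fourier_eq_integral_chi,
    ← integral_add_right_eq_self (μ := volume) _ a]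
  simp_rw [add_sub_cancel_right, neg_add, chi_add_left, mul_right_comm _ (chi (-a) w)]
  rw [integral_mul_const, norm_mul, norm_chi, mul_one]

end Characters

section Density

variable {α : Type*} [MeasurableSpace α] {μ : Measure α}

lemma integral_withDensity_ofReal {f : α → ℝ} (hf : Measurable f) (h0 : ∀ x, 0 ≤ f x)
    (g : α → ℂ) :
    ∫ x, g x ∂μ.withDensity (fun x => ENNReal.ofReal (f x)) = ∫ x, (f x : ℂ) * g x ∂μ := by
  refine (integral_withDensity_eq_integral_smul hf.real_toNNReal g).trans ?_
  refine integral_congr_ae (ae_of_all _ fun x => ?_)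
  simp [NNReal.smul_def, h0 x]

lemma integrable_withDensity_ofReal_iff {f : α → ℝ} (hf : Measurable f) (h0 : ∀ x, 0 ≤ f x)
    (g : α → ℂ) :
    Integrable g (μ.withDensity fun x => ENNReal.ofReal (f x)) ↔
      Integrable (fun x => (f x : ℂ) * g x) μ := by
  refine (integrable_withDensity_iff_integrable_smul hf.real_toNNReal).trans ?_
  refine integrable_congr (ae_of_all _ fun x => ?_)
  simp [NNReal.smul_def, h0 x]

end Density

/-! ### Vague compactness of translation bounded measures -/

section VagueCompactness

open Module
open scoped ENNReal

lemma exists_ultrafilter_tendsto_of_compl_closedBall_le {E : Type*} [MetricSpace E]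
    [ProperSpace E] [MeasurableSpace E] [BorelSpace E] {ν : ℕ → FiniteMeasure E} (a : E)
    {C : NNReal} (hC : ∀ n, (ν n).mass ≤ C) {u : ℕ → NNReal} (hu : Tendsto u atTop (𝓝 0))
    (h : ∀ n (j : ℕ), ν n (Metric.closedBall a j)ᶜ ≤ u j) :
    ∃ (U : Ultrafilter ℕ) (ν₀ : FiniteMeasure E), (U : Filter ℕ) ≤ atTop ∧
      Tendsto ν U (𝓝 ν₀) := by
  have hcompact := isCompact_setOfPred_finiteMeasure_mass_le_compl_isCompact_le (E := E)
    (K := fun j : ℕ => Metric.closedBall a (j : ℝ)) C hu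
    (fun j => isCompact_closedBall _ _) (Or.inr fun i j hij =>
      Metric.closedBall_subset_closedBall (by exact_mod_cast hij))
  obtain ⟨ν₀, -, hν₀⟩ := hcompact.ultrafilter_le_nhds ((Ultrafilter.of atTop).map ν)
    (le_principal_iff.2 (Ultrafilter.mem_map.2 (Filter.univ_mem' fun n => ⟨hC n, h n⟩)))
  exact ⟨Ultrafilter.of atTop, ν₀, Ultrafilter.of_le _, hν₀⟩

section Normed

variable {E : Type*} [NormedAddCommGroup E] [MeasurableSpace E]

/-- The measure with density `decayWeight n` with respect to `ω`; it is finite if `ω` is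
translation bounded and `n` exceeds the dimension. -/
def decayMeasure (n : ℕ) (ω : Measure E) : Measure E :=
  ω.withDensity fun x => ENNReal.ofReal (decayWeight n x)

variable [OpensMeasurableSpace E]

lemma integral_decayMeasure (n : ℕ) (ω : Measure E) (φ : E → ℂ) :
    ∫ x, (((decayWeight n x)⁻¹ : ℝ) : ℂ) * φ x ∂decayMeasure n ω = ∫ x, φ x ∂ω := by
  rw [decayMeasure, integral_withDensity_ofReal (continuous_decayWeight n).measurable
    fun x => (decayWeight_pos n x).le]
  refine integral_congr_ae (ae_of_all _ fun x => ?_)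
  beta_reduce
  rw [← mul_assoc, ← Complex.ofReal_mul, mul_inv_cancel₀ (decayWeight_pos n x).ne',
    Complex.ofReal_one, one_mul]

lemma exists_measure_forall_integral_inv_decayWeight_mul (n : ℕ) (ν : Measure E)
    [IsFiniteMeasure ν] :
    ∃ ω : Measure E, Integrable (decayWeight n) ω ∧ ∀ φ : E → ℂ,
      ∫ x, φ x ∂ω = ∫ x, (((decayWeight n x)⁻¹ : ℝ) : ℂ) * φ x ∂ν := by
  have hm : Measurable fun x : E => (decayWeight n x)⁻¹ :=
    (continuous_decayWeight n).measurable.inv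
  have h0 : ∀ x : E, 0 ≤ (decayWeight n x)⁻¹ := fun x => (inv_pos.2 (decayWeight_pos n x)).le
  refine ⟨ν.withDensity fun x => ENNReal.ofReal (decayWeight n x)⁻¹, ?_,
    integral_withDensity_ofReal hm h0⟩
  have hone : Integrable (fun x : E => (decayWeight n x : ℂ))
      (ν.withDensity fun x => ENNReal.ofReal (decayWeight n x)⁻¹) := by
    refine (integrable_withDensity_ofReal_iff hm h0 _).2 ((integrable_const (1 : ℂ)).congr
      (ae_of_all _ fun x => ?_))
    beta_reduce
    rw [← Complex.ofReal_mul, inv_mul_cancel₀ (decayWeight_pos n x).ne', Complex.ofReal_one]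
  simpa using hone.re

end Normed

variable {E : Type*} [NormedAddCommGroup E] [NormedSpace ℝ E] [FiniteDimensional ℝ E]
  [MeasureSpace E] [BorelSpace E] [(volume : Measure E).IsAddHaarMeasure] {M : ℝ≥0∞}

lemma TranslationBounded.decayMeasure_univ_le {ω : Measure E} (h : TranslationBounded ω 1 M)
    (hM : M ≠ ⊤) (n : ℕ) : decayMeasure n ω Set.univ ≤ M * weightConst E 1 n := by
  rw [decayMeasure, withDensity_apply _ MeasurableSet.univ, Measure.restrict_univ]
  exact h.lintegral_decayWeight_le one_pos hM n

lemma TranslationBounded.decayMeasure_compl_closedBall_le {ω : Measure E}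
    (h : TranslationBounded ω 1 M) (hM : M ≠ ⊤) (n j : ℕ) :
    decayMeasure (n + 1) ω (Metric.closedBall 0 (j : ℝ))ᶜ ≤
      ENNReal.ofReal ((1 + j : ℝ)⁻¹) * (M * weightConst E 1 n) := by
  rw [decayMeasure, withDensity_apply _ Metric.isClosed_closedBall.measurableSet.compl]
  calc ∫⁻ x in (Metric.closedBall 0 (j : ℝ))ᶜ, ENNReal.ofReal (decayWeight (n + 1) x) ∂ω ≤
      ∫⁻ x in (Metric.closedBall 0 (j : ℝ))ᶜ,
        ENNReal.ofReal ((1 + j : ℝ)⁻¹) * ENNReal.ofReal (decayWeight n x) ∂ω := by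
        refine setLIntegral_mono' Metric.isClosed_closedBall.measurableSet.compl fun x hx => ?_
        have hx' : (j : ℝ) ≤ ‖x‖ := by simpa using (not_le.1 (mt mem_closedBall_zero_iff.2 hx)).le
        rw [← ENNReal.ofReal_mul (by positivity)]
        refine ENNReal.ofReal_le_ofReal ?_
        rw [← pow_mul_decayWeight_add 1 n x, pow_one, inv_mul_eq_div,
          le_div_iff₀ (by positivity), mul_comm]
        have := (decayWeight_pos (n + 1) x).le
        gcongr
    _ ≤ ∫⁻ x, ENNReal.ofReal ((1 + j : ℝ)⁻¹) * ENNReal.ofReal (decayWeight n x) ∂ω :=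
        setLIntegral_le_lintegral _ _
    _ = ENNReal.ofReal ((1 + j : ℝ)⁻¹) * ∫⁻ x, ENNReal.ofReal (decayWeight n x) ∂ω :=
        lintegral_const_mul _ (continuous_decayWeight n).measurable.ennreal_ofReal
    _ ≤ ENNReal.ofReal ((1 + j : ℝ)⁻¹) * (M * weightConst E 1 n) := by
        gcongr
        exact h.lintegral_decayWeight_le one_pos hM n

lemma exists_ultrafilter_tendsto_decayMeasure (hM : M ≠ ⊤) {ω : ℕ → Measure E}
    (hω : ∀ k, TranslationBounded (ω k) 1 M) {n : ℕ} (hn : finrank ℝ E < n) :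
    ∃ (U : Ultrafilter ℕ) (ν₀ : FiniteMeasure E), (U : Filter ℕ) ≤ atTop ∧
      ∀ ψ : BoundedContinuousFunction E ℂ,
        Tendsto (fun k => ∫ x, ψ x ∂decayMeasure (n + 1) (ω k)) U (𝓝 (∫ x, ψ x ∂ν₀)) := by
  have hfinite : ∀ {l}, finrank ℝ E < l → M * weightConst E 1 l ≠ ⊤ := fun hl =>
    (ENNReal.mul_lt_top hM.lt_top (weightConst_lt_top one_pos hl)).ne
  have hC := hfinite (Nat.lt_succ_of_lt hn)
  set ν : ℕ → FiniteMeasure E := fun k => ⟨decayMeasure (n + 1) (ω k),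
    ⟨((hω k).decayMeasure_univ_le hM (n + 1)).trans_lt hC.lt_top⟩⟩
  have hmass : ∀ k, (ν k).mass ≤ (M * weightConst E 1 (n + 1)).toNNReal := fun k => by
    rw [← ENNReal.coe_le_coe, FiniteMeasure.ennreal_mass, ENNReal.coe_toNNReal hC]
    exact (hω k).decayMeasure_univ_le hM (n + 1)
  have htail : ∀ k (j : ℕ), ν k (Metric.closedBall 0 j)ᶜ ≤
      Real.toNNReal (1 + j : ℝ)⁻¹ * (M * weightConst E 1 n).toNNReal := fun k j => by
    rw [← ENNReal.coe_le_coe, FiniteMeasure.ennreal_coeFn_eq_coeFn_toMeasure, ENNReal.coe_mul,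
      ENNReal.coe_toNNReal (hfinite hn)]
    exact (hω k).decayMeasure_compl_closedBall_le hM n j
  have hzero : Tendsto (fun j : ℕ => Real.toNNReal (1 + j : ℝ)⁻¹ *
      (M * weightConst E 1 n).toNNReal) atTop (𝓝 0) := by
    have hinv : Tendsto (fun j : ℕ => (1 + j : ℝ)⁻¹) atTop (𝓝 0) := by
      simpa [add_comm] using tendsto_one_div_add_atTop_nhds_zero_nat (𝕜 := ℝ)
    simpa using (tendsto_real_toNNReal hinv).mul_const (M * weightConst E 1 n).toNNReal
  obtain ⟨U, ν₀, hU, hlim⟩ := exists_ultrafilter_tendsto_of_compl_closedBall_le 0 hmass hzero htail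
  exact ⟨U, ν₀, hU, (FiniteMeasure.tendsto_iff_forall_integral_rclike_tendsto ℂ).1 hlim⟩

theorem exists_ultrafilter_tendsto_integral (hM : M ≠ ⊤) {ω : ℕ → Measure E}
    (hω : ∀ k, TranslationBounded (ω k) 1 M) {n : ℕ} (hn : finrank ℝ E < n) :
    ∃ (U : Ultrafilter ℕ) (ω' : Measure E), (U : Filter ℕ) ≤ atTop ∧
      Integrable (decayWeight (n + 1)) ω' ∧ ∀ (φ : E → ℂ) (A : ℝ), Continuous φ →
        (∀ x, ‖φ x‖ ≤ A * decayWeight (n + 1) x) →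
          Tendsto (fun k => ∫ x, φ x ∂ω k) U (𝓝 (∫ x, φ x ∂ω')) := by
  obtain ⟨U, ν₀, hU, hlim⟩ := exists_ultrafilter_tendsto_decayMeasure hM hω hn
  obtain ⟨ω', hω', hint⟩ :=
    exists_measure_forall_integral_inv_decayWeight_mul (n + 1) (ν₀ : Measure E)
  refine ⟨U, ω', hU, hω', fun φ A hφ hA => ?_⟩
  have hcont : Continuous fun x => (((decayWeight (n + 1) x)⁻¹ : ℝ) : ℂ) * φ x :=
    (Complex.continuous_ofReal.comp ((continuous_decayWeight (n + 1)).inv₀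
      fun x => (decayWeight_pos _ x).ne')).mul hφ
  have hbound : ∀ x, ‖(((decayWeight (n + 1) x)⁻¹ : ℝ) : ℂ) * φ x‖ ≤ A := fun x => by
    rw [norm_mul, Complex.norm_real, Real.norm_of_nonneg (inv_pos.2 (decayWeight_pos _ x)).le,
      inv_mul_le_iff₀ (decayWeight_pos _ x), mul_comm]
    exact hA x
  have h := hlim (BoundedContinuousFunction.ofNormedAddCommGroup _ hcont A hbound)
  simp only [BoundedContinuousFunction.coe_ofNormedAddCommGroup, integral_decayMeasure] at h
  rwa [hint]

end VagueCompactness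

/-! ### The Bochner-Schwartz theorem for translation bounded measures -/

section BochnerSchwartz

open Module
open scoped ENNReal ComplexOrder

variable {ι : Type*} [Fintype ι]

/-- The linear functional `∑ i, c i • τ i` on test functions; a real combination of infinite
measures need not be a signed measure. -/
def combination {α : Type*} [MeasurableSpace α] (c : ι → ℝ) (τ : ι → Measure α) (φ : α → ℂ) : ℂ :=
  ∑ i, (c i : ℂ) * ∫ x, φ x ∂τ i

section Normed

variable {E : Type*} [NormedAddCommGroup E] [NormedSpace ℝ E] [FiniteDimensional ℝ E]
  [MeasureSpace E] [BorelSpace E] [(volume : Measure E).IsAddHaarMeasure]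
  {c : ι → ℝ} {τ : ι → Measure E} {ρ : ℝ} {M : ι → ℝ≥0∞} {φ : E → ℂ} {A : ℝ} {n : ℕ}

lemma norm_combination_le (hρ : 0 < ρ) (hM : ∀ i, M i ≠ ⊤)
    (hτ : ∀ i, TranslationBounded (τ i) ρ (M i)) (hn : finrank ℝ E < n) (hA : 0 ≤ A)
    (hφ : ∀ x, ‖φ x‖ ≤ A * decayWeight n x) :
    ‖combination c τ φ‖ ≤ A * ∑ i, |c i| * (M i * weightConst E ρ n).toReal := by
  refine (norm_sum_le _ _).trans ?_
  rw [Finset.mul_sum]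
  refine Finset.sum_le_sum fun i _ => ?_
  rw [norm_mul, Complex.norm_real, Real.norm_eq_abs, mul_left_comm]
  gcongr
  exact (norm_integral_le_integral_norm _).trans ((hτ i).integral_norm_le hρ (hM i) hn hA hφ)

lemma tendsto_combination_mul (hρ : 0 < ρ) (hM : ∀ i, M i ≠ ⊤)
    (hτ : ∀ i, TranslationBounded (τ i) ρ (M i)) (hn : finrank ℝ E < n) {g : ℕ → E → ℂ}
    (hg : ∀ k, Continuous (g k)) (hg1 : ∀ k x, ‖g k x‖ ≤ 1)
    (hlim : ∀ x, Tendsto (fun k => g k x) atTop (𝓝 1)) (hφ : Continuous φ)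
    (hA : ∀ x, ‖φ x‖ ≤ A * decayWeight n x) :
    Tendsto (fun k => combination c τ fun x => φ x * g k x) atTop (𝓝 (combination c τ φ)) := by
  refine tendsto_finsetSum _ fun i _ => Tendsto.const_mul _ ?_
  have hi : Integrable φ (τ i) :=
    (hτ i).integrable_of_le hρ (hM i) hn hφ.aestronglyMeasurable hA
  refine tendsto_integral_of_dominated_convergence (fun x => ‖φ x‖)
    (fun k => (hφ.mul (hg k)).aestronglyMeasurable) hi.norm (fun k => ae_of_all _ fun x => ?_)
    (ae_of_all _ fun x => ?_)
  · rw [norm_mul]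
    exact mul_le_of_le_one_right (norm_nonneg _) (hg1 k x)
  · simpa using (hlim x).const_mul (φ x)

end Normed

variable {d : ℕ} {c : ι → ℝ}

lemma integrable_chi_neg_mul {τ : Measure (Space d)} {g φ : Space d → ℂ}
    (hg : Integrable g τ) (hφ : Integrable φ) :
    Integrable (fun p : Space d × Space d => chi (-p.1) p.2 * (φ p.1 * g p.2))
      (volume.prod τ) :=
  (hφ.mul_prod hg).bdd_mul (c := 1) continuous_chi_neg_uncurry.aestronglyMeasurable
    (ae_of_all _ fun _ => (norm_chi _ _).le)

lemma integral_integral_chi_neg_mul {τ : Measure (Space d)} [SFinite τ] {g φ : Space d → ℂ}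
    (hg : Integrable g τ) (hφ : Integrable φ) :
    ∫ k, (∫ x, chi (-k) x * (φ k * g x) ∂τ) = ∫ x, 𝓕 φ x * g x ∂τ := by
  rw [integral_integral_swap (integrable_chi_neg_mul hg hφ)]
  refine integral_congr_ae (ae_of_all _ fun x => ?_)
  simp only [fourier_eq_integral_chi, ← mul_assoc, integral_mul_const]

lemma mul_combination_chi_neg {τ : ι → Measure (Space d)} {g φ : Space d → ℂ} (k : Space d) :
    φ k * combination c τ (fun x => chi (-k) x * g x) =
      ∑ i, (c i : ℂ) * ∫ x, chi (-k) x * (φ k * g x) ∂τ i := by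
  simp_rw [combination, Finset.mul_sum, mul_left_comm _ (φ k), integral_const_mul]
  exact Finset.sum_congr rfl fun i _ => mul_left_comm _ _ _

section Integrable

variable {τ : ι → Measure (Space d)} [∀ i, SFinite (τ i)] {g φ : Space d → ℂ}

lemma integrable_mul_combination (hg : ∀ i, Integrable g (τ i)) (hφ : Integrable φ) :
    Integrable fun k => φ k * combination c τ fun x => chi (-k) x * g x := by
  simp_rw [mul_combination_chi_neg]
  exact integrable_finsetSum _ fun i _ =>
    (integrable_chi_neg_mul (hg i) hφ).integral_prod_left.const_mul _

lemma integral_mul_combination (hg : ∀ i, Integrable g (τ i)) (hφ : Integrable φ) :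
    ∫ k, φ k * combination c τ (fun x => chi (-k) x * g x) =
      combination c τ fun x => 𝓕 φ x * g x := by
  simp_rw [mul_combination_chi_neg]
  rw [integral_finsetSum _ fun i _ =>
    (integrable_chi_neg_mul (hg i) hφ).integral_prod_left.const_mul _, combination]
  simp_rw [integral_const_mul, integral_integral_chi_neg_mul (hg _) hφ]

lemma measurable_combination_chi (hg : Continuous g) :
    Measurable fun k => combination c τ fun x => chi (-k) x * g x := by
  refine Finset.measurable_sum _ fun i _ => Measurable.const_mul ?_ _
  exact ((continuous_chi_neg_uncurry.mul
    (hg.comp continuous_snd)).stronglyMeasurable.integral_prod_right').measurable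

end Integrable

/-- The measure with density `k ↦ L (x ↦ exp (-2πi k·x) g x)`, where `L = combination c τ`, that
is, the Fourier transform of `g • L`; used when the density is nonnegative. -/
def densityMeasure (c : ι → ℝ) (τ : ι → Measure (Space d)) (g : Space d → ℂ) :
    Measure (Space d) :=
  volume.withDensity fun k =>
    ENNReal.ofReal (combination c τ fun x => chi (-k) x * g x).re

section DensityMeasure

variable {τ : ι → Measure (Space d)} [∀ i, SFinite (τ i)] {g φ : Space d → ℂ}

lemma integrable_densityMeasure (hg : Continuous g) (hgi : ∀ i, Integrable g (τ i))
    (hpos : ∀ k, 0 ≤ combination c τ fun x => chi (-k) x * g x) (hφ : Integrable φ) :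
    Integrable φ (densityMeasure c τ g) := by
  have hre : Measurable fun k => (combination c τ fun x => chi (-k) x * g x).re :=
    Complex.measurable_re.comp (measurable_combination_chi hg)
  rw [densityMeasure, integrable_withDensity_ofReal_iff hre
    fun k => (Complex.nonneg_iff.1 (hpos k)).1]
  refine (integrable_mul_combination (c := c) hgi hφ).congr (ae_of_all _ fun k => ?_)
  beta_reduce
  rw [← Complex.eq_re_of_ofReal_le (hpos k), mul_comm]

lemma integral_densityMeasure (hg : Continuous g) (hgi : ∀ i, Integrable g (τ i))
    (hpos : ∀ k, 0 ≤ combination c τ fun x => chi (-k) x * g x) (hφ : Integrable φ) :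
    ∫ k, φ k ∂densityMeasure c τ g = combination c τ fun x => 𝓕 φ x * g x := by
  have hre : Measurable fun k => (combination c τ fun x => chi (-k) x * g x).re :=
    Complex.measurable_re.comp (measurable_combination_chi hg)
  rw [densityMeasure, integral_withDensity_ofReal hre
    (fun k => (Complex.nonneg_iff.1 (hpos k)).1), ← integral_mul_combination hgi hφ]
  refine integral_congr_ae (ae_of_all _ fun k => ?_)
  beta_reduce
  rw [← Complex.eq_re_of_ofReal_le (hpos k), mul_comm]

end DensityMeasure

lemma measure_ball_le_norm_integral_sub {f : Space d → ℝ} (h0 : ∀ x, 0 ≤ f x)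
    (h1 : ∀ x ∈ Metric.ball 0 1, f x = 1) {ω : Measure (Space d)} {a : Space d}
    (hf : Integrable (fun x => (f (x - a) : ℂ)) ω) :
    ω (Metric.ball a 1) ≤ ENNReal.ofReal ‖∫ x, (f (x - a) : ℂ) ∂ω‖ := by
  calc ω (Metric.ball a 1) = ∫⁻ x, (Metric.ball a 1).indicator 1 x ∂ω :=
        (lintegral_indicator_one measurableSet_ball).symm
    _ ≤ ∫⁻ x, ENNReal.ofReal (f (x - a)) ∂ω := by
        refine lintegral_mono fun x => Set.indicator_apply_le' (fun hx => ?_) fun _ => bot_le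
        rw [h1 (x - a) (by rwa [mem_ball_zero_iff, ← mem_ball_iff_norm])]
        simp
    _ = ENNReal.ofReal (∫ x, f (x - a) ∂ω) :=
        (ofReal_integral_eq_lintegral_ofReal (by simpa using hf.re)
          (ae_of_all _ fun x => h0 _)).symm
    _ = ENNReal.ofReal ‖∫ x, (f (x - a) : ℂ) ∂ω‖ := by
        rw [integral_complex_ofReal, Complex.norm_real,
          Real.norm_of_nonneg (integral_nonneg fun x => h0 _)]

lemma exists_schwartz_eq_one_on_ball (d : ℕ) :
    ∃ (b : Space d → ℝ) (f : 𝓢(Space d, ℂ)), (∀ x, 0 ≤ b x) ∧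
      (∀ x ∈ Metric.ball 0 1, b x = 1) ∧ ∀ x, f x = (b x : ℂ) := by
  let b : ContDiffBump (0 : Space d) := ⟨1, 2, one_pos, one_lt_two⟩
  have hsupp : HasCompactSupport fun x : Space d => (b x : ℂ) :=
    b.hasCompactSupport.comp_left (g := Complex.ofReal) Complex.ofReal_zero
  have hdiff : ContDiff ℝ ((⊤ : ℕ∞) : WithTop ℕ∞) fun x : Space d => (b x : ℂ) :=
    Complex.ofRealCLM.contDiff.comp b.contDiff
  exact ⟨b, hsupp.toSchwartzMap hdiff, fun _ => b.nonneg,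
    fun x hx => b.one_of_mem_closedBall (Metric.ball_subset_closedBall hx), fun _ => rfl⟩

-- The mass of the ball about `a` is tested by a bump function centred at `a`. Translating the bump
-- does not change the modulus of its Fourier transform, so the bound does not depend on `a`.
theorem exists_translationBounded_densityMeasure {τ : ι → Measure (Space d)} {ρ : ℝ} (hρ : 0 < ρ)
    {M : ι → ℝ≥0∞} (hM : ∀ i, M i ≠ ⊤) (hτ : ∀ i, TranslationBounded (τ i) ρ (M i)) (c : ι → ℝ) :
    ∃ C : ℝ≥0∞, C ≠ ⊤ ∧ ∀ g : Space d → ℂ, Continuous g → (∀ x, ‖g x‖ ≤ 1) →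
      (∀ i, Integrable g (τ i)) → (∀ k, 0 ≤ combination c τ fun x => chi (-k) x * g x) →
        TranslationBounded (densityMeasure c τ g) 1 C := by
  have : ∀ i, IsLocallyFiniteMeasure (τ i) := fun i => (hτ i).isLocallyFiniteMeasure hρ (hM i)
  obtain ⟨b, f, hb0, hb1, hfb⟩ := exists_schwartz_eq_one_on_ball d
  obtain ⟨A, hA0, hA⟩ := exists_norm_schwartzMap_le_decayWeight (𝓕 f : 𝓢(Space d, ℂ)) (d + 1)
  refine ⟨ENNReal.ofReal (A * ∑ i, |c i| * (M i * weightConst (Space d) ρ (d + 1)).toReal),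
    ENNReal.ofReal_ne_top, fun g hg hg1 hgi hpos a => ?_⟩
  have hshift : (fun x => (b (x - a) : ℂ)) = fun x => f (x - a) := funext fun x => (hfb _).symm
  have hfi : Integrable fun x => f (x - a) := f.integrable.comp_sub_right a
  have hball := measure_ball_le_norm_integral_sub hb0 hb1 (a := a)
    (hshift ▸ integrable_densityMeasure hg hgi hpos hfi)
  rw [hshift, integral_densityMeasure hg hgi hpos hfi] at hball
  refine hball.trans (ENNReal.ofReal_le_ofReal (norm_combination_le hρ hM hτ (n := d + 1)
    (by simp) hA0 fun x => ?_))
  rw [norm_mul, norm_fourier_comp_sub]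
  exact (mul_le_of_le_one_right (norm_nonneg _) (hg1 x)).trans (hA x)

theorem exists_isFourierTransform_combination {τ : ι → Measure (Space d)} {ρ : ℝ} (hρ : 0 < ρ)
    {M : ι → ℝ≥0∞} (hM : ∀ i, M i ≠ ⊤) (hτ : ∀ i, TranslationBounded (τ i) ρ (M i))
    {g : ℕ → Space d → ℂ} (hg : ∀ n, Continuous (g n)) (hg1 : ∀ n x, ‖g n x‖ ≤ 1)
    (hlim : ∀ x, Tendsto (fun n => g n x) atTop (𝓝 1)) (hgi : ∀ n i, Integrable (g n) (τ i))
    (hpos : ∀ n k, 0 ≤ combination c τ fun x => chi (-k) x * g n x) :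
    ∃ ω : Measure (Space d), Integrable (decayWeight (d + 2)) ω ∧
      IsFourierTransform (combination c τ) ω := by
  have : ∀ i, IsLocallyFiniteMeasure (τ i) := fun i => (hτ i).isLocallyFiniteMeasure hρ (hM i)
  obtain ⟨C, hC, hbound⟩ := exists_translationBounded_densityMeasure hρ hM hτ c
  obtain ⟨U, ω, hU, hω, htest⟩ := exists_ultrafilter_tendsto_integral (n := d + 1) hC
    (fun n => hbound _ (hg n) (hg1 n) (hgi n) (hpos n)) (by simp)
  refine ⟨ω, hω, fun φ => ?_⟩
  obtain ⟨A, -, hA⟩ := exists_norm_schwartzMap_le_decayWeight φ (d + 2)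
  obtain ⟨B, -, hB⟩ := exists_norm_schwartzMap_le_decayWeight (𝓕 φ : 𝓢(Space d, ℂ)) (d + 1)
  refine ⟨(hω.const_mul A).mono' φ.continuous.aestronglyMeasurable (ae_of_all _ hA), ?_⟩
  have hcomb := (tendsto_combination_mul (c := c) hρ hM hτ (by simp) hg hg1 hlim
    (𝓕 φ : 𝓢(Space d, ℂ)).continuous hB).mono_left hU
  refine tendsto_nhds_unique (htest φ A φ.continuous hA) (hcomb.congr fun n => ?_)
  exact (integral_densityMeasure (hg n) (hgi n) (hpos n) φ.integrable).symm

end BochnerSchwartz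

/-! ### Correlations of functions -/

section Correlation

variable {d : ℕ} {f g : Space d → ℂ} {A B : ℝ}

/-- The correlation `x ↦ ∫ f (x + y) conj (g y) dy`, that is `f * g~`. -/
def correlation (f g : Space d → ℂ) (x : Space d) : ℂ := ∫ y, f (x + y) * conj (g y)

lemma norm_correlation_integrand_le (hA0 : 0 ≤ A) (hB0 : 0 ≤ B)
    (hA : ∀ x, ‖f x‖ ≤ A * decayWeight (d + 1) x)
    (hB : ∀ x, ‖g x‖ ≤ B * decayWeight (d + 1 + (d + 1)) x) (x y : Space d) :
    ‖f (x + y) * conj (g y)‖ ≤ (A * decayWeight (d + 1) x) * (B * decayWeight (d + 1) y) := by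
  rw [norm_mul, RCLike.norm_conj]
  calc ‖f (x + y)‖ * ‖g y‖
      ≤ (A * decayWeight (d + 1) (x + y)) * (B * decayWeight (d + 1 + (d + 1)) y) := by
        have := (decayWeight_pos (d + 1) (x + y)).le
        gcongr
        exacts [hA _, hB _]
    _ = A * B * (decayWeight (d + 1 + (d + 1)) y * decayWeight (d + 1) (x + y)) := by ring
    _ ≤ A * B * (decayWeight (d + 1) y * decayWeight (d + 1) x) := by
        exact mul_le_mul_of_nonneg_left (decayWeight_mul_le _ _ _) (mul_nonneg hA0 hB0)
    _ = (A * decayWeight (d + 1) x) * (B * decayWeight (d + 1) y) := by ring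

lemma norm_correlation_le (hA0 : 0 ≤ A) (hB0 : 0 ≤ B)
    (hA : ∀ x, ‖f x‖ ≤ A * decayWeight (d + 1) x)
    (hB : ∀ x, ‖g x‖ ≤ B * decayWeight (d + 1 + (d + 1)) x) (x : Space d) :
    ‖correlation f g x‖ ≤
      (A * (B * ∫ y : Space d, decayWeight (d + 1) y)) * decayWeight (d + 1) x := by
  refine (norm_integral_le_of_norm_le
    (((integrable_decayWeight (E := Space d) (by simp)).const_mul B).const_mul
      (A * decayWeight (d + 1) x))
    (ae_of_all _ (norm_correlation_integrand_le hA0 hB0 hA hB x))).trans (le_of_eq ?_)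
  rw [integral_const_mul, integral_const_mul]
  ring

lemma measurable_correlation_integrand (hf : Measurable f) (hg : Measurable g) :
    Measurable fun p : Space d × Space d => f (p.1 + p.2) * conj (g p.2) :=
  (hf.comp measurable_add).mul (Complex.continuous_conj.measurable.comp (hg.comp measurable_snd))

lemma measurable_correlation (hf : Measurable f) (hg : Measurable g) :
    Measurable (correlation f g) :=
  (measurable_correlation_integrand hf hg).stronglyMeasurable.integral_prod_right'.measurable

lemma integral_correlation (hf : Measurable f) (hg : Measurable g) (hA0 : 0 ≤ A) (hB0 : 0 ≤ B)
    (hA : ∀ x, ‖f x‖ ≤ A * decayWeight (d + 1) x)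
    (hB : ∀ x, ‖g x‖ ≤ B * decayWeight (d + 1 + (d + 1)) x) {τ : Measure (Space d)} [SFinite τ]
    (hτ : Integrable (decayWeight (d + 1)) τ) :
    ∫ x, correlation f g x ∂τ = ∫ y, conj (g y) * ∫ x, f (y + x) ∂τ := by
  have hint : Integrable (fun p : Space d × Space d => f (p.1 + p.2) * conj (g p.2))
      (τ.prod volume) :=
    ((hτ.const_mul A).mul_prod ((integrable_decayWeight (by simp)).const_mul B)).mono'
      (measurable_correlation_integrand hf hg).aestronglyMeasurable
      (ae_of_all _ fun p => norm_correlation_integrand_le hA0 hB0 hA hB p.1 p.2)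
  simp only [correlation]
  rw [integral_integral_swap hint]
  refine integral_congr_ae (ae_of_all _ fun y => ?_)
  beta_reduce
  rw [integral_mul_const, mul_comm]
  simp only [add_comm]

end Correlation

/-! ### The Palm measures -/

section Palm

open ProbabilityTheory
open scoped ENNReal

variable {d m : ℕ} {r : ℝ} {μ : Measure (Config d m r)}

lemma measurable_integral_colour {f : Space d → ℂ} (hf : Measurable f) (i : Fin m) :
    Measurable fun lam : Config d m r => ∫ x, f x ∂colour i lam :=
  (hf.stronglyMeasurable.integral_kernel (κ := colourKernel i)).measurable

/-- The expected number of points of colour `i` in a set, seen from which the configuration lies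
in `D`. -/
def markedIntensity (μ : Measure (Config d m r)) (i : Fin m) (D : Set (Config d m r)) :
    Measure (Space d) :=
  ((μ ⊗ₘ colourKernel i).restrict {p | -p.2 +ᵥ p.1 ∈ D}).map Prod.snd

/-- The first moment measure of colour `p.2` under the Palm measure of colour `p.1`. -/
def palmIntensity (μ : Measure (Config d m r)) (p : Fin m × Fin m) : Measure (Space d) :=
  (palm μ p.1).bind (colour p.2)

lemma translationBounded_palmIntensity (μ : Measure (Config d m r)) (p : Fin m × Fin m) :
    TranslationBounded (palmIntensity μ p) (r / 2) (palm μ p.1 Set.univ) := by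
  intro x
  rw [palmIntensity, Measure.bind_apply measurableSet_ball (measurable_colour _).aemeasurable]
  refine (lintegral_mono fun lam => translationBounded_colour _ lam x).trans_eq ?_
  rw [lintegral_const, one_mul]

variable [hr : Fact (0 < r)]

lemma integrable_colour_integral [IsFiniteMeasure μ] {f : Space d → ℂ} {A : ℝ}
    (hf : Measurable f) (hA0 : 0 ≤ A) (hA : ∀ x, ‖f x‖ ≤ A * decayWeight (d + 1) x) (i : Fin m) :
    Integrable (fun lam => ∫ x, f x ∂colour i lam) μ :=
  Integrable.of_bound (measurable_integral_colour hf i).aestronglyMeasurable _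
    (ae_of_all _ (norm_integral_colour_le hA0 hA i))

lemma integral_countingFn [IsFiniteMeasure μ] (w : Fin m → ℝ) {f : Space d → ℂ} {A : ℝ}
    (hf : Measurable f) (hA0 : 0 ≤ A) (hA : ∀ x, ‖f x‖ ≤ A * decayWeight (d + 1) x) :
    ∫ lam, countingFn w f lam ∂μ = ∑ i, (w i : ℂ) * ∫ lam, ∫ x, f x ∂colour i lam ∂μ := by
  simp only [countingFn]
  rw [integral_finsetSum _ fun i _ => (integrable_colour_integral hf hA0 hA i).const_mul _]
  simp_rw [integral_const_mul]

lemma integrable_compProd_of_le [IsFiniteMeasure μ] (j : Fin m)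
    {h : Config d m r × Space d → ℂ} (hm : Measurable h) {B : ℝ} (hB : 0 ≤ B)
    (hle : ∀ p, ‖h p‖ ≤ B * decayWeight (d + 1) p.2) :
    Integrable h (μ ⊗ₘ colourKernel j) := by
  refine ⟨hm.aestronglyMeasurable, ?_⟩
  rw [hasFiniteIntegral_iff_enorm, Measure.lintegral_compProd hm.enorm]
  have hfibre : ∀ lam, ∫⁻ x, ‖h (lam, x)‖ₑ ∂colour j lam ≤
      ENNReal.ofReal B * weightConst (Space d) (r / 2) (d + 1) := fun lam => by
    refine le_trans (lintegral_mono fun x => ?_) ((lintegral_const_mul _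
      (continuous_decayWeight (d + 1)).measurable.ennreal_ofReal).trans_le
      (mul_le_mul_right (lintegral_colour_decayWeight_le j lam (d + 1)) _))
    rw [← ofReal_norm, ← ENNReal.ofReal_mul hB]
    exact ENNReal.ofReal_le_ofReal (hle (lam, x))
  refine (lintegral_mono hfibre).trans_lt ?_
  rw [lintegral_const]
  exact ENNReal.mul_lt_top (ENNReal.mul_lt_top ENNReal.ofReal_lt_top weightConst_colour_lt_top)
    (measure_lt_top _ _)

lemma measurableSet_marked {B : Set (Space d)} (hB : MeasurableSet B)
    {D : Set (Config d m r)} (hD : MeasurableSet D) :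
    MeasurableSet {p : Config d m r × Space d | p.2 ∈ B ∧ -p.2 +ᵥ p.1 ∈ D} :=
  (measurable_snd hB).inter (measurable_neg_vadd hD)

lemma map_restrict_colour_apply (i : Fin m) (lam : Config d m r) {B : Set (Space d)}
    {D : Set (Config d m r)} (hD : MeasurableSet D) :
    ((colour i lam).restrict B).map (fun x : Space d => (-x) +ᵥ lam) D =
      colour i lam {x | x ∈ B ∧ -x +ᵥ lam ∈ D} := by
  rw [Measure.map_apply (measurable_neg_vadd_right lam) hD,
    Measure.restrict_apply (measurable_neg_vadd_right lam hD), Set.inter_comm]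
  rfl

lemma measurable_colour_marked (i : Fin m) {B : Set (Space d)} (hB : MeasurableSet B)
    {D : Set (Config d m r)} (hD : MeasurableSet D) :
    Measurable fun lam : Config d m r => colour i lam {x | x ∈ B ∧ -x +ᵥ lam ∈ D} :=
  Kernel.measurable_kernel_prodMk_left (κ := colourKernel i) (measurableSet_marked hB hD)

lemma palm_apply (i : Fin m) {D : Set (Config d m r)} (hD : MeasurableSet D) :
    palm μ i D = ∫⁻ lam, colour i lam {x | x ∈ cube d 1 ∧ -x +ᵥ lam ∈ D} ∂μ := by
  rw [palm, Measure.bind_apply hD]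
  · exact lintegral_congr fun lam => map_restrict_colour_apply i lam hD
  · refine (Measure.measurable_of_measurable_coe _ fun D hD => ?_).aemeasurable
    simp_rw [map_restrict_colour_apply i _ hD]
    exact measurable_colour_marked i (measurableSet_cube 1) hD

lemma markedIntensity_apply [SFinite μ] (i : Fin m) {D : Set (Config d m r)}
    (hD : MeasurableSet D) {B : Set (Space d)} (hB : MeasurableSet B) :
    markedIntensity μ i D B = ∫⁻ lam, colour i lam {x | x ∈ B ∧ -x +ᵥ lam ∈ D} ∂μ := by
  rw [markedIntensity, Measure.map_apply measurable_snd hB,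
    Measure.restrict_apply (measurable_snd hB)]
  exact Measure.compProd_apply (measurableSet_marked hB hD)

lemma palm_eq_markedIntensity_cube [SFinite μ] (i : Fin m) {D : Set (Config d m r)}
    (hD : MeasurableSet D) : palm μ i D = markedIntensity μ i D (cube d 1) := by
  rw [palm_apply i hD, markedIntensity_apply i hD (measurableSet_cube 1)]

section Finite

variable [IsFiniteMeasure μ]

lemma isLocallyFiniteMeasure_markedIntensity (i : Fin m) {D : Set (Config d m r)}
    (hD : MeasurableSet D) : IsLocallyFiniteMeasure (markedIntensity μ i D) := by
  have htb : TranslationBounded (markedIntensity μ i D) (r / 2) (μ Set.univ) := fun x => by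
    rw [markedIntensity_apply i hD measurableSet_ball]
    refine (lintegral_mono fun lam =>
      (measure_mono fun y hy => hy.1).trans (translationBounded_colour i lam x)).trans_eq ?_
    rw [lintegral_const, one_mul]
  exact htb.isLocallyFiniteMeasure (half_pos hr.out) (measure_ne_top _ _)

instance (i : Fin m) : IsFiniteMeasure (palm μ i) := by
  refine ⟨?_⟩
  have := isLocallyFiniteMeasure_markedIntensity (μ := μ) i MeasurableSet.univ
  rw [palm_eq_markedIntensity_cube i MeasurableSet.univ]
  exact (measure_mono (cube_subset_closedBall zero_le_one)).trans_lt
    (isCompact_closedBall _ _).measure_lt_top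

variable [VAddInvariantMeasure (Space d) (Config d m r) μ]

lemma isAddLeftInvariant_markedIntensity (i : Fin m) {D : Set (Config d m r)}
    (hD : MeasurableSet D) : (markedIntensity μ i D).IsAddLeftInvariant := by
  refine ⟨fun t => ?_⟩
  ext B hB
  rw [Measure.map_apply (measurable_const_add t) hB, markedIntensity_apply i hD hB,
    markedIntensity_apply i hD (measurable_const_add t hB),
    ← (measurePreserving_vadd t μ).lintegral_comp (measurable_colour_marked i hB hD)]
  refine lintegral_congr fun lam => ?_
  have hs : MeasurableSet {x | x ∈ B ∧ -x +ᵥ (t +ᵥ lam) ∈ D} :=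
    measurable_prodMk_left (measurableSet_marked hB hD)
  rw [colour_vadd, Measure.map_apply (measurable_const_add t) hs]
  congr 1
  ext x
  simp [vadd_vadd]

lemma markedIntensity_eq_palm_smul_volume (i : Fin m) {D : Set (Config d m r)}
    (hD : MeasurableSet D) : markedIntensity μ i D = palm μ i D • volume := by
  have := isLocallyFiniteMeasure_markedIntensity (μ := μ) i hD
  have := isAddLeftInvariant_markedIntensity (μ := μ) i hD
  have heq := Measure.isAddLeftInvariant_eq_smul (markedIntensity μ i D) volume
  have hpalm : palm μ i D = (markedIntensity μ i D).addHaarScalarFactor volume := by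
    rw [palm_eq_markedIntensity_cube i hD]
    refine (DFunLike.congr_fun heq (cube d 1)).trans ?_
    simp [volume_cube zero_le_one]
  rw [hpalm]
  exact heq

theorem map_compProd_colourKernel (i : Fin m) :
    (μ ⊗ₘ colourKernel i).map (fun p : Config d m r × Space d => (p.2, -p.2 +ᵥ p.1)) =
      volume.prod (palm μ i) := by
  refine (Measure.prod_eq fun B D hB hD => ?_).symm
  have hm : Measurable fun p : Config d m r × Space d => (p.2, -p.2 +ᵥ p.1) :=
    measurable_snd.prodMk measurable_neg_vadd
  rw [Measure.map_apply hm (hB.prod hD), Measure.compProd_apply (hm (hB.prod hD))]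
  have h := markedIntensity_apply (μ := μ) i hD hB
  rw [markedIntensity_eq_palm_smul_volume i hD, Measure.smul_apply, smul_eq_mul, mul_comm] at h
  exact h.symm

theorem integral_integral_colour_neg_vadd (j : Fin m) {H : Space d × Config d m r → ℂ} {B : ℝ}
    (hH : Measurable H) (hB0 : 0 ≤ B) (hB : ∀ q, ‖H q‖ ≤ B * decayWeight (d + 1) q.1) :
    ∫ lam, ∫ y, H (y, -y +ᵥ lam) ∂colour j lam ∂μ = ∫ lam, (∫ y, H (y, lam)) ∂palm μ j := by
  have hm : Measurable fun p : Config d m r × Space d => (p.2, -p.2 +ᵥ p.1) :=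
    measurable_snd.prodMk measurable_neg_vadd
  have hcomp : Integrable (fun p : Config d m r × Space d => H (p.2, -p.2 +ᵥ p.1))
      (μ ⊗ₘ colourKernel j) :=
    integrable_compProd_of_le j (hH.comp hm) hB0 fun p => hB _
  have hprod : Integrable H (volume.prod (palm μ j)) := by
    rw [← map_compProd_colourKernel]
    exact (integrable_map_measure hH.aestronglyMeasurable hm.aemeasurable).2 hcomp
  calc ∫ lam, ∫ y, H (y, -y +ᵥ lam) ∂colour j lam ∂μ
      = ∫ p, H (p.2, -p.2 +ᵥ p.1) ∂(μ ⊗ₘ colourKernel j) :=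
        (Measure.integral_compProd hcomp).symm
    _ = ∫ q, H q ∂(volume.prod (palm μ j)) := by
        rw [← map_compProd_colourKernel, integral_map hm.aemeasurable hH.aestronglyMeasurable]
    _ = ∫ lam, (∫ y, H (y, lam)) ∂palm μ j := integral_prod_symm _ hprod

end Finite

section Correlation

variable {f g : Space d → ℂ} {A B : ℝ}

variable [IsFiniteMeasure μ]

lemma integrable_integral_mul_conj (hf : Measurable f) (hg : Measurable g) (hA0 : 0 ≤ A)
    (hB0 : 0 ≤ B) (hA : ∀ x, ‖f x‖ ≤ A * decayWeight (d + 1) x)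
    (hB : ∀ x, ‖g x‖ ≤ B * decayWeight (d + 1) x) (i j : Fin m) :
    Integrable (fun lam : Config d m r =>
      (∫ x, f x ∂colour i lam) * conj (∫ y, g y ∂colour j lam)) μ := by
  refine (integrable_colour_integral hf hA0 hA i).mul_bdd
    (c := B * (weightConst (Space d) (r / 2) (d + 1)).toReal)
    (Complex.continuous_conj.measurable.comp
      (measurable_integral_colour hg j)).aestronglyMeasurable (ae_of_all _ fun lam => ?_)
  rw [RCLike.norm_conj]
  exact norm_integral_colour_le hB0 hB j lam

variable [VAddInvariantMeasure (Space d) (Config d m r) μ]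

theorem integral_mul_conj_colour (hf : Measurable f) (hg : Measurable g) (hA0 : 0 ≤ A)
    (hB0 : 0 ≤ B) (hA : ∀ x, ‖f x‖ ≤ A * decayWeight (d + 1) x)
    (hB : ∀ x, ‖g x‖ ≤ B * decayWeight (d + 1 + (d + 1)) x) (i j : Fin m) :
    ∫ lam, (∫ x, f x ∂colour i lam) * conj (∫ y, g y ∂colour j lam) ∂μ =
      ∫ lam, ∫ x, correlation f g x ∂colour i lam ∂palm μ j := by
  let H : Space d × Config d m r → ℂ := fun q => conj (g q.1) * ∫ x, f x ∂colour i (q.1 +ᵥ q.2)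
  have hH : Measurable H :=
    (Complex.continuous_conj.measurable.comp (hg.comp measurable_fst)).mul
      ((measurable_integral_colour hf i).comp measurable_vadd)
  have hHle : ∀ q, ‖H q‖ ≤
      B * (A * (weightConst (Space d) (r / 2) (d + 1)).toReal) * decayWeight (d + 1) q.1 :=
    fun q => by
      rw [norm_mul, RCLike.norm_conj, mul_right_comm]
      have := (decayWeight_pos (d + 1) q.1).le
      gcongr
      · exact (hB _).trans (mul_le_mul_of_nonneg_left (decayWeight_antitone (by omega) _) hB0)
      · exact norm_integral_colour_le hA0 hA i _
  calc ∫ lam, (∫ x, f x ∂colour i lam) * conj (∫ y, g y ∂colour j lam) ∂μ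
      = ∫ lam, ∫ y, H (y, -y +ᵥ lam) ∂colour j lam ∂μ := by
        refine integral_congr_ae (ae_of_all _ fun lam => ?_)
        simp only [H, vadd_neg_vadd, integral_mul_const, integral_conj]
        exact mul_comm _ _
    _ = ∫ lam, (∫ y, H (y, lam)) ∂palm μ j :=
        integral_integral_colour_neg_vadd j hH (by positivity) hHle
    _ = ∫ lam, ∫ x, correlation f g x ∂colour i lam ∂palm μ j := by
        refine integral_congr_ae (ae_of_all _ fun lam => ?_)
        simp only [H, integral_colour_vadd]
        exact (integral_correlation hf hg hA0 hB0 hA hB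
          ((translationBounded_colour i lam).integrable_decayWeight (half_pos hr.out)
            ENNReal.one_ne_top (by simp))).symm

theorem integral_countingFn_mul_conj (w : Fin m → ℝ) (hf : Measurable f) (hg : Measurable g)
    (hA0 : 0 ≤ A) (hB0 : 0 ≤ B) (hA : ∀ x, ‖f x‖ ≤ A * decayWeight (d + 1) x)
    (hB : ∀ x, ‖g x‖ ≤ B * decayWeight (d + 1 + (d + 1)) x) :
    ∫ lam, countingFn w f lam * conj (countingFn w g lam) ∂μ =
      palmMoment μ w (correlation f g) := by
  have hexpand : ∀ lam : Config d m r, countingFn w f lam * conj (countingFn w g lam) =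
      ∑ j, ∑ i, (w j : ℂ) * ((w i : ℂ) *
        ((∫ x, f x ∂colour i lam) * conj (∫ y, g y ∂colour j lam))) := fun lam => by
    simp only [countingFn, map_sum, map_mul, Complex.conj_ofReal, Finset.mul_sum, Finset.sum_mul]
    refine Finset.sum_congr rfl fun j _ => Finset.sum_congr rfl fun i _ => ?_
    ring
  have hint : ∀ i j, Integrable (fun lam : Config d m r =>
      (∫ x, f x ∂colour i lam) * conj (∫ y, g y ∂colour j lam)) μ :=
    integrable_integral_mul_conj hf hg hA0 hB0 hA fun x =>
      (hB x).trans (mul_le_mul_of_nonneg_left (decayWeight_antitone (by omega) x) hB0)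
  have hI : 0 ≤ ∫ y : Space d, decayWeight (d + 1) y :=
    integral_nonneg fun y => (decayWeight_pos _ y).le
  simp_rw [hexpand]
  rw [integral_finsetSum _ fun j _ => integrable_finsetSum _ fun i _ =>
    ((hint i j).const_mul _).const_mul _, palmMoment]
  refine Finset.sum_congr rfl fun j _ => ?_
  rw [integral_countingFn _ (measurable_correlation hf hg) (by positivity)
    (norm_correlation_le hA0 hB0 hA hB), integral_finsetSum _ fun i _ =>
    ((hint i j).const_mul _).const_mul _, Finset.mul_sum]
  simp_rw [integral_const_mul, integral_mul_conj_colour hf hg hA0 hB0 hA hB]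

end Correlation

theorem palmMoment_eq_combination [IsFiniteMeasure μ] (w : Fin m → ℝ) {f : Space d → ℂ} {A : ℝ}
    (hf : Measurable f) (hA0 : 0 ≤ A) (hA : ∀ x, ‖f x‖ ≤ A * decayWeight (d + 1) x) :
    palmMoment μ w f =
      combination (fun p : Fin m × Fin m => w p.1 * w p.2) (palmIntensity μ) f := by
  rw [palmMoment, combination, Fintype.sum_prod_type]
  refine Finset.sum_congr rfl fun i _ => ?_
  rw [integral_countingFn w hf hA0 hA, Finset.mul_sum]
  refine Finset.sum_congr rfl fun j _ => ?_
  have hi : Integrable f (palmIntensity μ (i, j)) :=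
    (translationBounded_palmIntensity μ (i, j)).integrable_of_le (half_pos hr.out)
      (measure_ne_top _ _) (by simp) hf.aestronglyMeasurable hA
  have hbind : ∫ x, f x ∂palmIntensity μ (i, j) = ∫ lam, ∫ x, f x ∂colour j lam ∂palm μ i :=
    Kernel.integral_comp (κ := Kernel.const Unit (palm μ i)) (η := colourKernel j) (a := ()) hi
  rw [hbind, Complex.ofReal_mul, mul_assoc]

end Palm

/-! ### The Fourier transform of the Palm moment -/

section Approximation

variable {d : ℕ} {f g h : Space d → ℂ}

lemma continuous_correlation (hf : Continuous f) (hfs : HasCompactSupport f) (hg : Continuous g)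
    (hgs : HasCompactSupport g) : Continuous (correlation f g) := by
  obtain ⟨C, hC⟩ := hfs.exists_bound_of_continuous hf
  refine continuous_of_dominated (bound := fun y => C * ‖g y‖) (fun x => ?_)
    (fun x => ae_of_all _ fun y => ?_) ((hg.integrable_of_hasCompactSupport hgs).norm.const_mul C)
    (ae_of_all _ fun y => ?_)
  · exact Continuous.aestronglyMeasurable (by fun_prop)
  · rw [norm_mul, RCLike.norm_conj]
    exact mul_le_mul_of_nonneg_right (hC _) (norm_nonneg _)
  · fun_prop

lemma correlation_self_zero (h : Space d → ℂ) :
    correlation h h 0 = ((∫ y, ‖h y‖ ^ 2 : ℝ) : ℂ) := by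
  simp only [correlation, zero_add, RCLike.mul_conj, ← integral_complex_ofReal]
  norm_cast

lemma norm_correlation_self_le (hc : Continuous h) (hs : HasCompactSupport h) (x : Space d) :
    ‖correlation h h x‖ ≤ ∫ y, ‖h y‖ ^ 2 := by
  have hi : Integrable fun y => ‖h y‖ ^ 2 := by
    simp_rw [sq]
    exact (hc.norm.mul hc.norm).integrable_of_hasCompactSupport hs.norm.mul_left
  have hi' : Integrable fun y => ‖h (x + y)‖ ^ 2 := hi.comp_add_left x
  refine (norm_integral_le_of_norm_le ((hi'.add hi).const_mul 2⁻¹)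
    (ae_of_all _ fun y => ?_)).trans (le_of_eq ?_)
  · rw [Pi.add_apply, norm_mul, RCLike.norm_conj]
    nlinarith [sq_nonneg (‖h (x + y)‖ - ‖h y‖)]
  · rw [integral_const_mul, integral_add' hi' hi,
      integral_add_left_eq_self (fun y => ‖h y‖ ^ 2) x]
    ring

lemma chi_mul_correlation_self (h : Space d → ℂ) (k x : Space d) :
    chi (-k) x * correlation h h x =
      correlation (fun y => chi (-k) y * h y) (fun y => chi (-k) y * h y) x := by
  simp only [correlation]
  rw [← integral_const_mul]
  refine integral_congr_ae (ae_of_all _ fun y => ?_)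
  have hone : chi (-k) y * conj (chi (-k) y) = 1 := by
    rw [Complex.mul_conj, Complex.normSq_eq_norm_sq, norm_chi]; norm_num
  simp only [map_mul, chi_add_right]
  linear_combination (-(chi (-k) x * h (x + y) * conj (h y))) * hone

lemma correlation_self_dilation (h : Space d → ℂ) {a : ℝ} (ha : 0 < a) (x : Space d) :
    correlation (fun x => (√(a ^ d) : ℂ) * h (a • x)) (fun x => (√(a ^ d) : ℂ) * h (a • x)) x =
      correlation h h (a • x) := by
  have hsqrt : (√(a ^ d) : ℂ) * √(a ^ d) = (a ^ d : ℝ) := by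
    rw [← Complex.ofReal_mul, Real.mul_self_sqrt (by positivity)]
  have hdil := Measure.integral_comp_smul (volume : Measure (Space d))
    (fun y => h (a • x + y) * conj (h y)) a
  rw [finrank_euclideanSpace_fin, abs_of_pos (by positivity)] at hdil
  calc correlation (fun x => (√(a ^ d) : ℂ) * h (a • x)) (fun x => (√(a ^ d) : ℂ) * h (a • x)) x
      = ∫ y, ((a ^ d : ℝ) : ℂ) * (h (a • x + a • y) * conj (h (a • y))) := by
        refine integral_congr_ae (ae_of_all _ fun y => ?_)
        simp only [smul_add, map_mul, Complex.conj_ofReal]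
        linear_combination (h (a • x + a • y) * conj (h (a • y))) * hsqrt
    _ = correlation h h (a • x) := by
        rw [integral_const_mul, hdil, Complex.real_smul, ← mul_assoc, ← Complex.ofReal_mul,
          mul_inv_cancel₀ (by positivity), Complex.ofReal_one, one_mul, correlation]

lemma exists_continuous_integral_norm_sq_eq_one (d : ℕ) :
    ∃ h : Space d → ℂ, Continuous h ∧ HasCompactSupport h ∧ ∫ y, ‖h y‖ ^ 2 = 1 := by
  let b : ContDiffBump (0 : Space d) := ⟨1, 2, one_pos, one_lt_two⟩
  have hs : HasCompactSupport fun x => b x ^ 2 :=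
    b.hasCompactSupport.comp_left (g := fun t : ℝ => t ^ 2) (by norm_num)
  have hpos : 0 < ∫ y, b y ^ 2 := by
    refine (b.continuous.pow 2).integral_pos_of_hasCompactSupport_nonneg_nonzero hs
      (fun x => sq_nonneg _) (x := 0) ?_
    rw [b.one_of_mem_closedBall (by simp [b])]
    norm_num
  refine ⟨fun x => (((√(∫ y, b y ^ 2))⁻¹ * b x : ℝ) : ℂ),
    Complex.continuous_ofReal.comp (continuous_const.mul b.continuous),
    b.hasCompactSupport.mul_left.comp_left (g := Complex.ofReal) Complex.ofReal_zero, ?_⟩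
  simp_rw [Complex.norm_real, Real.norm_eq_abs, sq_abs, mul_pow]
  rw [integral_const_mul, inv_pow, Real.sq_sqrt hpos.le, inv_mul_cancel₀ hpos.ne']

-- The functions are dilations of a single one.
lemma exists_correlation_self_tendsto_one (d : ℕ) :
    ∃ h : ℕ → Space d → ℂ, (∀ n, Continuous (h n)) ∧ (∀ n, HasCompactSupport (h n)) ∧
      (∀ n, ∫ y, ‖h n y‖ ^ 2 = 1) ∧
      ∀ x, Tendsto (fun n => correlation (h n) (h n) x) atTop (𝓝 1) := by
  obtain ⟨h, hc, hs, h1⟩ := exists_continuous_integral_norm_sq_eq_one d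
  have hzero : correlation h h 0 = 1 := by rw [correlation_self_zero, h1, Complex.ofReal_one]
  have ha : ∀ n : ℕ, (0 : ℝ) < 1 / ((n : ℝ) + 1) := fun n => by positivity
  refine ⟨fun n x => (√((1 / ((n : ℝ) + 1)) ^ d) : ℂ) * h ((1 / ((n : ℝ) + 1)) • x),
    fun n => by fun_prop, fun n => (hs.comp_smul (ha n).ne').mul_left, fun n => ?_, fun x => ?_⟩
  · refine Complex.ofReal_injective ?_
    rw [← correlation_self_zero, correlation_self_dilation h (ha n), smul_zero, hzero,
      Complex.ofReal_one]
  · simp_rw [correlation_self_dilation h (ha _)]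
    have hlim : Tendsto (fun n : ℕ => (1 / ((n : ℝ) + 1)) • x) atTop (𝓝 ((0 : ℝ) • x)) :=
      tendsto_one_div_add_atTop_nhds_zero_nat.smul_const x
    rw [zero_smul] at hlim
    rw [← hzero]
    exact ((continuous_correlation hc hs hc hs).tendsto 0).comp hlim

lemma exists_norm_correlation_le_decayWeight (hf : Continuous f) (hfs : HasCompactSupport f)
    (hg : Continuous g) (hgs : HasCompactSupport g) :
    ∃ A, 0 ≤ A ∧ ∀ x, ‖correlation f g x‖ ≤ A * decayWeight (d + 1) x := by
  obtain ⟨A, hA0, hA⟩ := exists_norm_le_decayWeight_of_hasCompactSupport hf hfs (d + 1)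
  obtain ⟨B, hB0, hB⟩ :=
    exists_norm_le_decayWeight_of_hasCompactSupport hg hgs (d + 1 + (d + 1))
  have hI : 0 ≤ ∫ y : Space d, decayWeight (d + 1) y :=
    integral_nonneg fun y => (decayWeight_pos _ y).le
  exact ⟨_, by positivity, norm_correlation_le hA0 hB0 hA hB⟩

end Approximation

section PalmFourier

variable {d m : ℕ} {r : ℝ} [hr : Fact (0 < r)] {μ : Measure (Config d m r)} [IsFiniteMeasure μ]
  [VAddInvariantMeasure (Space d) (Config d m r) μ]

open scoped ComplexOrder in
lemma palmMoment_chi_mul_correlation_self_nonneg (w : Fin m → ℝ) {h : Space d → ℂ}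
    (hc : Continuous h) (hs : HasCompactSupport h) (k : Space d) :
    0 ≤ palmMoment μ w fun x => chi (-k) x * correlation h h x := by
  have hm : Measurable fun y => chi (-k) y * h y := ((continuous_chi _).mul hc).measurable
  have hn : ∀ y, ‖chi (-k) y * h y‖ = ‖h y‖ := fun y => by rw [norm_mul, norm_chi, one_mul]
  obtain ⟨A, hA0, hA⟩ := exists_norm_le_decayWeight_of_hasCompactSupport hc hs (d + 1)
  obtain ⟨B, hB0, hB⟩ := exists_norm_le_decayWeight_of_hasCompactSupport hc hs (d + 1 + (d + 1))
  simp_rw [chi_mul_correlation_self]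
  rw [← integral_countingFn_mul_conj w hm hm hA0 hB0 (fun x => (hn x).trans_le (hA x))
    fun x => (hn x).trans_le (hB x)]
  simp_rw [Complex.mul_conj]
  rw [integral_complex_ofReal, Complex.zero_le_real]
  exact integral_nonneg fun _ => Complex.normSq_nonneg _

theorem exists_isFourierTransform_palmMoment (w : Fin m → ℝ) :
    ∃ ω : Measure (Space d), Integrable (decayWeight (d + 2)) ω ∧
      IsFourierTransform (palmMoment μ w) ω := by
  obtain ⟨h, hc, hs, h1, hlim⟩ := exists_correlation_self_tendsto_one d
  have hcont := fun n => continuous_correlation (hc n) (hs n) (hc n) (hs n)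
  have hdecay := fun n => exists_norm_correlation_le_decayWeight (hc n) (hs n) (hc n) (hs n)
  obtain ⟨ω, hω, hF⟩ := exists_isFourierTransform_combination
    (c := fun p : Fin m × Fin m => w p.1 * w p.2) (half_pos hr.out)
    (fun p => measure_ne_top (palm μ p.1) Set.univ) (translationBounded_palmIntensity μ) hcont
    (fun n x => (norm_correlation_self_le (hc n) (hs n) x).trans_eq (h1 n)) hlim
    (fun n p => (hdecay n).elim fun _ hA =>
      (translationBounded_palmIntensity μ p).integrable_of_le (half_pos hr.out)
        (measure_ne_top _ _) (by simp) (hcont n).aestronglyMeasurable hA.2)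
    fun n k => by
      obtain ⟨A, hA0, hA⟩ := hdecay n
      rw [← palmMoment_eq_combination (f := fun x => chi (-k) x * correlation (h n) (h n) x) w
        ((continuous_chi _).mul (hcont n)).measurable hA0
        fun x => by rw [norm_mul, norm_chi, one_mul]; exact hA x]
      exact palmMoment_chi_mul_correlation_self_nonneg w (hc n) (hs n) k
  refine ⟨ω, hω, fun φ => ⟨(hF φ).1, ?_⟩⟩
  obtain ⟨A, hA0, hA⟩ := exists_norm_schwartzMap_le_decayWeight (𝓕 φ : 𝓢(Space d, ℂ)) (d + 1)
  rw [(hF φ).2, palmMoment_eq_combination w (𝓕 φ : 𝓢(Space d, ℂ)).continuous.measurable hA0 hA]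

end PalmFourier

/-! ### Measures and Schwartz functions -/

section Determination

variable {d : ℕ} {ω ω' : Measure (Space d)}

lemma exists_schwartz_dist_le_of_hasCompactSupport {f : Space d → ℂ} (hf : Continuous f) {ρ : ℝ}
    (hρ : ∀ x, ρ < ‖x‖ → f x = 0) {ε : ℝ} (hε : 0 < ε) :
    ∃ g : 𝓢(Space d, ℂ), (∀ x, ρ + 1 < ‖x‖ → g x = 0) ∧ ∀ x, ‖g x - f x‖ ≤ ε := by
  have hs : HasCompactSupport f :=
    HasCompactSupport.intro (isCompact_closedBall (0 : Space d) ρ) fun x hx =>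
      hρ x (by simpa using hx)
  obtain ⟨δ, hδ, hu⟩ := Metric.uniformContinuous_iff.1 (hs.uniformContinuous_of_continuous hf) ε hε
  obtain ⟨g, hg, hgf⟩ := hf.exists_contDiff_dist_le_of_forall_mem_ball_dist_le (lt_min one_pos hδ)
  have hgout : ∀ x, ρ + 1 < ‖x‖ → g x = 0 := fun x hx => by
    have hball : ∀ y ∈ Metric.ball x (min 1 δ), dist (f y) 0 ≤ 0 := fun y hy => by
      have hxy : ‖x - y‖ < 1 := by
        rw [← dist_eq_norm, dist_comm]
        exact (Metric.mem_ball.1 hy).trans_le (min_le_left _ _)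
      rw [hρ y (by linarith [norm_sub_norm_le x y]), dist_self]
    rw [← hρ x (by linarith)] at hball
    have hgx := hgf x 0 hball
    rw [hρ x (by linarith)] at hgx
    exact dist_le_zero.1 hgx
  have hgs : HasCompactSupport g :=
    HasCompactSupport.intro (isCompact_closedBall (0 : Space d) (ρ + 1)) fun x hx =>
      hgout x (by simpa using hx)
  refine ⟨hgs.toSchwartzMap hg, hgout, fun x => ?_⟩
  rw [← dist_eq_norm]
  exact hgf x ε fun y hy => (hu ((Metric.mem_ball.1 hy).trans_le (min_le_right _ _))).le

lemma exists_forall_eq_zero_of_lt_norm {f : Space d → ℂ} (hs : HasCompactSupport f) :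
    ∃ ρ > 0, ∀ x, ρ < ‖x‖ → f x = 0 := by
  obtain ⟨ρ, hρ0, hρ⟩ := hs.isCompact.isBounded.subset_closedBall_lt 0 (0 : Space d)
  refine ⟨ρ, hρ0, fun x hx => ?_⟩
  by_contra h
  have := hρ (subset_tsupport _ h)
  rw [mem_closedBall_zero_iff] at this
  linarith

lemma tendsto_integral_of_dist_le {f : Space d → ℂ} (hf : Continuous f) {g : ℕ → Space d → ℂ}
    (hg : ∀ n, Continuous (g n)) {K : Set (Space d)} (hK : IsCompact K)
    (hfK : ∀ x ∉ K, f x = 0) (hgK : ∀ n, ∀ x ∉ K, g n x = 0) {ε : ℕ → ℝ}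
    (hε : Tendsto ε atTop (𝓝 0)) (h : ∀ n x, ‖g n x - f x‖ ≤ ε n) (τ : Measure (Space d))
    [IsLocallyFiniteMeasure τ] :
    Tendsto (fun n => ∫ x, g n x ∂τ) atTop (𝓝 (∫ x, f x ∂τ)) := by
  have hint : ∀ {φ : Space d → ℂ}, Continuous φ → (∀ x ∉ K, φ x = 0) → Integrable φ τ :=
    fun hφ hφK => hφ.integrable_of_hasCompactSupport (HasCompactSupport.intro hK @hφK)
  rw [tendsto_iff_norm_sub_tendsto_zero]
  refine squeeze_zero (fun n => norm_nonneg _) (fun n => ?_)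
    (by simpa using hε.mul_const (τ.real K))
  rw [← integral_sub (hint (hg n) (hgK n)) (hint hf hfK),
    ← setIntegral_eq_integral_of_forall_compl_eq_zero
    fun x hx => by rw [hgK n x hx, hfK x hx, sub_zero]]
  exact norm_setIntegral_le_of_norm_le_const hK.measure_lt_top fun x _ => h n x

theorem ext_of_integral_schwartz [IsLocallyFiniteMeasure ω] [IsLocallyFiniteMeasure ω']
    (h : ∀ φ : 𝓢(Space d, ℂ), ∫ x, φ x ∂ω = ∫ x, φ x ∂ω') : ω = ω' := by
  refine Measure.ext_of_integral_eq_on_compactlySupported fun f => ?_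
  have hf : Continuous fun x => (f x : ℂ) := Complex.continuous_ofReal.comp f.continuous
  obtain ⟨ρ, -, hρ⟩ := exists_forall_eq_zero_of_lt_norm
    (f.hasCompactSupport.comp_left (g := Complex.ofReal) Complex.ofReal_zero)
  have hε : ∀ n : ℕ, (0 : ℝ) < 1 / ((n : ℝ) + 1) := fun n => by positivity
  choose g hg hgf using fun n => exists_schwartz_dist_le_of_hasCompactSupport hf hρ (hε n)
  have hlim := tendsto_integral_of_dist_le hf (fun n => (g n).continuous)
    (isCompact_closedBall (0 : Space d) (ρ + 1))
    (fun x hx => hρ x (by rw [mem_closedBall_zero_iff] at hx; linarith))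
    (fun n x hx => hg n x (by simpa using hx)) tendsto_one_div_add_atTop_nhds_zero_nat hgf
  have heq := tendsto_nhds_unique (hlim ω) ((hlim ω').congr fun n => (h (g n)).symm)
  rwa [integral_complex_ofReal, integral_complex_ofReal, Complex.ofReal_inj] at heq

theorem IsFourierTransform.unique {L : (Space d → ℂ) → ℂ} [IsLocallyFiniteMeasure ω]
    [IsLocallyFiniteMeasure ω'] (h : IsFourierTransform L ω) (h' : IsFourierTransform L ω') :
    ω = ω' :=
  ext_of_integral_schwartz fun φ => (h φ).2.trans (h' φ).2.symm

end Determination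

section Reflection

variable {d : ℕ}

/-- The complex conjugate of a Schwartz function. -/
def schwartzConj : 𝓢(Space d, ℂ) → 𝓢(Space d, ℂ) :=
  SchwartzMap.postcompCLM (Complex.conjCLE : ℂ →L[ℝ] ℂ)

lemma schwartzConj_apply (f : 𝓢(Space d, ℂ)) (x : Space d) : schwartzConj f x = conj (f x) := rfl

/-- The reflection `x ↦ f (-x)` of a Schwartz function. -/
def schwartzNeg : 𝓢(Space d, ℂ) → 𝓢(Space d, ℂ) :=
  SchwartzMap.compCLMOfContinuousLinearEquiv ℝ (ContinuousLinearEquiv.neg ℝ)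

lemma schwartzNeg_apply (f : 𝓢(Space d, ℂ)) (x : Space d) : schwartzNeg f x = f (-x) := rfl

lemma fourier_schwartzConj (f : 𝓢(Space d, ℂ)) (k : Space d) :
    (𝓕 (schwartzConj f) : 𝓢(Space d, ℂ)) k = conj ((𝓕 f : 𝓢(Space d, ℂ)) (-k)) := by
  rw [SchwartzMap.fourier_coe, SchwartzMap.fourier_coe, fourier_eq_integral_chi,
    fourier_eq_integral_chi, ← integral_conj]
  refine integral_congr_ae (ae_of_all _ fun x => ?_)
  simp only [schwartzConj_apply, map_mul, chi_neg_left, chi_neg_right, Complex.conj_conj]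

lemma fourier_schwartzNeg (f : 𝓢(Space d, ℂ)) (k : Space d) :
    (𝓕 (schwartzNeg f) : 𝓢(Space d, ℂ)) k = (𝓕 f : 𝓢(Space d, ℂ)) (-k) := by
  rw [SchwartzMap.fourier_coe, SchwartzMap.fourier_coe, fourier_eq_integral_chi,
    fourier_eq_integral_chi, ← integral_neg_eq_self]
  refine integral_congr_ae (ae_of_all _ fun x => ?_)
  simp only [schwartzNeg_apply, neg_neg, chi_neg_right, chi_neg_left, Complex.conj_conj]

lemma integral_map_neg (ω : Measure (Space d)) (φ : Space d → ℂ) :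
    ∫ x, φ x ∂ω.map (fun x => -x) = ∫ x, φ (-x) ∂ω :=
  (MeasurableEquiv.neg (Space d)).measurableEmbedding.integral_map φ

theorem IsFourierTransform.map_neg {L : (Space d → ℂ) → ℂ} {ω : Measure (Space d)}
    [IsLocallyFiniteMeasure ω] (h : IsFourierTransform L ω)
    (hL : ∀ f : Space d → ℂ, L (fun x => conj (f x)) = conj (L f)) :
    ω.map (fun x => -x) = ω := by
  have : IsFiniteMeasureOnCompacts (ω.map fun x => -x) := ⟨fun K hK => by
    rw [Measure.map_apply measurable_neg hK.measurableSet]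
    exact ((Homeomorph.neg (Space d)).isCompact_preimage.2 hK).measure_lt_top⟩
  refine ext_of_integral_schwartz fun φ => ?_
  have hneg : (⇑(𝓕 (schwartzNeg φ) : 𝓢(Space d, ℂ)) : Space d → ℂ) =
      fun x => conj ((𝓕 (schwartzConj φ) : 𝓢(Space d, ℂ)) x) := by
    funext x
    rw [fourier_schwartzNeg, fourier_schwartzConj, Complex.conj_conj]
  calc ∫ x, φ x ∂ω.map (fun x => -x) = ∫ x, schwartzNeg φ x ∂ω := integral_map_neg ω φ
    _ = L (𝓕 (schwartzNeg φ) : 𝓢(Space d, ℂ)) := (h _).2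
    _ = conj (L (𝓕 (schwartzConj φ) : 𝓢(Space d, ℂ))) := by rw [hneg, hL]
    _ = ∫ x, φ x ∂ω := by
      rw [← (h (schwartzConj φ)).2, ← integral_conj]
      simp only [schwartzConj_apply, Complex.conj_conj]

lemma correlation_eq_convolution (f g : 𝓢(Space d, ℂ)) :
    correlation f g =
      SchwartzMap.convolution (ContinuousLinearMap.mul ℂ ℂ) f (schwartzNeg (schwartzConj g)) := by
  funext x
  rw [SchwartzMap.convolution_apply, MeasureTheory.convolution, correlation]
  rw [← integral_add_left_eq_self (μ := volume) (fun t => ContinuousLinearMap.mul ℂ ℂ (f t)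
    (schwartzNeg (schwartzConj g) (x - t))) x]
  refine integral_congr_ae (ae_of_all _ fun y => ?_)
  simp [schwartzNeg_apply, schwartzConj_apply]

lemma exists_fourier_eq_correlation (f g : 𝓢(Space d, ℂ)) :
    ∃ ψ : 𝓢(Space d, ℂ), (𝓕 ψ : 𝓢(Space d, ℂ)) = correlation f g ∧
      ∀ k, ψ k = (𝓕 f : 𝓢(Space d, ℂ)) (-k) * conj ((𝓕 g : 𝓢(Space d, ℂ)) (-k)) := by
  refine ⟨𝓕⁻ (SchwartzMap.convolution (ContinuousLinearMap.mul ℂ ℂ) f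
    (schwartzNeg (schwartzConj g))), ?_, fun k => ?_⟩
  · rw [FourierTransform.fourier_fourierInv_eq, correlation_eq_convolution]
  · have hinv : ∀ φ : 𝓢(Space d, ℂ), (𝓕⁻ φ : 𝓢(Space d, ℂ)) k = (𝓕 φ : 𝓢(Space d, ℂ)) (-k) := by
      intro φ
      rw [SchwartzMap.fourierInv_coe, SchwartzMap.fourier_coe]
      exact Real.fourierInv_eq_fourier_neg _ _
    rw [hinv, SchwartzMap.fourier_convolution]
    simp [fourier_schwartzNeg, fourier_schwartzConj]

end Reflection

section Parseval

variable {d m : ℕ} {r : ℝ} {μ : Measure (Config d m r)}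

lemma palmMoment_conj (w : Fin m → ℝ) (f : Space d → ℂ) :
    palmMoment μ w (fun x => conj (f x)) = conj (palmMoment μ w f) := by
  simp only [palmMoment, countingFn, map_sum, map_mul, Complex.conj_ofReal,
    ← integral_conj]

theorem integral_countingFn_schwartz [Fact (0 < r)] [IsFiniteMeasure μ]
    [VAddInvariantMeasure (Space d) (Config d m r) μ] {w : Fin m → ℝ} {ω : Measure (Space d)}
    [IsLocallyFiniteMeasure ω] (h : IsFourierTransform (palmMoment μ w) ω) (f g : 𝓢(Space d, ℂ)) :
    ∫ lam, countingFn w f lam * conj (countingFn w g lam) ∂μ =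
      ∫ k, (𝓕 f : 𝓢(Space d, ℂ)) k * conj ((𝓕 g : 𝓢(Space d, ℂ)) k) ∂ω := by
  obtain ⟨A, hA0, hA⟩ := exists_norm_schwartzMap_le_decayWeight f (d + 1)
  obtain ⟨B, hB0, hB⟩ := exists_norm_schwartzMap_le_decayWeight g (d + 1 + (d + 1))
  obtain ⟨ψ, hψ, hψ_apply⟩ := exists_fourier_eq_correlation f g
  rw [integral_countingFn_mul_conj w f.continuous.measurable g.continuous.measurable hA0 hB0 hA hB,
    ← hψ, ← (h ψ).2]
  simp_rw [hψ_apply]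
  rw [← integral_map_neg ω (fun k => (𝓕 f : 𝓢(Space d, ℂ)) k * conj ((𝓕 g : 𝓢(Space d, ℂ)) k)),
    h.map_neg (palmMoment_conj w)]

end Parseval

/-! ### Complex measures -/

section ComplexMeasures

variable {X : Type*} [MeasurableSpace X] {ν : Measure X} {h φ : X → ℂ}

lemma isFiniteMeasure_variation_withDensityᵥ (hi : Integrable h ν) :
    IsFiniteMeasure (ν.withDensityᵥ h).variation := by
  rw [Measure.variation_withDensityᵥ hi]
  exact isFiniteMeasure_withDensity hi.hasFiniteIntegral.ne

lemma simpleFunc_integral_withDensityᵥ (hi : Integrable h ν) (f : SimpleFunc X ℂ) :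
    VectorMeasure.integral (ν.withDensityᵥ h) f (ContinuousLinearMap.mul ℝ ℂ) =
      ∫ x, f x * h x ∂ν := by
  have := isFiniteMeasure_variation_withDensityᵥ hi
  induction f using SimpleFunc.induction with
  | @const a s hs =>
    simp only [SimpleFunc.coe_piecewise, SimpleFunc.coe_const, SimpleFunc.const_zero,
      SimpleFunc.coe_zero, Set.piecewise_eq_indicator]
    have hconst : VectorMeasure.integral (ν.withDensityᵥ h) (s.indicator (Function.const X a))
        (ContinuousLinearMap.mul ℝ ℂ) = a * ν.withDensityᵥ h s :=
      (VectorMeasure.integral_indicator hs).trans (VectorMeasure.setIntegral_const a)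
    rw [hconst, withDensityᵥ_apply hi hs, ← integral_const_mul, ← integral_indicator hs]
    simp only [Set.indicator_mul_left]
    rfl
  | @add f g _ hf hg =>
    have hint (f : SimpleFunc X ℂ) : Integrable (fun x => f x * h x) ν :=
      hi.bdd_mul f.stronglyMeasurable.aestronglyMeasurable
        (ae_of_all _ f.exists_forall_norm_le.choose_spec)
    rw [SimpleFunc.coe_add, VectorMeasure.integral_add
      (SimpleFunc.integrable_of_isFiniteMeasure f) (SimpleFunc.integrable_of_isFiniteMeasure g),
      hf, hg, ← integral_add (hint f) (hint g)]
    simp only [Pi.add_apply, add_mul]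

theorem integral_withDensityᵥ (hi : Integrable h ν) (hφ : Measurable φ) {C : ℝ}
    (hC : ∀ x, ‖φ x‖ ≤ C) :
    VectorMeasure.integral (ν.withDensityᵥ h) φ (ContinuousLinearMap.mul ℝ ℂ) =
      ∫ x, φ x * h x ∂ν := by
  have := isFiniteMeasure_variation_withDensityᵥ hi
  have hsm : StronglyMeasurable φ := hφ.stronglyMeasurable
  have hlim (x : X) : Tendsto (fun n => hsm.approxBounded C n x) atTop (𝓝 (φ x)) :=
    hsm.tendsto_approxBounded_of_norm_le (hC x)
  have hb (n : ℕ) (x : X) : ‖hsm.approxBounded C n x‖ ≤ C :=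
    hsm.norm_approxBounded_le ((norm_nonneg _).trans (hC x)) n x
  have hmeas (n : ℕ) (τ : Measure X) : AEStronglyMeasurable (hsm.approxBounded C n) τ :=
    (SimpleFunc.stronglyMeasurable _).aestronglyMeasurable
  refine tendsto_nhds_unique (VectorMeasure.tendsto_integral_of_dominated_convergence (fun _ => C)
    (fun n => hmeas n _) (integrable_const C) (fun n => ae_of_all _ (hb n)) (ae_of_all _ hlim)) ?_
  simp only [simpleFunc_integral_withDensityᵥ hi]
  refine tendsto_integral_of_dominated_convergence (fun x => C * ‖h x‖)
    (fun n => (hmeas n _).mul hi.aestronglyMeasurable) (hi.norm.const_mul C)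
    (fun n => ae_of_all _ fun x => ?_) (ae_of_all _ fun x => (hlim x).mul_const _)
  rw [norm_mul]
  gcongr
  exact hb n x

lemma exists_eq_withDensityᵥ (ρ : ComplexMeasure X) :
    ∃ (ν : Measure X) (h : X → ℂ), Integrable h ν ∧ IsFiniteMeasure ν ∧ ρ = ν.withDensityᵥ h := by
  let ν := (ComplexMeasure.re ρ).totalVariation + (ComplexMeasure.im ρ).totalVariation
  have habs {s : SignedMeasure X} (hs : s.totalVariation ≤ ν) :
      s ≪ᵥ ν.toENNRealVectorMeasure := by
    refine VectorMeasure.AbsolutelyContinuous.mk fun t ht h0 => ?_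
    rw [Measure.toENNRealVectorMeasure_apply_measurable ht] at h0
    exact SignedMeasure.null_of_totalVariation_zero s (le_antisymm ((hs t).trans h0.le) bot_le)
  have hi := ComplexMeasure.integrable_rnDeriv ρ ν
  have hre : ν.withDensityᵥ ((ComplexMeasure.re ρ).rnDeriv ν) = ComplexMeasure.re ρ :=
    SignedMeasure.withDensityᵥ_rnDeriv_eq _ ν (habs (Measure.le_add_right le_rfl))
  have him : ν.withDensityᵥ ((ComplexMeasure.im ρ).rnDeriv ν) = ComplexMeasure.im ρ :=
    SignedMeasure.withDensityᵥ_rnDeriv_eq _ ν (habs (Measure.le_add_left le_rfl))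
  refine ⟨ν, ρ.rnDeriv ν, hi, inferInstance, VectorMeasure.ext fun s hs => ?_⟩
  rw [withDensityᵥ_apply hi hs]
  refine Complex.ext ?_ ?_
  · calc (ρ s).re = ∫ x in s, (ComplexMeasure.re ρ).rnDeriv ν x ∂ν := by
          rw [← withDensityᵥ_apply (SignedMeasure.integrable_rnDeriv _ _) hs, hre]
          rfl
      _ = (∫ x in s, ρ.rnDeriv ν x ∂ν).re := integral_re hi.integrableOn
  · calc (ρ s).im = ∫ x in s, (ComplexMeasure.im ρ).rnDeriv ν x ∂ν := by
          rw [← withDensityᵥ_apply (SignedMeasure.integrable_rnDeriv _ _) hs, him]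
          rfl
      _ = (∫ x in s, ρ.rnDeriv ν x ∂ν).im := integral_im hi.integrableOn

instance (ρ : ComplexMeasure X) :
    IsFiniteMeasure ρ.variation := by
  obtain ⟨ν, h, hi, -, rfl⟩ := exists_eq_withDensityᵥ ρ
  exact isFiniteMeasure_variation_withDensityᵥ hi

end ComplexMeasures

section Uniqueness

variable {d : ℕ}

theorem measure_ext_of_integral_chi {τ τ' : Measure (Space d)} [IsFiniteMeasure τ]
    [IsFiniteMeasure τ'] (h : ∀ t, ∫ x, chi x t ∂τ = ∫ x, chi x t ∂τ') : τ = τ' := by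
  refine Measure.ext_of_charFun (funext fun t => ?_)
  have hexp (x : Space d) : Complex.exp ((inner ℝ x t : ℝ) * Complex.I) =
      chi x ((2 * Real.pi)⁻¹ • t) := by
    rw [chi, Real.fourierChar_apply, inner_smul_right, mul_inv_cancel_left₀ (by positivity)]
  simp_rw [charFun_apply, hexp]
  exact h _

lemma integral_fourier_mul {ν : Measure (Space d)} [SFinite ν] {h : Space d → ℂ}
    (hi : Integrable h ν) (φ : 𝓢(Space d, ℂ)) :
    ∫ x, (𝓕 φ : 𝓢(Space d, ℂ)) x * h x ∂ν = ∫ t, φ t * (∫ x, chi (-x) t * h x ∂ν) := by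
  have hchi (x t : Space d) : chi (-x) t = chi (-t) x := by
    rw [chi_neg_left, chi_neg_left, chi_comm]
  have hint : Integrable (Function.uncurry fun x t => chi (-x) t * (h x * φ t))
      (ν.prod volume) :=
    (hi.mul_prod φ.integrable).bdd_mul (c := 1) continuous_chi_neg_uncurry.aestronglyMeasurable
      (ae_of_all _ fun p => (norm_chi _ _).le)
  calc ∫ x, (𝓕 φ : 𝓢(Space d, ℂ)) x * h x ∂ν
      = ∫ x, (∫ t, chi (-x) t * (h x * φ t)) ∂ν := by
        simp_rw [SchwartzMap.fourier_coe, fourier_eq_integral_chi, ← integral_mul_const, hchi,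
          mul_assoc, mul_comm (h _)]
    _ = ∫ t, (∫ x, chi (-x) t * (h x * φ t) ∂ν) := integral_integral_swap hint
    _ = ∫ t, φ t * (∫ x, chi (-x) t * h x ∂ν) := by
        simp_rw [← mul_assoc, integral_mul_const, mul_comm (φ _)]

lemma ae_eq_zero_of_integral_chi_mul_eq_zero {ν : Measure (Space d)} [IsFiniteMeasure ν]
    {h : Space d → ℂ} (hi : Integrable h ν) (h0 : ∀ t, ∫ x, chi (-x) t * h x ∂ν = 0) :
    h =ᵐ[ν] 0 := by
  refine ae_eq_zero_of_integral_contDiff_smul_eq_zero hi.locallyIntegrable fun g hg hgs => ?_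
  let φ : 𝓢(Space d, ℂ) := (hgs.comp_left (g := Complex.ofReal) Complex.ofReal_zero).toSchwartzMap
    (Complex.ofRealCLM.contDiff.comp hg)
  have hφ := integral_fourier_mul hi (𝓕⁻ φ)
  simp only [FourierTransform.fourier_fourierInv_eq, h0, mul_zero, integral_zero] at hφ
  exact hφ

theorem complexMeasure_ext_of_integral_chi {ρ ρ' : ComplexMeasure (Space d)}
    (h : ∀ t, VectorMeasure.integral ρ (fun x => chi (-x) t) (ContinuousLinearMap.mul ℝ ℂ) =
      VectorMeasure.integral ρ' (fun x => chi (-x) t) (ContinuousLinearMap.mul ℝ ℂ)) :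
    ρ = ρ' := by
  have hchi (t : Space d) : Measurable fun x => chi (-x) t :=
    continuous_chi_neg_uncurry.along_fst.measurable
  have hint (t : Space d) (ρ : ComplexMeasure (Space d)) :
      VectorMeasure.Integrable ρ fun x => chi (-x) t :=
    Integrable.of_bound (hchi t).aestronglyMeasurable 1 (ae_of_all _ fun x => (norm_chi _ _).le)
  have hsub (t : Space d) : VectorMeasure.integral (ρ - ρ') (fun x => chi (-x) t)
      (ContinuousLinearMap.mul ℝ ℂ) = 0 := by
    rw [VectorMeasure.integral_sub_vectorMeasure (hint t ρ) (hint t ρ'), h, sub_self]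
  obtain ⟨ν, g, hi, hν, hρ⟩ := exists_eq_withDensityᵥ (ρ - ρ')
  simp only [hρ, integral_withDensityᵥ hi (hchi _) fun _ => (norm_chi _ _).le] at hsub
  rw [← sub_eq_zero, hρ, WithDensityᵥEq.congr_ae (ae_eq_zero_of_integral_chi_mul_eq_zero hi hsub),
    withDensityᵥ_zero]

end Uniqueness

/-! ### The embedding -/

section IntegrableWeight

variable {E : Type*} [NormedAddCommGroup E] [MeasurableSpace E] {ω : Measure E}

lemma isLocallyFiniteMeasure_of_integrable_pos {f : E → ℝ} (hf : Continuous f) (h0 : ∀ x, 0 < f x)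
    (h : Integrable f ω) : IsLocallyFiniteMeasure ω :=
  ⟨fun x => ⟨{y | f x / 2 < f y},
    (hf.tendsto x).eventually (lt_mem_nhds (half_lt_self (h0 x))),
    h.measure_gt_lt_top (half_pos (h0 x))⟩⟩

lemma hasTemperateGrowth_of_integrable_decayWeight {n : ℕ} (h : Integrable (decayWeight n) ω) :
    ω.HasTemperateGrowth := by
  refine ⟨n, h.congr (ae_of_all _ fun x => ?_)⟩
  beta_reduce
  rw [decayWeight, Real.rpow_neg (by positivity), Real.rpow_natCast]

end IntegrableWeight

section CountingMap

variable {d m : ℕ} {r : ℝ}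

lemma countingFn_add (w : Fin m → ℝ) {f g : Space d → ℂ} {lam : Config d m r}
    (hf : ∀ i, Integrable f (colour i lam)) (hg : ∀ i, Integrable g (colour i lam)) :
    countingFn w (f + g) lam = countingFn w f lam + countingFn w g lam := by
  simp only [countingFn, integral_add' (hf _) (hg _), mul_add, Finset.sum_add_distrib]

lemma countingFn_smul (w : Fin m → ℝ) (c : ℂ) (f : Space d → ℂ) (lam : Config d m r) :
    countingFn w (c • f) lam = c * countingFn w f lam := by
  simp only [countingFn, Finset.mul_sum, Pi.smul_apply, smul_eq_mul, integral_const_mul,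
    mul_left_comm]

variable [Fact (0 < r)]

lemma integrable_colour_schwartz (f : 𝓢(Space d, ℂ)) (i : Fin m) (lam : Config d m r) :
    Integrable f (colour i lam) :=
  let ⟨_, _, hA⟩ := exists_norm_schwartzMap_le_decayWeight f (d + 1)
  integrable_colour f.continuous.stronglyMeasurable hA i lam

variable {μ : Measure (Config d m r)} [IsFiniteMeasure μ]

lemma memLp_countingFn (w : Fin m → ℝ) {f : Space d → ℂ} (hf : Measurable f) {A : ℝ}
    (hA0 : 0 ≤ A) (hA : ∀ x, ‖f x‖ ≤ A * decayWeight (d + 1) x) : MemLp (countingFn w f) 2 μ :=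
  MemLp.of_bound (measurable_countingFn w hf).aestronglyMeasurable _
    (ae_of_all _ (norm_countingFn_le w hA0 hA))

lemma memLp_countingFn_schwartz (w : Fin m → ℝ) (f : 𝓢(Space d, ℂ)) :
    MemLp (countingFn w f) 2 μ :=
  let ⟨_, hA0, hA⟩ := exists_norm_schwartzMap_le_decayWeight f (d + 1)
  memLp_countingFn w f.continuous.measurable hA0 hA

variable (μ) in
/-- The map `f ↦ N^w_f` from Schwartz functions to `L²(X, μ)`. -/
def countingMap (w : Fin m → ℝ) : 𝓢(Space d, ℂ) →ₗ[ℂ] Lp ℂ 2 μ where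
  toFun f := (memLp_countingFn_schwartz w f).toLp _
  map_add' f g := by
    rw [← MemLp.toLp_add]
    exact MemLp.toLp_congr _ _ (ae_of_all _ fun lam => countingFn_add w
      (fun i => integrable_colour_schwartz f i lam) fun i => integrable_colour_schwartz g i lam)
  map_smul' c f := by
    rw [RingHom.id_apply, ← MemLp.toLp_const_smul]
    exact MemLp.toLp_congr _ _ (ae_of_all _ fun lam => countingFn_smul w c f lam)

lemma coeFn_countingMap (w : Fin m → ℝ) (f : 𝓢(Space d, ℂ)) :
    countingMap μ w f =ᵐ[μ] countingFn w f :=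
  (memLp_countingFn_schwartz w f).coeFn_toLp

end CountingMap

section FourierToLp

variable {d : ℕ} (ω : Measure (Space d)) [ω.HasTemperateGrowth]

/-- The map `f ↦ f^` from Schwartz functions to `L²(ℝ^d, ω)`. -/
def fourierToLp : 𝓢(Space d, ℂ) →ₗ[ℂ] Lp ℂ 2 ω :=
  (SchwartzMap.toLpCLM ℂ ℂ 2 ω).toLinearMap ∘ₗ
    (FourierTransform.fourierCLM ℂ 𝓢(Space d, ℂ)).toLinearMap

lemma coeFn_fourierToLp (f : 𝓢(Space d, ℂ)) : fourierToLp ω f =ᵐ[ω] 𝓕 (f : Space d → ℂ) :=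
  (𝓕 f : 𝓢(Space d, ℂ)).coeFn_toLp 2 ω

lemma denseRange_fourierToLp [IsLocallyFiniteMeasure ω] : DenseRange (fourierToLp ω) := by
  have h : DenseRange (SchwartzMap.toLpCLM ℂ ℂ 2 ω : 𝓢(Space d, ℂ) → Lp ℂ 2 ω) :=
    SchwartzMap.denseRange_toLpCLM (by norm_num)
  refine Dense.mono ?_ h
  rintro _ ⟨f, rfl⟩
  refine ⟨𝓕⁻ f, ?_⟩
  change SchwartzMap.toLpCLM ℂ ℂ 2 ω (𝓕 (𝓕⁻ f)) = _
  rw [FourierTransform.fourier_fourierInv_eq]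

end FourierToLp

section Embedding

variable {d m : ℕ} {r : ℝ} {μ : Measure (Config d m r)} [Fact (0 < r)] [IsFiniteMeasure μ]
  {w : Fin m → ℝ} {ω : Measure (Space d)} [ω.HasTemperateGrowth]

lemma IsCountingEmbedding.apply_fourierToLp {θ : Lp ℂ 2 ω →ₗᵢ[ℂ] Lp ℂ 2 μ}
    (h : IsCountingEmbedding μ w ω θ) (f : 𝓢(Space d, ℂ)) :
    θ (fourierToLp ω f) = countingMap μ w f :=
  (h f).2.2

lemma norm_countingMap_eq [VAddInvariantMeasure (Space d) (Config d m r) μ]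
    [IsLocallyFiniteMeasure ω] (h : IsFourierTransform (palmMoment μ w) ω) (f : 𝓢(Space d, ℂ)) :
    ‖countingMap μ w f‖ = ‖fourierToLp ω f‖ := by
  have hinner : inner ℂ (countingMap μ w f) (countingMap μ w f) =
      inner ℂ (fourierToLp ω f) (fourierToLp ω f) := by
    rw [L2.inner_def, L2.inner_def]
    calc ∫ lam, inner ℂ (countingMap μ w f lam) (countingMap μ w f lam) ∂μ
        = ∫ lam, countingFn w f lam * conj (countingFn w f lam) ∂μ :=
          integral_congr_ae <| (coeFn_countingMap w f).mono fun lam h => by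
            simp only [h, RCLike.inner_apply]
      _ = ∫ k, (𝓕 f : 𝓢(Space d, ℂ)) k * conj ((𝓕 f : 𝓢(Space d, ℂ)) k) ∂ω :=
          integral_countingFn_schwartz h f f
      _ = ∫ k, inner ℂ (fourierToLp ω f k) (fourierToLp ω f k) ∂ω :=
          integral_congr_ae <| (coeFn_fourierToLp ω f).symm.mono fun k h => by
            simp only [← h, RCLike.inner_apply, SchwartzMap.fourier_coe]
  rw [inner_self_eq_norm_sq_to_K, inner_self_eq_norm_sq_to_K] at hinner
  exact (pow_left_inj₀ (norm_nonneg _) (norm_nonneg _) two_ne_zero).1 (by exact_mod_cast hinner)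

theorem exists_isCountingEmbedding [VAddInvariantMeasure (Space d) (Config d m r) μ]
    [IsLocallyFiniteMeasure ω] (h : IsFourierTransform (palmMoment μ w) ω) :
    ∃ θ : Lp ℂ 2 ω →ₗᵢ[ℂ] Lp ℂ 2 μ, IsCountingEmbedding μ w ω θ := by
  let T : Lp ℂ 2 ω →L[ℂ] Lp ℂ 2 μ := (countingMap μ w).extendOfNorm (fourierToLp ω)
  have hT (f : 𝓢(Space d, ℂ)) : T (fourierToLp ω f) = countingMap μ w f :=
    LinearMap.extendOfNorm_eq (denseRange_fourierToLp ω)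
      ⟨1, fun f => by rw [one_mul, norm_countingMap_eq h]⟩ f
  have hnorm (u : Lp ℂ 2 ω) : ‖T u‖ = ‖u‖ :=
    (denseRange_fourierToLp ω).induction_on (p := fun u => ‖T u‖ = ‖u‖) u
      (isClosed_eq (by fun_prop) (by fun_prop)) fun f => by rw [hT, norm_countingMap_eq h]
  exact ⟨⟨T.toLinearMap, hnorm⟩, fun f =>
    ⟨(𝓕 f : 𝓢(Space d, ℂ)).memLp 2 ω, memLp_countingFn_schwartz w f, hT f⟩⟩

theorem IsCountingEmbedding.unique [IsLocallyFiniteMeasure ω] {θ θ' : Lp ℂ 2 ω →ₗᵢ[ℂ] Lp ℂ 2 μ}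
    (h : IsCountingEmbedding μ w ω θ) (h' : IsCountingEmbedding μ w ω θ') : θ' = θ :=
  DFunLike.coe_injective <| (denseRange_fourierToLp ω).equalizer θ'.continuous θ.continuous <|
    funext fun f => (h'.apply_fourierToLp f).trans (h.apply_fourierToLp f).symm

end Embedding

section Representations

variable {d m : ℕ} {r : ℝ} {μ : Measure (Config d m r)} {ω : Measure (Space d)}

lemma coeFn_multiplicationRep (t : Space d) (f : Lp ℂ 2 ω) :
    multiplicationRep ω t f =ᵐ[ω] fun x => chi (-t) x * f x :=
  (memLp_chi_mul ω t f).coeFn_toLp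

lemma multiplicationRep_smul (t : Space d) (c : ℂ) (f : Lp ℂ 2 ω) :
    multiplicationRep ω t (c • f) = c • multiplicationRep ω t f := by
  refine Lp.ext ?_
  filter_upwards [coeFn_multiplicationRep t (c • f), coeFn_multiplicationRep t f,
    Lp.coeFn_smul c f, Lp.coeFn_smul c (multiplicationRep ω t f)] with x h1 h2 h3 h4
  rw [h1, h4, h3, Pi.smul_apply, Pi.smul_apply, h2, smul_eq_mul, smul_eq_mul, mul_left_comm]

lemma continuous_multiplicationRep (t : Space d) : Continuous (multiplicationRep ω t) := by
  refine Isometry.continuous fun f g => ?_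
  rw [Lp.edist_def, Lp.edist_def]
  refine eLpNorm_congr_norm_ae ?_
  filter_upwards [coeFn_multiplicationRep t f, coeFn_multiplicationRep t g] with x h1 h2
  rw [Pi.sub_apply, Pi.sub_apply, h1, h2, ← mul_sub, norm_mul, norm_chi, one_mul]

lemma fourier_translate (f : Space d → ℂ) (t k : Space d) :
    𝓕 (fun x => f (-t + x)) k = chi (-t) k * 𝓕 f k := by
  rw [fourier_eq_integral_chi, fourier_eq_integral_chi, ← integral_const_mul,
    ← integral_add_left_eq_self (fun x => chi (-x) k * f (-t + x)) t]
  simp only [neg_add_cancel_left, neg_add, chi_add_left, mul_assoc]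

lemma multiplicationRep_fourierToLp [ω.HasTemperateGrowth] (t : Space d) {f g : 𝓢(Space d, ℂ)}
    (h : (g : Space d → ℂ) = fun x => f (-t + x)) :
    multiplicationRep ω t (fourierToLp ω f) = fourierToLp ω g := by
  refine Lp.ext ?_
  filter_upwards [coeFn_multiplicationRep t (fourierToLp ω f), coeFn_fourierToLp ω f,
    coeFn_fourierToLp ω g] with k h1 h2 h3
  rw [h1, h2, h3, h, fourier_translate]

variable [VAddInvariantMeasure (Space d) (Config d m r) μ]

lemma coeFn_translationRep (t : Space d) (F : Lp ℂ 2 μ) :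
    translationRep μ t F =ᵐ[μ] fun lam => F (-t +ᵥ lam) :=
  Lp.coeFn_compMeasurePreserving _ _

lemma translationRep_smul (t : Space d) (c : ℂ) (F : Lp ℂ 2 μ) :
    translationRep μ t (c • F) = c • translationRep μ t F :=
  map_smul (Lp.compMeasurePreservingₗ ℂ _ (measurePreserving_vadd (-t) μ)) c F

lemma continuous_translationRep (t : Space d) : Continuous (translationRep μ t) :=
  (Lp.isometry_compMeasurePreserving _).continuous

lemma translationRep_countingMap [Fact (0 < r)] [IsFiniteMeasure μ] (w : Fin m → ℝ) (t : Space d)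
    {f g : 𝓢(Space d, ℂ)} (h : (g : Space d → ℂ) = fun x => f (-t + x)) :
    translationRep μ t (countingMap μ w f) = countingMap μ w g := by
  refine (Lp.toLp_compMeasurePreserving (memLp_countingFn_schwartz w f)
    (measurePreserving_vadd (-t) μ)).trans ?_
  refine MemLp.toLp_congr _ (memLp_countingFn_schwartz w g) (ae_of_all _ fun lam => ?_)
  rw [Function.comp_apply, countingFn_vadd, h]

theorem IsCountingEmbedding.intertwines [Fact (0 < r)] [IsFiniteMeasure μ] {w : Fin m → ℝ}
    [ω.HasTemperateGrowth] [IsLocallyFiniteMeasure ω] {θ : Lp ℂ 2 ω →ₗᵢ[ℂ] Lp ℂ 2 μ}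
    (h : IsCountingEmbedding μ w ω θ) (t : Space d) (u : Lp ℂ 2 ω) :
    θ (multiplicationRep ω t u) = translationRep μ t (θ u) := by
  refine (denseRange_fourierToLp ω).induction_on
    (p := fun u => θ (multiplicationRep ω t u) = translationRep μ t (θ u)) u
    (isClosed_eq (θ.continuous.comp (continuous_multiplicationRep t))
      ((continuous_translationRep t).comp θ.continuous)) fun f => ?_
  have hshift : (f.compSubConstCLM ℂ t : Space d → ℂ) = fun x => f (-t + x) := by
    funext x
    rw [neg_add_eq_sub]
    rfl
  rw [multiplicationRep_fourierToLp t hshift, h.apply_fourierToLp, h.apply_fourierToLp,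
    translationRep_countingMap w t hshift]

end Representations

section CrossSpectralMeasures

variable {d : ℕ}

lemma isCrossSpectralMeasure_map_iff {H K : Type*} [NormedAddCommGroup H] [InnerProductSpace ℂ H]
    [NormedAddCommGroup K] [InnerProductSpace ℂ K] {V : Space d → H → H} {S : Space d → K → K}
    {θ : H →ₗᵢ[ℂ] K} (hθ : ∀ t u, θ (V t u) = S t (θ u)) (u v : H)
    (ρ : ComplexMeasure (Space d)) :
    IsCrossSpectralMeasure S (θ u) (θ v) ρ ↔ IsCrossSpectralMeasure V u v ρ := by
  simp only [IsCrossSpectralMeasure, ← hθ, LinearIsometry.inner_map_map]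

theorem isCrossSpectralMeasure_multiplicationRep_iff {ω : Measure (Space d)} (f g : Lp ℂ 2 ω)
    (ρ : ComplexMeasure (Space d)) :
    IsCrossSpectralMeasure (multiplicationRep ω) f g ρ ↔
      ρ = ω.withDensityᵥ fun x => f x * conj (g x) := by
  have hi : Integrable (fun x => f x * conj (g x)) ω := by
    simpa only [RCLike.inner_apply] using L2.integrable_inner (𝕜 := ℂ) g f
  have hdensity : IsCrossSpectralMeasure (multiplicationRep ω) f g
      (ω.withDensityᵥ fun x => f x * conj (g x)) := by
    intro t
    have hchi : Measurable fun x => chi (-x) t :=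
      continuous_chi_neg_uncurry.along_fst.measurable
    rw [integral_withDensityᵥ hi hchi fun _ => (norm_chi _ _).le, L2.inner_def]
    refine integral_congr_ae ?_
    filter_upwards [coeFn_multiplicationRep t f] with x hx
    rw [hx, RCLike.inner_apply, chi_neg_left, chi_comm, ← chi_neg_left, mul_assoc]
  exact ⟨fun h => complexMeasure_ext_of_integral_chi fun t => (h t).symm.trans (hdensity t),
    fun h => h ▸ hdensity⟩

end CrossSpectralMeasures

/-! ### Eigenfunctions -/

section Eigenfunctions

variable {d : ℕ} {H K : Type*} [NormedAddCommGroup H] [InnerProductSpace ℂ H]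
  [NormedAddCommGroup K] [InnerProductSpace ℂ K] {V : Space d → H → H} {S : Space d → K → K}

lemma IsEigenfunction.smul {k : Space d} {u : H} (h : IsEigenfunction V k u)
    (hV : ∀ t (c : ℂ) u, V t (c • u) = c • V t u) {c : ℂ} (hc : c ≠ 0) :
    IsEigenfunction V k (c • u) :=
  ⟨smul_ne_zero hc h.1, fun t => by rw [hV, h.2, smul_comm]⟩

lemma isEigenfunction_map_iff {θ : H →ₗᵢ[ℂ] K} (hθ : ∀ t u, θ (V t u) = S t (θ u)) (k : Space d)
    (u : H) : IsEigenfunction S k (θ u) ↔ IsEigenfunction V k u := by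
  simp only [IsEigenfunction, ← hθ, ← map_smul, θ.injective.eq_iff, Ne,
    map_eq_zero_iff θ θ.injective]

end Eigenfunctions

section MultiplicationEigenfunctions

variable {d : ℕ} {ω : Measure (Space d)} {k x : Space d}

lemma eq_zero_of_forall_chi_eq_one (h : ∀ t, chi x t = 1) : x = 0 := by
  by_contra hx
  have hnorm : ‖x‖ ≠ 0 := norm_ne_zero_iff.2 hx
  have hhalf : 2 * Real.pi * ((2 * ‖x‖ ^ 2)⁻¹ * ‖x‖ ^ 2) = Real.pi := by field_simp
  have hneg : chi x ((2 * ‖x‖ ^ 2)⁻¹ • x) = -1 := by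
    rw [chi, inner_smul_right, real_inner_self_eq_norm_sq, Real.fourierChar_apply, hhalf,
      Complex.exp_pi_mul_I]
  exact absurd (hneg.symm.trans (h _)) (by norm_num)

lemma eq_neg_of_forall_chi_eq {s : ℕ → Space d} (hs : DenseRange s)
    (h : ∀ n, chi (-s n) x = chi k (s n)) : x = -k := by
  have hall : (fun t => chi (-t) x) = chi k :=
    hs.equalizer continuous_chi_neg_uncurry.along_fst (continuous_chi k) (funext h)
  refine eq_neg_of_add_eq_zero_left (eq_zero_of_forall_chi_eq_one fun t => ?_)
  rw [chi_add_left, ← congrFun hall t, chi_comm x t, mul_comm, chi_neg_mul]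

lemma IsEigenfunction.ae_eq_zero_of_ne {f : Lp ℂ 2 ω}
    (hf : IsEigenfunction (multiplicationRep ω) k f) : ∀ᵐ x ∂ω, x ≠ -k → f x = 0 := by
  have hae (t : Space d) : ∀ᵐ x ∂ω, chi (-t) x * f x = chi k t * f x := by
    filter_upwards [coeFn_multiplicationRep t f, Lp.coeFn_smul (chi k t) f] with x h1 h2
    rw [← h1, hf.2 t, h2, Pi.smul_apply, smul_eq_mul]
  obtain ⟨s, hs⟩ := TopologicalSpace.exists_dense_seq (Space d)
  filter_upwards [ae_all_iff.2 fun n => hae (s n)] with x hx hne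
  by_contra hfx
  exact hne (eq_neg_of_forall_chi_eq hs fun n => mul_right_cancel₀ hfx (hx n))

variable [IsLocallyFiniteMeasure ω]

lemma norm_pointIndicator (x : Space d) : ‖pointIndicator ω x‖ = √((ω {x}).toReal) := by
  rw [pointIndicator, norm_indicatorConstLp (by norm_num) (by norm_num), norm_one, one_mul,
    Real.sqrt_eq_rpow, ENNReal.toReal_ofNat, Measure.real]

lemma pointIndicator_ne_zero_iff (x : Space d) : pointIndicator ω x ≠ 0 ↔ ω {x} ≠ 0 := by
  rw [← norm_ne_zero_iff, norm_pointIndicator, Real.sqrt_ne_zero ENNReal.toReal_nonneg,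
    ENNReal.toReal_ne_zero, and_iff_left isCompact_singleton.measure_ne_top]

lemma coeFn_pointIndicator (x : Space d) :
    pointIndicator ω x =ᵐ[ω] Set.indicator {x} fun _ => 1 :=
  indicatorConstLp_coeFn

lemma eq_smul_pointIndicator {f : Lp ℂ 2 ω} (h : ∀ᵐ y ∂ω, y ≠ x → f y = 0) :
    f = f x • pointIndicator ω x := by
  refine Lp.ext ?_
  filter_upwards [h, Lp.coeFn_smul (f x) (pointIndicator ω x), coeFn_pointIndicator x]
    with y h1 h2 h3
  rw [h2, Pi.smul_apply, h3, smul_eq_mul]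
  obtain rfl | hy := eq_or_ne y x
  · rw [Set.indicator_of_mem (Set.mem_singleton _), mul_one]
  · rw [Set.indicator_of_notMem (Set.mem_singleton_iff.not.2 hy), mul_zero, h1 hy]

lemma multiplicationRep_pointIndicator (k t : Space d) :
    multiplicationRep ω t (pointIndicator ω (-k)) = chi k t • pointIndicator ω (-k) := by
  refine Lp.ext ?_
  filter_upwards [coeFn_multiplicationRep t (pointIndicator ω (-k)),
    Lp.coeFn_smul (chi k t) (pointIndicator ω (-k)), coeFn_pointIndicator (-k)] with x h1 h2 h3
  rw [h1, h2, Pi.smul_apply, h3, smul_eq_mul]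
  obtain rfl | hx := eq_or_ne x (-k)
  · rw [chi_neg_left, chi_neg_right, Complex.conj_conj, chi_comm]
  · rw [Set.indicator_of_notMem (Set.mem_singleton_iff.not.2 hx), mul_zero, mul_zero]

lemma isEigenfunction_pointIndicator_iff :
    IsEigenfunction (multiplicationRep ω) k (pointIndicator ω (-k)) ↔ ω {-k} ≠ 0 := by
  rw [IsEigenfunction, pointIndicator_ne_zero_iff]
  exact and_iff_left (multiplicationRep_pointIndicator k)

theorem isEigenfunction_multiplicationRep_iff {f : Lp ℂ 2 ω} :
    IsEigenfunction (multiplicationRep ω) k f ↔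
      ω {-k} ≠ 0 ∧ ∃ c : ℂ, c ≠ 0 ∧ f = c • pointIndicator ω (-k) := by
  constructor
  · intro hf
    have heq := eq_smul_pointIndicator hf.ae_eq_zero_of_ne
    have hne : f (-k) • pointIndicator ω (-k) ≠ 0 := heq ▸ hf.1
    rw [smul_ne_zero_iff, pointIndicator_ne_zero_iff] at hne
    exact ⟨hne.2, f (-k), hne.1, heq⟩
  · rintro ⟨hk, c, hc, rfl⟩
    exact (isEigenfunction_pointIndicator_iff.2 hk).smul multiplicationRep_smul hc

theorem exists_isEigenfunction_multiplicationRep_iff :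
    (∃ f, IsEigenfunction (multiplicationRep ω) k f) ↔ ω {-k} ≠ 0 :=
  ⟨fun ⟨_, hf⟩ => (isEigenfunction_multiplicationRep_iff.1 hf).1,
    fun h => ⟨_, isEigenfunction_pointIndicator_iff.2 h⟩⟩

end MultiplicationEigenfunctions

section TranslationEigenfunctions

variable {d m : ℕ} {r : ℝ} {μ : Measure (Config d m r)} {k : Space d} {F G : Lp ℂ 2 μ}

lemma IsEigenfunction.ae_vadd_eq [VAddInvariantMeasure (Space d) (Config d m r) μ]
    (hF : IsEigenfunction (translationRep μ) k F) (t : Space d) :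
    ∀ᵐ lam ∂μ, F (t +ᵥ lam) = chi k (-t) * F lam := by
  have hcoe := coeFn_translationRep (-t) F
  rw [hF.2 (-t), neg_neg] at hcoe
  filter_upwards [hcoe, Lp.coeFn_smul (chi k (-t)) F] with lam h1 h2
  rw [← h1, h2, Pi.smul_apply, smul_eq_mul]

variable [ErgodicVAdd (Space d) (Config d m r) μ]

lemma IsEigenfunction.exists_ae_mul_conj_eq (hF : IsEigenfunction (translationRep μ) k F)
    (hG : IsEigenfunction (translationRep μ) k G) :
    ∃ c : ℂ, ∀ᵐ lam ∂μ, F lam * conj (G lam) = c := by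
  refine exists_ae_eq_const_of_forall_vadd_ae_eq (G := Space d) ((Lp.aestronglyMeasurable F).mul
    (Complex.continuous_conj.comp_aestronglyMeasurable (Lp.aestronglyMeasurable G))) fun t => ?_
  filter_upwards [hF.ae_vadd_eq t, hG.ae_vadd_eq t] with lam h1 h2
  have hunit : chi k (-t) * conj (chi k (-t)) = 1 := by
    rw [Complex.mul_conj', norm_chi, Complex.ofReal_one, one_pow]
  rw [h1, h2, map_mul, mul_mul_mul_comm, hunit, one_mul]

lemma IsEigenfunction.exists_eq_smul (hF : IsEigenfunction (translationRep μ) k F)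
    (hG : IsEigenfunction (translationRep μ) k G) : ∃ c : ℂ, F = c • G := by
  obtain ⟨a, ha⟩ := hF.exists_ae_mul_conj_eq hG
  obtain ⟨b, hb⟩ := hG.exists_ae_mul_conj_eq hG
  have hb0 : b ≠ 0 := by
    rintro rfl
    refine hG.1 (Lp.ext ?_)
    filter_upwards [hb, Lp.coeFn_zero ℂ 2 μ] with lam h1 h2
    rw [h2, Pi.zero_apply]
    simpa using h1
  refine ⟨a / b, Lp.ext ?_⟩
  filter_upwards [ha, hb, Lp.coeFn_smul (a / b) G] with lam h1 h2 h3
  rw [h3, Pi.smul_apply, smul_eq_mul, div_mul_eq_mul_div, eq_div_iff hb0, ← h1, ← h2]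
  ring

theorem isEigenfunction_translationRep_iff (hG : IsEigenfunction (translationRep μ) k G) :
    IsEigenfunction (translationRep μ) k F ↔ ∃ c : ℂ, c ≠ 0 ∧ F = c • G := by
  constructor
  · intro hF
    obtain ⟨c, rfl⟩ := hF.exists_eq_smul hG
    exact ⟨c, (smul_ne_zero_iff.1 hF.1).1, rfl⟩
  · rintro ⟨c, hc, rfl⟩
    exact hG.smul translationRep_smul hc

end TranslationEigenfunctions

/-! ### Counting functions of compactly supported functions -/

section SchwartzApproximation

variable {d : ℕ} {f g : Space d → ℂ}

lemma exists_schwartz_norm_sub_le_decayWeight (hf : Continuous f) (hs : HasCompactSupport f) (n : ℕ)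
    {ε : ℝ} (hε : 0 < ε) : ∃ g : 𝓢(Space d, ℂ), ∀ x, ‖g x - f x‖ ≤ ε * decayWeight n x := by
  obtain ⟨ρ, hρ0, hρ⟩ := exists_forall_eq_zero_of_lt_norm hs
  obtain ⟨g, hg, hgf⟩ := exists_schwartz_dist_le_of_hasCompactSupport hf hρ
    (ε := ε * ((1 + (ρ + 1)) ^ n)⁻¹) (by positivity)
  refine ⟨g, fun x => ?_⟩
  obtain hx | hx := le_or_gt ‖x‖ (ρ + 1)
  · refine (hgf x).trans ?_
    rw [decayWeight]
    gcongr
  · rw [hg x hx, hρ x (by linarith), sub_zero, norm_zero]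
    exact mul_nonneg hε.le (decayWeight_pos n x).le

lemma norm_fourier_sub_le (hf : Integrable f) (hg : Integrable g) (k : Space d) :
    ‖𝓕 f k - 𝓕 g k‖ ≤ ∫ x, ‖f x - g x‖ := by
  have hint {f : Space d → ℂ} (hf : Integrable f) : Integrable fun v => chi (-v) k * f v :=
    hf.bdd_mul continuous_chi_neg_uncurry.along_fst.aestronglyMeasurable
      (ae_of_all _ fun v => (norm_chi (-v) k).le)
  rw [fourier_eq_integral_chi, fourier_eq_integral_chi, ← integral_sub (hint hf) (hint hg)]
  refine norm_integral_le_of_norm_le (hf.sub hg).norm (ae_of_all _ fun x => ?_)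
  rw [← mul_sub, norm_mul, norm_chi, one_mul]

lemma continuous_fourier (hf : Integrable f) : Continuous (𝓕 f) :=
  VectorFourier.fourierIntegral_continuous Real.continuous_fourierChar
    continuous_inner hf

lemma tendsto_fourier (hf : Integrable f) {g : ℕ → Space d → ℂ} (hg : ∀ n, Integrable (g n))
    {ε : ℕ → ℝ} (hε : Tendsto ε atTop (𝓝 0))
    (h : ∀ n x, ‖g n x - f x‖ ≤ ε n * decayWeight (d + 1) x) (k : Space d) :
    Tendsto (fun n => 𝓕 (g n) k) atTop (𝓝 (𝓕 f k)) := by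
  rw [tendsto_iff_norm_sub_tendsto_zero]
  refine squeeze_zero (fun _ => norm_nonneg _) (fun n => (norm_fourier_sub_le (hg n) hf k).trans ?_)
    (g := fun n => ε n * ∫ x : Space d, decayWeight (d + 1) x) (by simpa using hε.mul_const _)
  rw [← integral_const_mul]
  exact integral_mono ((hg n).sub hf).norm ((integrable_decayWeight (by simp)).const_mul _) (h n)

end SchwartzApproximation

section Limits

lemma exists_tendsto_of_isometry {ι Y Z : Type*} [MetricSpace Y] [CompleteSpace Y] [MetricSpace Z]
    {θ : Y → Z} (hθ : Isometry θ) {l : Filter ι} [l.NeBot] {u : ι → Y} {z : Z}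
    (h : Tendsto (fun n => θ (u n)) l (𝓝 z)) : ∃ y, θ y = z ∧ Tendsto u l (𝓝 y) := by
  obtain ⟨y, rfl⟩ := hθ.isClosedEmbedding.isClosed_range.mem_of_tendsto h
    (Eventually.of_forall fun n => ⟨_, rfl⟩)
  exact ⟨y, rfl, hθ.isClosedEmbedding.isEmbedding.tendsto_nhds_iff.2 h⟩

lemma ae_eq_of_tendsto_Lp {α E : Type*} [MeasurableSpace α] {μ : Measure α} [NormedAddCommGroup E]
    {p : ENNReal} [Fact (1 ≤ p)] {u : ℕ → Lp E p μ} {v : Lp E p μ} {g : ℕ → α → E} {f : α → E}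
    (hu : Tendsto u atTop (𝓝 v)) (hug : ∀ n, u n =ᵐ[μ] g n)
    (hg : ∀ x, Tendsto (fun n => g n x) atTop (𝓝 (f x))) : v =ᵐ[μ] f := by
  obtain ⟨ns, hns, hae⟩ := (tendstoInMeasure_of_tendsto_Lp hu).exists_seq_tendsto_ae
  filter_upwards [hae, ae_all_iff.2 hug] with x hx hugx
  exact tendsto_nhds_unique hx
    (((hg x).comp hns.tendsto_atTop).congr fun n => (hugx (ns n)).symm)

end Limits

section CompactSupport

variable {d m : ℕ} {r : ℝ} {μ : Measure (Config d m r)} [Fact (0 < r)] [IsFiniteMeasure μ]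
  {w : Fin m → ℝ} {f : Space d → ℂ}

lemma memLp_countingFn_of_hasCompactSupport (w : Fin m → ℝ) (hf : Continuous f)
    (hs : HasCompactSupport f) : MemLp (countingFn w f) 2 μ :=
  let ⟨_, hA0, hA⟩ := exists_norm_le_decayWeight_of_hasCompactSupport hf hs (d + 1)
  memLp_countingFn w hf.measurable hA0 hA

lemma norm_countingFn_sub_le {g : 𝓢(Space d, ℂ)} (hf : Continuous f) (hs : HasCompactSupport f)
    {ε : ℝ} (hε : 0 ≤ ε) (h : ∀ x, ‖g x - f x‖ ≤ ε * decayWeight (d + 1) x)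
    (lam : Config d m r) :
    ‖countingFn w g lam - countingFn w f lam‖ ≤
      ε * ((∑ i, |w i|) * (weightConst (Space d) (r / 2) (d + 1)).toReal) := by
  obtain ⟨A, -, hA⟩ := exists_norm_le_decayWeight_of_hasCompactSupport hf hs (d + 1)
  have hfi (i : Fin m) : Integrable f (colour i lam) :=
    integrable_colour hf.stronglyMeasurable hA i lam
  have hadd := countingFn_add w (fun i => (integrable_colour_schwartz g i lam).sub (hfi i)) hfi
  rw [sub_add_cancel] at hadd
  rw [hadd, add_sub_cancel_right]
  exact norm_countingFn_le w hε h lam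

lemma norm_countingMap_sub_toLp_le {g : 𝓢(Space d, ℂ)} (hf : Continuous f)
    (hs : HasCompactSupport f) {ε : ℝ} (hε : 0 ≤ ε)
    (h : ∀ x, ‖g x - f x‖ ≤ ε * decayWeight (d + 1) x) :
    ‖countingMap μ w g - (memLp_countingFn_of_hasCompactSupport w hf hs).toLp _‖ ≤
      (measureUnivNNReal μ : ℝ) ^ (2 : ENNReal).toReal⁻¹ *
        (ε * ((∑ i, |w i|) * (weightConst (Space d) (r / 2) (d + 1)).toReal)) := by
  refine Lp.norm_le_of_ae_bound (by positivity) ?_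
  filter_upwards [Lp.coeFn_sub (countingMap μ w g)
      ((memLp_countingFn_of_hasCompactSupport w hf hs).toLp _), coeFn_countingMap w g,
    (memLp_countingFn_of_hasCompactSupport (μ := μ) w hf hs).coeFn_toLp] with lam h1 h2 h3
  rw [h1, Pi.sub_apply, h2, h3]
  exact norm_countingFn_sub_le hf hs hε h lam

lemma tendsto_countingMap (hf : Continuous f) (hs : HasCompactSupport f) {g : ℕ → 𝓢(Space d, ℂ)}
    {ε : ℕ → ℝ} (hε0 : ∀ n, 0 ≤ ε n) (hε : Tendsto ε atTop (𝓝 0))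
    (h : ∀ n x, ‖g n x - f x‖ ≤ ε n * decayWeight (d + 1) x) :
    Tendsto (fun n => countingMap μ w (g n)) atTop
      (𝓝 ((memLp_countingFn_of_hasCompactSupport w hf hs).toLp _)) := by
  rw [tendsto_iff_norm_sub_tendsto_zero]
  exact squeeze_zero (fun _ => norm_nonneg _)
    (fun n => norm_countingMap_sub_toLp_le hf hs (hε0 n) (h n))
    (by simpa using (hε.mul_const _).const_mul _)

variable {ω : Measure (Space d)} [ω.HasTemperateGrowth] {θ : Lp ℂ 2 ω →ₗᵢ[ℂ] Lp ℂ 2 μ}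

theorem IsCountingEmbedding.exists_apply_toLp_fourier (h : IsCountingEmbedding μ w ω θ)
    (hf : Continuous f) (hs : HasCompactSupport f) :
    ∃ hF : MemLp (𝓕 f) 2 ω,
      θ (hF.toLp _) = (memLp_countingFn_of_hasCompactSupport w hf hs).toLp _ := by
  have hε (n : ℕ) : (0 : ℝ) < 1 / ((n : ℝ) + 1) := by positivity
  choose g hg using fun n => exists_schwartz_norm_sub_le_decayWeight hf hs (d + 1) (hε n)
  have hcount := tendsto_countingMap (μ := μ) (w := w) hf hs (fun n => (hε n).le)
    tendsto_one_div_add_atTop_nhds_zero_nat hg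
  obtain ⟨u, hθu, hu⟩ := exists_tendsto_of_isometry θ.isometry
    (hcount.congr fun n => (h.apply_fourierToLp (g n)).symm)
  have hae : u =ᵐ[ω] 𝓕 f := ae_eq_of_tendsto_Lp hu (fun n => coeFn_fourierToLp ω (g n))
    (tendsto_fourier (hf.integrable_of_hasCompactSupport hs) (fun n => (g n).integrable)
      tendsto_one_div_add_atTop_nhds_zero_nat hg)
  have hF : MemLp (𝓕 f) 2 ω := (memLp_congr_ae hae).1 (Lp.memLp u)
  exact ⟨hF, by rw [← hθu, Lp.ext (hF.coeFn_toLp.trans hae.symm)]⟩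

end CompactSupport

section SpectralMeasure

variable {d : ℕ}

/-- The measure `|f^|² ω`, which is the spectral measure of `N^w_f` when `ω` is the Fourier
transform of the weighted first Palm moment. -/
def spectralDensity (ω : Measure (Space d)) (f : Space d → ℂ) : Measure (Space d) :=
  ω.withDensity fun k => ENNReal.ofReal (‖𝓕 f k‖ ^ 2)

lemma integral_spectralDensity (ω : Measure (Space d)) {f : Space d → ℂ} (hf : Integrable f)
    (φ : Space d → ℂ) :
    ∫ k, φ k ∂spectralDensity ω f = ∫ k, ((‖𝓕 f k‖ ^ 2 : ℝ) : ℂ) * φ k ∂ω :=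
  integral_withDensity_ofReal ((continuous_fourier hf).norm.pow 2).measurable
    (fun _ => sq_nonneg _) φ

theorem IsSpectralMeasure.unique {H : Type*} [NormedAddCommGroup H] [InnerProductSpace ℂ H]
    {S : Space d → H → H} {u : H} {σ σ' : Measure (Space d)} (h : IsSpectralMeasure S u σ)
    (h' : IsSpectralMeasure S u σ') : σ' = σ := by
  have := h.1
  have := h'.1
  exact measure_ext_of_integral_chi fun t => (h'.2 t).symm.trans (h.2 t)

variable {m : ℕ} {r : ℝ} {μ : Measure (Config d m r)} [Fact (0 < r)] [IsFiniteMeasure μ]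
  {w : Fin m → ℝ} {ω : Measure (Space d)} [ω.HasTemperateGrowth]
  {θ : Lp ℂ 2 ω →ₗᵢ[ℂ] Lp ℂ 2 μ} {f : Space d → ℂ}

theorem IsCountingEmbedding.isSpectralMeasure
    [VAddInvariantMeasure (Space d) (Config d m r) μ] [IsLocallyFiniteMeasure ω]
    (h : IsCountingEmbedding μ w ω θ) (hf : Continuous f) (hs : HasCompactSupport f) :
    IsSpectralMeasure (translationRep μ)
      ((memLp_countingFn_of_hasCompactSupport w hf hs).toLp _) (spectralDensity ω f) := by
  obtain ⟨hF, hθ⟩ := h.exists_apply_toLp_fourier hf hs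
  refine ⟨isFiniteMeasure_withDensity_ofReal
    ((memLp_two_iff_integrable_sq_norm hF.1).1 hF).hasFiniteIntegral, fun t => ?_⟩
  rw [← hθ, ← h.intertwines, LinearIsometry.inner_map_map,
    integral_spectralDensity ω (hf.integrable_of_hasCompactSupport hs), L2.inner_def]
  refine integral_congr_ae ?_
  filter_upwards [coeFn_multiplicationRep t (hF.toLp _), hF.coeFn_toLp] with k h1 h2
  have hsq := Complex.mul_conj' (𝓕 f k)
  rw [h1, h2, RCLike.inner_apply, map_mul, chi_neg_left, Complex.conj_conj, chi_comm,
    mul_left_comm, hsq, Complex.ofReal_pow, mul_comm]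

end SpectralMeasure

/-! ### Autocorrelations along the orbits -/

section LocalAutocorrelation

variable {d : ℕ}

/-- The contribution of the point `x` to the autocorrelation of `g`, tested on `φ` and restricted
to `s`; the autocorrelation of `g` is the limit of its averages over the cubes `s = C_R`. -/
def localAutocorrelation (g φ : Space d → ℂ) (s : Set (Space d)) (x : Space d) : ℂ :=
  ∫ y in s, g x * conj (g y) * φ (x - y)

variable {g φ ψ : Space d → ℂ} {C : ℝ}

lemma measurable_mul_conj_mul_sub (hg : Measurable g) (hφ : Measurable φ) :
    Measurable fun p : Space d × Space d => g p.1 * conj (g p.2) * φ (p.1 - p.2) := by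
  fun_prop

lemma norm_mul_conj_mul_le {α : Type*} {g φ : α → ℂ} (hC : ∀ x, ‖g x‖ ≤ C) (x y z : α) :
    ‖g x * conj (g y) * φ z‖ ≤ C ^ 2 * ‖φ z‖ := by
  rw [norm_mul, norm_mul, RCLike.norm_conj, sq]
  have hC0 : 0 ≤ C := (norm_nonneg _).trans (hC x)
  gcongr
  exacts [hC x, hC y]

lemma integrable_mul_conj_mul_sub (hg : Measurable g) (hC : ∀ x, ‖g x‖ ≤ C) (hφ : Measurable φ)
    (hi : Integrable φ) (x : Space d) : Integrable fun y => g x * conj (g y) * φ (x - y) :=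
  ((hi.comp_sub_left x).norm.const_mul (C ^ 2)).mono'
    ((measurable_mul_conj_mul_sub hg hφ).comp measurable_prodMk_left).aestronglyMeasurable
    (ae_of_all _ fun y => norm_mul_conj_mul_le hC x y (x - y))

lemma norm_localAutocorrelation_le (hC : ∀ x, ‖g x‖ ≤ C) (hi : Integrable φ) (s : Set (Space d))
    (x : Space d) : ‖localAutocorrelation g φ s x‖ ≤ C ^ 2 * ∫ z, ‖φ z‖ := by
  have hdom : Integrable fun y => C ^ 2 * ‖φ (x - y)‖ := (hi.comp_sub_left x).norm.const_mul _
  calc ‖localAutocorrelation g φ s x‖ ≤ ∫ y in s, C ^ 2 * ‖φ (x - y)‖ :=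
        norm_integral_le_of_norm_le hdom.integrableOn
          (ae_of_all _ fun y => norm_mul_conj_mul_le hC x y (x - y))
    _ ≤ ∫ y, C ^ 2 * ‖φ (x - y)‖ :=
        setIntegral_le_integral hdom (ae_of_all _ fun _ => by positivity)
    _ = C ^ 2 * ∫ z, ‖φ z‖ := by
        rw [integral_const_mul, integral_sub_left_eq_self (fun z => ‖φ z‖) volume x]

lemma integrableOn_localAutocorrelation (hg : Measurable g) (hC : ∀ x, ‖g x‖ ≤ C)
    (hφ : Measurable φ) (hi : Integrable φ) (s : Set (Space d)) (R : ℝ) :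
    IntegrableOn (localAutocorrelation g φ s) (cube d R) :=
  Measure.integrableOn_of_bounded (volume_cube_lt_top R).ne
    (measurable_mul_conj_mul_sub hg hφ).stronglyMeasurable.integral_prod_right'.aestronglyMeasurable
    (ae_of_all _ (norm_localAutocorrelation_le hC hi s))

lemma localAutocorrelation_sub (hg : Measurable g) (hC : ∀ x, ‖g x‖ ≤ C) (hφ : Measurable φ)
    (hφi : Integrable φ) (hψ : Measurable ψ) (hψi : Integrable ψ) (s : Set (Space d))
    (x : Space d) :
    localAutocorrelation g φ s x - localAutocorrelation g ψ s x =
      localAutocorrelation g (φ - ψ) s x := by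
  rw [localAutocorrelation, localAutocorrelation, ← integral_sub
    (integrable_mul_conj_mul_sub hg hC hφ hφi x).integrableOn
    (integrable_mul_conj_mul_sub hg hC hψ hψi x).integrableOn]
  simp only [localAutocorrelation, Pi.sub_apply, mul_sub]

lemma norm_setAverage_localAutocorrelation_sub_le (hg : Measurable g) (hC : ∀ x, ‖g x‖ ≤ C)
    (hφ : Measurable φ) (hφi : Integrable φ) (hψ : Measurable ψ) (hψi : Integrable ψ) (R : ℝ) :
    ‖(⨍ x in cube d R, localAutocorrelation g φ (cube d R) x) -
        ⨍ x in cube d R, localAutocorrelation g ψ (cube d R) x‖ ≤ C ^ 2 * ∫ z, ‖φ z - ψ z‖ := by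
  rw [setAverage_eq, setAverage_eq, ← smul_sub,
    ← integral_sub (integrableOn_localAutocorrelation hg hC hφ hφi _ R)
      (integrableOn_localAutocorrelation hg hC hψ hψi _ R)]
  simp_rw [localAutocorrelation_sub hg hC hφ hφi hψ hψi]
  rw [norm_smul, norm_inv, Real.norm_of_nonneg measureReal_nonneg]
  refine inv_mul_le_of_le_mul₀ measureReal_nonneg (by positivity) ?_
  rw [mul_comm]
  exact norm_setIntegral_le_of_norm_le_const (volume_cube_lt_top R)
    fun x _ => norm_localAutocorrelation_le hC (hφi.sub hψi) (cube d R) x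

lemma localAutocorrelation_cube_eq {a : ℝ} (ha : ∀ z, a < ‖z‖ → φ z = 0) {R : ℝ} {x : Space d}
    (hx : x ∈ cube d (R - 2 * a)) :
    localAutocorrelation g φ (cube d R) x = localAutocorrelation g φ Set.univ x := by
  rw [localAutocorrelation, localAutocorrelation, setIntegral_univ]
  refine setIntegral_eq_integral_of_forall_compl_eq_zero fun y hy => ?_
  rw [ha, mul_zero]
  by_contra! hle
  have hmem := add_mem_cube (x := x) (t := y - x) (R := R)
    (cube_mono (by rw [norm_sub_rev]; linarith) hx)
  exact hy (by rwa [add_sub_cancel] at hmem)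

lemma norm_setIntegral_localAutocorrelation_sub_le (hg : Measurable g) (hC : ∀ x, ‖g x‖ ≤ C)
    (hφ : Measurable φ) (hi : Integrable φ) {a : ℝ} (ha0 : 0 ≤ a) (ha : ∀ z, a < ‖z‖ → φ z = 0)
    (R : ℝ) :
    ‖(∫ x in cube d R, localAutocorrelation g φ (cube d R) x) -
        ∫ x in cube d R, localAutocorrelation g φ Set.univ x‖ ≤
      2 * (C ^ 2 * ∫ z, ‖φ z‖) * (volume.real (cube d R) - volume.real (cube d (R - 2 * a))) := by
  have hsub : cube d (R - 2 * a) ⊆ cube d R := cube_mono (by linarith)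
  rw [← integral_sub (integrableOn_localAutocorrelation hg hC hφ hi _ R)
      (integrableOn_localAutocorrelation hg hC hφ hi _ R),
    setIntegral_eq_of_subset_of_forall_sdiff_eq_zero (measurableSet_cube R)
      (Set.sdiff_subset (t := cube d (R - 2 * a))) fun x hx => sub_eq_zero.2
        (localAutocorrelation_cube_eq ha (by_contra fun hn => hx.2 ⟨hx.1, hn⟩)),
    ← measureReal_sdiff hsub (measurableSet_cube _) (volume_cube_lt_top R).ne]
  refine norm_setIntegral_le_of_norm_le_const
    ((measure_mono Set.sdiff_subset).trans_lt (volume_cube_lt_top R)) fun x _ => ?_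
  rw [two_mul]
  exact norm_sub_le_of_le (norm_localAutocorrelation_le hC hi _ x)
    (norm_localAutocorrelation_le hC hi _ x)

theorem tendsto_setAverage_localAutocorrelation (hg : Measurable g) (hC : ∀ x, ‖g x‖ ≤ C)
    (hφ : Continuous φ) (hs : HasCompactSupport φ) {L : ℂ}
    (h : Tendsto (fun R => ⨍ x in cube d R, localAutocorrelation g φ Set.univ x) atTop (𝓝 L)) :
    Tendsto (fun R => ⨍ x in cube d R, localAutocorrelation g φ (cube d R) x) atTop (𝓝 L) := by
  obtain ⟨a, ha0, ha⟩ := exists_forall_eq_zero_of_lt_norm hs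
  have hboundary := tendsto_inv_measureReal_cube_smul_of_boundary
    (norm_setIntegral_localAutocorrelation_sub_le hg hC hφ.measurable
      (hφ.integrable_of_hasCompactSupport hs) ha0.le ha)
  simp only [setAverage_eq] at h ⊢
  have hsum := hboundary.add h
  rw [zero_add] at hsum
  exact hsum.congr fun R => by rw [← smul_add, sub_add_cancel]

end LocalAutocorrelation

section OrbitCorrelation

/-- The correlation function `z ↦ ∫ N(λ) conj (N(z + λ)) dμ` of an observable `N`. -/
def orbitCorrelation {G X : Type*} [MeasurableSpace X] [VAdd G X] (μ : Measure X) (N : X → ℂ)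
    (z : G) : ℂ :=
  ∫ lam, N lam * conj (N (z +ᵥ lam)) ∂μ

lemma norm_mul_conj_vadd_le {G X : Type*} [VAdd G X] {N : X → ℂ} {C : ℝ} (hC : ∀ lam, ‖N lam‖ ≤ C)
    (lam : X) (z : G) : ‖N lam * conj (N (z +ᵥ lam))‖ ≤ C ^ 2 := by
  rw [norm_mul, RCLike.norm_conj, sq]
  exact mul_le_mul (hC _) (hC _) (norm_nonneg _) ((norm_nonneg _).trans (hC lam))

lemma norm_orbitCorrelation_le {G X : Type*} [MeasurableSpace X] [VAdd G X] {μ : Measure X}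
    [IsProbabilityMeasure μ] {N : X → ℂ} {C : ℝ} (hC : ∀ lam, ‖N lam‖ ≤ C) (z : G) :
    ‖orbitCorrelation μ N z‖ ≤ C ^ 2 := by
  simpa [orbitCorrelation] using norm_integral_le_of_norm_le_const (μ := μ)
    (ae_of_all _ fun lam => norm_mul_conj_vadd_le hC lam z)

lemma measurable_mul_conj_vadd {G X : Type*} [MeasurableSpace X] [MeasurableSpace G] [VAdd G X]
    [MeasurableVAdd₂ G X] {N : X → ℂ} (hN : Measurable N) :
    Measurable fun p : X × G => N p.1 * conj (N (p.2 +ᵥ p.1)) :=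
  (hN.comp measurable_fst).mul (Complex.continuous_conj.measurable.comp
    (hN.comp (measurable_snd.vadd measurable_fst)))

lemma measurable_orbitCorrelation {G X : Type*} [MeasurableSpace X] [MeasurableSpace G] [VAdd G X]
    [MeasurableVAdd₂ G X] {μ : Measure X} [SFinite μ] {N : X → ℂ} (hN : Measurable N) :
    Measurable (orbitCorrelation μ N : G → ℂ) :=
  ((measurable_mul_conj_vadd hN).comp
    measurable_swap).stronglyMeasurable.integral_prod_right'.measurable

variable {d : ℕ} {X : Type*} [AddAction (Space d) X] {N : X → ℂ} {C : ℝ} {φ : Space d → ℂ}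

lemma localAutocorrelation_orbit (lam : X) (x : Space d) :
    localAutocorrelation (fun x => N (-x +ᵥ lam)) φ Set.univ x =
      ∫ z, N (-x +ᵥ lam) * conj (N (z +ᵥ (-x +ᵥ lam))) * φ z := by
  rw [localAutocorrelation, setIntegral_univ, ← integral_sub_left_eq_self _ volume x]
  simp only [vadd_vadd, sub_sub_cancel, neg_sub, ← sub_eq_add_neg]

variable [MeasurableSpace X] [MeasurableVAdd₂ (Space d) X] {μ : Measure X} [IsProbabilityMeasure μ]

lemma integral_integral_orbit (hN : Measurable N) (hC : ∀ lam, ‖N lam‖ ≤ C) (hφ : Measurable φ)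
    (hi : Integrable φ) :
    ∫ lam, (∫ z, N lam * conj (N (z +ᵥ lam)) * φ z) ∂μ = ∫ z, orbitCorrelation μ N z * φ z := by
  have hm : Measurable fun p : X × Space d => N p.1 * conj (N (p.2 +ᵥ p.1)) * φ p.2 :=
    (measurable_mul_conj_vadd hN).mul (hφ.comp measurable_snd)
  rw [integral_integral_swap]
  · simp_rw [integral_mul_const, orbitCorrelation]
  · refine ((hi.norm.const_mul (C ^ 2)).comp_snd μ).mono' hm.aestronglyMeasurable
      (ae_of_all _ fun p => ?_)
    simp only [Function.uncurry, norm_mul _ (φ _)]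
    gcongr
    exact norm_mul_conj_vadd_le hC p.1 p.2

lemma norm_integral_orbitCorrelation_sub_le (hN : Measurable N) (hC : ∀ lam, ‖N lam‖ ≤ C)
    {ψ : Space d → ℂ} (hφ : Integrable φ) (hψ : Integrable ψ) :
    ‖(∫ z, orbitCorrelation μ N z * φ z) - ∫ z, orbitCorrelation μ N z * ψ z‖ ≤
      C ^ 2 * ∫ z, ‖φ z - ψ z‖ := by
  have hint {φ : Space d → ℂ} (hφ : Integrable φ) :
      Integrable fun z => orbitCorrelation μ N z * φ z :=
    hφ.bdd_mul (measurable_orbitCorrelation hN).aestronglyMeasurable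
      (ae_of_all _ (norm_orbitCorrelation_le hC))
  rw [← integral_sub (hint hφ) (hint hψ), ← integral_const_mul]
  refine norm_integral_le_of_norm_le ((hφ.sub hψ).norm.const_mul _) (ae_of_all _ fun z => ?_)
  rw [← mul_sub, norm_mul]
  exact mul_le_mul_of_nonneg_right (norm_orbitCorrelation_le hC z) (norm_nonneg _)

lemma ae_tendsto_setAverage_localAutocorrelation [ErgodicVAdd (Space d) X μ] (hN : Measurable N)
    (hC : ∀ lam, ‖N lam‖ ≤ C) (hφ : Continuous φ) (hs : HasCompactSupport φ) :
    ∀ᵐ lam ∂μ, Tendsto (fun R => ⨍ x in cube d R,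
      localAutocorrelation (fun x => N (-x +ᵥ lam)) φ (cube d R) x) atTop
        (𝓝 (∫ z, orbitCorrelation μ N z * φ z)) := by
  have hi : Integrable φ := hφ.integrable_of_hasCompactSupport hs
  have hmeas : Measurable fun lam => ∫ z, N lam * conj (N (z +ᵥ lam)) * φ z :=
    ((measurable_mul_conj_vadd hN).mul
      (hφ.measurable.comp measurable_snd)).stronglyMeasurable.integral_prod_right'.measurable
  have hbound (lam : X) : ‖∫ z, N lam * conj (N (z +ᵥ lam)) * φ z‖ ≤ ∫ z, C ^ 2 * ‖φ z‖ := by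
    refine norm_integral_le_of_norm_le (hi.norm.const_mul _) (ae_of_all _ fun z => ?_)
    rw [norm_mul]
    exact mul_le_mul_of_nonneg_right (norm_mul_conj_vadd_le hC lam z) (norm_nonneg _)
  filter_upwards [ae_tendsto_setAverage_cube (d := d) (μ := μ) hmeas hbound] with lam hlam
  rw [integral_integral_orbit hN hC hφ.measurable hi] at hlam
  have hg : Measurable fun x : Space d => N (-x +ᵥ lam) := hN.comp (measurable_neg_vadd_right lam)
  refine tendsto_setAverage_localAutocorrelation hg (fun x => hC _) hφ hs ?_
  simpa only [localAutocorrelation_orbit] using hlam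

end OrbitCorrelation

section DenseTestFunctions

lemma exists_countable_forall_exists_integral_norm_sub_lt (d : ℕ) :
    ∃ S : Set C_c(Space d, ℂ), S.Countable ∧ ∀ (φ : C_c(Space d, ℂ)) (ε : ℝ), 0 < ε →
      ∃ ψ ∈ S, ∫ z, ‖φ z - ψ z‖ < ε := by
  have hmem (φ : C_c(Space d, ℂ)) : MemLp φ 1 (volume : Measure (Space d)) :=
    memLp_one_iff_integrable.2 (φ.continuous.integrable_of_hasCompactSupport φ.hasCompactSupport)
  let toL1 (φ : C_c(Space d, ℂ)) : Lp ℂ 1 (volume : Measure (Space d)) := (hmem φ).toLp _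
  have hone : Fact ((1 : ENNReal) ≠ ⊤) := ⟨ENNReal.one_ne_top⟩
  obtain ⟨t, hts, htc, hdense⟩ := (TopologicalSpace.IsSeparable.of_separableSpace
    (Set.range toL1)).exists_countable_dense_subset
  choose! F hF using fun v (hv : v ∈ t) => hts hv
  refine ⟨F '' t, htc.image F, fun φ ε hε => ?_⟩
  obtain ⟨v, hv, hdist⟩ := Metric.mem_closure_iff.1 (hdense (Set.mem_range_self φ)) ε hε
  refine ⟨F v, Set.mem_image_of_mem F hv, ?_⟩
  rw [← hF v hv, Lp.dist_edist, Lp.edist_toLp_toLp, eLpNorm_one_eq_lintegral_enorm] at hdist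
  rw [integral_norm_eq_lintegral_enorm]
  · exact hdist
  · exact (φ.continuous.sub (F v).continuous).aestronglyMeasurable

lemma tendsto_of_forall_exists_dist_le {ι Y : Type*} [PseudoMetricSpace Y] {l : Filter ι}
    {u : ι → Y} {a : Y} (h : ∀ ε > 0, ∃ (v : ι → Y) (b : Y), Tendsto v l (𝓝 b) ∧
      (∀ i, dist (u i) (v i) ≤ ε) ∧ dist b a ≤ ε) : Tendsto u l (𝓝 a) := by
  refine Metric.tendsto_nhds.2 fun ε hε => ?_
  obtain ⟨v, b, hv, huv, hba⟩ := h (ε / 3) (by positivity)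
  filter_upwards [Metric.tendsto_nhds.1 hv (ε / 3) (by positivity)] with i hi
  linarith [dist_triangle4 (u i) (v i) b a, huv i]

variable {d : ℕ} {X : Type*} [MeasurableSpace X] [AddAction (Space d) X]
  [MeasurableVAdd₂ (Space d) X] {μ : Measure X} [IsProbabilityMeasure μ]

theorem ae_forall_tendsto_setAverage_localAutocorrelation [ErgodicVAdd (Space d) X μ] {N : X → ℂ}
    (hN : Measurable N) {C : ℝ} (hC : ∀ lam, ‖N lam‖ ≤ C) :
    ∀ᵐ lam ∂μ, ∀ φ : C_c(Space d, ℂ), Tendsto (fun R => ⨍ x in cube d R,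
      localAutocorrelation (fun x => N (-x +ᵥ lam)) φ (cube d R) x) atTop
        (𝓝 (∫ z, orbitCorrelation μ N z * φ z)) := by
  obtain ⟨S, hS, hdense⟩ := exists_countable_forall_exists_integral_norm_sub_lt d
  have hi (φ : C_c(Space d, ℂ)) : Integrable φ :=
    φ.continuous.integrable_of_hasCompactSupport φ.hasCompactSupport
  filter_upwards [(ae_ball_iff hS).2 fun φ _ => ae_tendsto_setAverage_localAutocorrelation
    (μ := μ) hN hC φ.continuous φ.hasCompactSupport] with lam hlam φ
  refine tendsto_of_forall_exists_dist_le fun ε hε => ?_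
  obtain ⟨ψ, hψ, hlt⟩ := hdense φ (ε / (C ^ 2 + 1)) (by positivity)
  have hsmall : C ^ 2 * ∫ z, ‖φ z - ψ z‖ ≤ ε := by
    rw [lt_div_iff₀ (by positivity)] at hlt
    have hnonneg : 0 ≤ ∫ z, ‖φ z - ψ z‖ := by positivity
    linarith
  refine ⟨_, _, hlam ψ hψ, fun R => ?_, ?_⟩
  · rw [dist_eq_norm]
    exact (norm_setAverage_localAutocorrelation_sub_le (hN.comp (measurable_neg_vadd_right lam))
      (fun _ => hC _) φ.continuous.measurable (hi φ) ψ.continuous.measurable (hi ψ) R).trans hsmall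
  · rw [dist_comm, dist_eq_norm]
    exact (norm_integral_orbitCorrelation_sub_le hN hC (hi φ) (hi ψ)).trans hsmall

end DenseTestFunctions

/-! ### Diffraction -/

section ComplexRadonDensity

variable {d : ℕ} {h : Space d → ℂ}

/-- The complex Radon measure `h dx` with a locally integrable density `h`. The phase is set to `1`
where `h` vanishes. -/
def ComplexRadon.ofDensity (h : Space d → ℂ) (hm : Measurable h) (hi : LocallyIntegrable h) :
    ComplexRadon d where
  variation := volume.withDensity fun z => ENNReal.ofReal ‖h z‖
  locallyFinite := ⟨fun x => by
    obtain ⟨U, hU, hint⟩ := hi x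
    refine ⟨U, hU, ?_⟩
    rw [withDensity_apply']
    simpa only [ofReal_norm] using! hint.2⟩
  phase z := if h z = 0 then 1 else h z / ‖h z‖
  measurable_phase := Measurable.ite (hm (measurableSet_singleton 0)) measurable_const
    (hm.div (Complex.continuous_ofReal.measurable.comp hm.norm))
  norm_phase z := by
    split_ifs with h0
    · exact norm_one
    · rw [norm_div, Complex.norm_real, norm_norm, div_self (norm_ne_zero_iff.2 h0)]

lemma ComplexRadon.integral_ofDensity (hm : Measurable h) (hi : LocallyIntegrable h)
    (φ : Space d → ℂ) : (ComplexRadon.ofDensity h hm hi).integral φ = ∫ z, h z * φ z := by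
  refine (integral_withDensity_ofReal hm.norm (fun _ => norm_nonneg _) _).trans ?_
  refine integral_congr_ae (ae_of_all _ fun z => ?_)
  simp only [ComplexRadon.ofDensity]
  split_ifs with h0
  · rw [h0, norm_zero, Complex.ofReal_zero, zero_mul, zero_mul]
  · have : (‖h z‖ : ℂ) ≠ 0 := by exact_mod_cast norm_ne_zero_iff.2 h0
    field_simp

lemma ComplexRadon.integrable_variation_ofDensity_iff (hm : Measurable h)
    (hi : LocallyIntegrable h) {φ : Space d → ℂ} :
    Integrable φ (ComplexRadon.ofDensity h hm hi).variation ↔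
      Integrable fun z => (‖h z‖ : ℂ) * φ z :=
  integrable_withDensity_ofReal_iff hm.norm (fun _ => norm_nonneg _) φ

end ComplexRadonDensity

section ComplexRadonExt

variable {d : ℕ}

lemma exists_compactlySupported_tendsto_one (d : ℕ) :
    ∃ b : ℕ → C_c(Space d, ℂ), (∀ n x, ‖b n x‖ ≤ 1) ∧ ∀ x, ∀ᶠ n in atTop, b n x = 1 := by
  let b (n : ℕ) : ContDiffBump (0 : Space d) := ⟨n + 1, n + 2, by positivity, by linarith⟩
  refine ⟨fun n => ⟨⟨_, Complex.continuous_ofReal.comp (b n).continuous⟩,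
    (b n).hasCompactSupport.comp_left Complex.ofReal_zero⟩, fun n x => ?_, fun x => ?_⟩
  · change ‖(b n x : ℂ)‖ ≤ 1
    rw [Complex.norm_real, Real.norm_of_nonneg (b n).nonneg]
    exact (b n).le_one
  · filter_upwards [eventually_ge_atTop ⌈‖x‖⌉₊] with n hn
    change (b n x : ℂ) = 1
    have hx : x ∈ Metric.closedBall 0 (b n).rIn :=
      mem_closedBall_zero_iff.2 ((Nat.ceil_le.1 hn).trans (le_add_of_nonneg_right zero_le_one))
    rw [(b n).one_of_mem_closedBall hx, Complex.ofReal_one]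

lemma ComplexRadon.tendsto_integral_mul (γ : ComplexRadon d) {b : ℕ → Space d → ℂ}
    (hbm : ∀ n, Measurable (b n)) (hb : ∀ n x, ‖b n x‖ ≤ 1)
    (hb1 : ∀ x, ∀ᶠ n in atTop, b n x = 1) {ψ : Space d → ℂ} (hi : Integrable ψ γ.variation) :
    Tendsto (fun n => γ.integral fun x => b n x * ψ x) atTop (𝓝 (γ.integral ψ)) := by
  refine tendsto_integral_of_dominated_convergence (fun x => ‖ψ x‖)
    (fun n => γ.measurable_phase.aestronglyMeasurable.mul
      ((hbm n).aestronglyMeasurable.mul hi.aestronglyMeasurable)) hi.norm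
    (fun n => ae_of_all _ fun x => ?_) (ae_of_all _ fun x => ?_)
  · rw [norm_mul, norm_mul, γ.norm_phase, one_mul]
    exact mul_le_of_le_one_left (norm_nonneg _) (hb n x)
  · refine tendsto_const_nhds.congr' ?_
    filter_upwards [hb1 x] with n hn
    rw [hn, one_mul]

lemma ComplexRadon.integral_eq_of_forall_compactlySupported {γ γ' : ComplexRadon d}
    (h : ∀ φ : C_c(Space d, ℂ), γ.integral φ = γ'.integral φ) {ψ : Space d → ℂ}
    (hψ : Continuous ψ) (hi : Integrable ψ γ.variation) (hi' : Integrable ψ γ'.variation) :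
    γ.integral ψ = γ'.integral ψ := by
  obtain ⟨b, hb, hb1⟩ := exists_compactlySupported_tendsto_one d
  have hlim (γ : ComplexRadon d) (hi : Integrable ψ γ.variation) :
      Tendsto (fun n => γ.integral fun x => b n x * ψ x) atTop (𝓝 (γ.integral ψ)) :=
    γ.tendsto_integral_mul (fun n => (b n).continuous.measurable) hb hb1 hi
  refine tendsto_nhds_unique (hlim γ hi) ((hlim γ' hi').congr fun n => ?_)
  exact (h ⟨⟨_, (b n).continuous.mul hψ⟩, (b n).hasCompactSupport.mul_right⟩).symm

lemma IsAutocorrelation.integral_eq {g : Space d → ℂ} {γ γ' : ComplexRadon d}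
    (h : IsAutocorrelation g γ) (h' : IsAutocorrelation g γ') {ψ : Space d → ℂ}
    (hψ : Continuous ψ) (hi : Integrable ψ γ.variation) (hi' : Integrable ψ γ'.variation) :
    γ.integral ψ = γ'.integral ψ :=
  ComplexRadon.integral_eq_of_forall_compactlySupported
    (fun φ => tendsto_nhds_unique (h.2 φ) (h'.2 φ)) hψ hi hi'

end ComplexRadonExt

section DiffractionOfDensity

variable {d : ℕ}

lemma integral_integral_chi_mul_fourier (σ : Measure (Space d)) [IsFiniteMeasure σ]
    (φ : 𝓢(Space d, ℂ)) :
    ∫ z, (∫ x, chi x z ∂σ) * (𝓕 φ : 𝓢(Space d, ℂ)) z = ∫ x, φ x ∂σ := by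
  have hc : Continuous fun p : Space d × Space d => chi p.2 p.1 * (𝓕 φ : 𝓢(Space d, ℂ)) p.1 :=
    (continuous_chi_uncurry.comp continuous_swap).mul
      ((𝓕 φ : 𝓢(Space d, ℂ)).continuous.comp continuous_fst)
  have hint : Integrable (fun p : Space d × Space d => chi p.2 p.1 * (𝓕 φ : 𝓢(Space d, ℂ)) p.1)
      (volume.prod σ) := by
    refine ((𝓕 φ : 𝓢(Space d, ℂ)).integrable.norm.comp_fst σ).mono' hc.aestronglyMeasurable
      (ae_of_all _ fun p => ?_)
    rw [norm_mul, norm_chi, one_mul]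
  have hinv (x : Space d) : ∫ z, chi x z * (𝓕 φ : 𝓢(Space d, ℂ)) z = φ x := by
    simp_rw [chi_comm x]
    rw [← fourierInv_eq_integral_chi, ← SchwartzMap.fourierInv_coe,
      FourierTransform.fourierInv_fourier_eq]
  simp_rw [← integral_mul_const]
  rw [integral_integral_swap hint]
  simp_rw [hinv]

lemma isAutocorrelation_ofDensity {g h : Space d → ℂ} (hg : LocallyIntegrable g)
    (hm : Measurable h) (hi : LocallyIntegrable h)
    (hlim : ∀ φ : C_c(Space d, ℂ), Tendsto
      (fun R => ⨍ x in cube d R, localAutocorrelation g φ (cube d R) x) atTop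
        (𝓝 (∫ z, h z * φ z))) :
    IsAutocorrelation g (ComplexRadon.ofDensity h hm hi) := by
  refine ⟨hg, fun φ => ?_⟩
  rw [ComplexRadon.integral_ofDensity]
  simpa only [setAverage_complex, localAutocorrelation] using hlim φ

lemma isDiffraction_iff_of_isAutocorrelation {g : Space d → ℂ} {γ : ComplexRadon d}
    (hγ : IsAutocorrelation g γ)
    (hint : ∀ φ : 𝓢(Space d, ℂ), Integrable (𝓕 φ : 𝓢(Space d, ℂ)) γ.variation)
    {σ : Measure (Space d)} [IsLocallyFiniteMeasure σ] (hσ : IsFourierTransform γ.integral σ)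
    (σ' : Measure (Space d)) : IsDiffraction g σ' ↔ σ' = σ := by
  constructor
  · rintro ⟨γ', hγ', hint', hσ'_fin, hσ'⟩
    refine ext_of_integral_schwartz fun φ => ?_
    rw [(hσ' φ).2, (hσ φ).2]
    exact hγ'.integral_eq hγ (𝓕 φ : 𝓢(Space d, ℂ)).continuous (hint' φ) (hint φ)
  · rintro rfl
    exact ⟨γ, hγ, hint, inferInstance, hσ⟩

theorem isDiffraction_iff_of_density {g h : Space d → ℂ} (hg : LocallyIntegrable g)
    (hm : Measurable h)
    (hlim : ∀ φ : C_c(Space d, ℂ), Tendsto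
      (fun R => ⨍ x in cube d R, localAutocorrelation g φ (cube d R) x) atTop
        (𝓝 (∫ z, h z * φ z)))
    {σ : Measure (Space d)} [IsFiniteMeasure σ] (hσ : ∀ z, h z = ∫ x, chi x z ∂σ)
    (σ' : Measure (Space d)) : IsDiffraction g σ' ↔ σ' = σ := by
  have hB (z : Space d) : ‖h z‖ ≤ σ.real Set.univ := by
    rw [hσ]
    simpa using norm_integral_le_of_norm_le_const (ae_of_all σ fun x => (norm_chi x z).le)
  have hi : LocallyIntegrable h := (locallyIntegrable_const (σ.real Set.univ)).mono
    hm.aestronglyMeasurable (ae_of_all _ fun z => (hB z).trans (le_abs_self _))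
  refine isDiffraction_iff_of_isAutocorrelation (isAutocorrelation_ofDensity hg hm hi hlim)
    (fun φ => (ComplexRadon.integrable_variation_ofDensity_iff hm hi).2 ?_)
    (fun φ => ⟨φ.integrable, ?_⟩) σ'
  · exact (𝓕 φ : 𝓢(Space d, ℂ)).integrable.bdd_mul
      (Complex.continuous_ofReal.measurable.comp hm.norm).aestronglyMeasurable
      (ae_of_all _ fun z => by simpa using hB z)
  · rw [ComplexRadon.integral_ofDensity]
    simp_rw [hσ]
    exact (integral_integral_chi_mul_fourier σ φ).symm

end DiffractionOfDensity

section Dworkin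

variable {d m : ℕ} {r : ℝ} {μ : Measure (Config d m r)} {w : Fin m → ℝ} {ω : Measure (Space d)}

lemma weightedConv_eq_countingFn (w : Fin m → ℝ) (f : Space d → ℂ) (lam : Config d m r) :
    weightedConv w f lam = fun x : Space d => countingFn w (fun y => f (-y)) (-x +ᵥ lam) := by
  funext x
  rw [countingFn_vadd]
  simp only [weightedConv, countingFn, neg_add_rev, neg_neg, sub_eq_neg_add]

lemma fourier_comp_neg (f : Space d → ℂ) (k : Space d) : 𝓕 (fun x => f (-x)) k = 𝓕 f (-k) := by
  rw [fourier_eq_integral_chi, fourier_eq_integral_chi, ← integral_neg_eq_self]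
  simp only [neg_neg, chi_neg_left, chi_neg_right, Complex.conj_conj]

lemma orbitCorrelation_eq_inner [VAddInvariantMeasure (Space d) (Config d m r) μ]
    {N : Config d m r → ℂ} (hN : MemLp N 2 μ) (z : Space d) :
    orbitCorrelation μ N z = inner ℂ (translationRep μ (-z) (hN.toLp N)) (hN.toLp N) := by
  rw [L2.inner_def]
  have hq := (measurePreserving_vadd z μ).quasiMeasurePreserving.ae_eq_comp hN.coeFn_toLp
  refine integral_congr_ae ?_
  filter_upwards [coeFn_translationRep (-z) (hN.toLp N), hN.coeFn_toLp, hq] with lam h1 h2 h3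
  rw [Function.comp_apply, Function.comp_apply] at h3
  rw [RCLike.inner_apply, h1, h2, neg_neg, h3]

lemma integral_chi_spectralDensity_comp_neg (hω : ω.map (fun x => -x) = ω)
    {f : Space d → ℂ} (hf : Integrable f) (z : Space d) :
    ∫ x, chi x (-z) ∂spectralDensity ω (fun x => f (-x)) = ∫ x, chi x z ∂spectralDensity ω f := by
  rw [integral_spectralDensity ω hf.comp_neg, integral_spectralDensity ω hf, ← hω,
    integral_map_neg, hω]
  simp only [fourier_comp_neg, neg_neg, chi_neg_left, chi_neg_right, Complex.conj_conj]

variable [Fact (0 < r)] [IsProbabilityMeasure μ] [ω.HasTemperateGrowth] [IsLocallyFiniteMeasure ω]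
  {θ : Lp ℂ 2 ω →ₗᵢ[ℂ] Lp ℂ 2 μ} {f : Space d → ℂ}

lemma IsCountingEmbedding.orbitCorrelation_countingFn_comp_neg
    [VAddInvariantMeasure (Space d) (Config d m r) μ] (hθ : IsCountingEmbedding μ w ω θ)
    (hω : ω.map (fun x => -x) = ω) (hf : Continuous f) (hs : HasCompactSupport f) (z : Space d) :
    orbitCorrelation μ (countingFn w fun x => f (-x)) z = ∫ x, chi x z ∂spectralDensity ω f := by
  have hf' : Continuous fun x => f (-x) := hf.comp continuous_neg
  have hs' : HasCompactSupport fun x => f (-x) := hs.comp_homeomorph (Homeomorph.neg (Space d))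
  rw [orbitCorrelation_eq_inner (memLp_countingFn_of_hasCompactSupport w hf' hs'),
    (hθ.isSpectralMeasure hf' hs').2,
    integral_chi_spectralDensity_comp_neg hω (hf.integrable_of_hasCompactSupport hs)]

theorem IsCountingEmbedding.ae_isDiffraction_iff [ErgodicVAdd (Space d) (Config d m r) μ]
    (hθ : IsCountingEmbedding μ w ω θ) (hω : ω.map (fun x => -x) = ω) (hf : Continuous f)
    (hs : HasCompactSupport f) :
    ∀ᵐ lam ∂μ, ∀ σ' : Measure (Space d),
      IsDiffraction (weightedConv w f lam) σ' ↔ σ' = spectralDensity ω f := by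
  have hf' : Continuous fun x => f (-x) := hf.comp continuous_neg
  have hs' : HasCompactSupport fun x => f (-x) := hs.comp_homeomorph (Homeomorph.neg (Space d))
  have hN : Measurable (countingFn w (fun x => f (-x)) : Config d m r → ℂ) :=
    measurable_countingFn w hf'.measurable
  obtain ⟨A, hA0, hA⟩ := exists_norm_le_decayWeight_of_hasCompactSupport hf' hs' (d + 1)
  have hC (lam : Config d m r) := norm_countingFn_le w hA0 hA lam
  have hfin := (hθ.isSpectralMeasure hf hs).1
  filter_upwards [ae_forall_tendsto_setAverage_localAutocorrelation (d := d) hN hC] with lam hlam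
  rw [weightedConv_eq_countingFn]
  have horbit : Measurable fun x : Space d => countingFn w (fun y => f (-y)) (-x +ᵥ lam) :=
    hN.comp (measurable_neg_vadd_right lam)
  refine isDiffraction_iff_of_density ?_ (measurable_orbitCorrelation hN) hlam
    (hθ.orbitCorrelation_countingFn_comp_neg hω hf hs)
  exact (locallyIntegrable_const (_ : ℝ)).mono horbit.aestronglyMeasurable
    (ae_of_all _ fun x => (hC _).trans (le_abs_self _))

end Dworkin

section PointSpectrum

variable {d : ℕ}

lemma measure_singleton_neg {ω : Measure (Space d)} (hω : ω.map (fun x => -x) = ω)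
    (k : Space d) : ω {-k} = ω {k} := by
  rw [← Set.neg_singleton, ← Set.neg_preimage,
    ← Measure.map_apply measurable_neg (measurableSet_singleton k), hω]

end PointSpectrum

end

theorem corollary1 {d m : ℕ} {r : ℝ} (hr : 0 < r)
    (μ : Measure (Config d m r)) [IsProbabilityMeasure μ]
    [ErgodicVAdd (Space d) (Config d m r) μ]
    (hI : ∀ i, 0 < intensity μ i) (w : Fin m → ℝ) :
    -- the diffraction of `f * lam` is almost surely the spectral measure of `N^w_f`
    (∀ f : C_c(Space d, ℂ), ∃ (hf : MemLp (countingFn w f) 2 μ) (σ : Measure (Space d)),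
      (∀ σ' : Measure (Space d),
        IsSpectralMeasure (translationRep μ) (hf.toLp _) σ' ↔ σ' = σ) ∧
      ∀ᵐ lam ∂μ, ∀ σ' : Measure (Space d),
        IsDiffraction (weightedConv w f lam) σ' ↔ σ' = σ) ∧
    -- the Fourier transform `ω` of the weighted first moment of the Palm measure
    ∃ (ω : Measure (Space d)) (_ : IsLocallyFiniteMeasure ω),
      IsFourierTransform (palmMoment μ w) ω ∧
      (∀ ω' : Measure (Space d), IsLocallyFiniteMeasure ω' →
        IsFourierTransform (palmMoment μ w) ω' → ω' = ω) ∧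
      -- the embedding `θ^w`
      ∃ θ : Lp ℂ 2 ω →ₗᵢ[ℂ] Lp ℂ 2 μ,
        IsCountingEmbedding μ w ω θ ∧
        (∀ θ' : Lp ℂ 2 ω →ₗᵢ[ℂ] Lp ℂ 2 μ, IsCountingEmbedding μ w ω θ' → θ' = θ) ∧
        (∀ (t : Space d) (f : Lp ℂ 2 ω),
          θ (multiplicationRep ω t f) = translationRep μ t (θ f)) ∧
        -- the spectral measures on the two sides coincide
        (∀ f g : Lp ℂ 2 ω, ∃ ρ : ComplexMeasure (Space d),
          (∀ ρ' : ComplexMeasure (Space d),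
            IsCrossSpectralMeasure (multiplicationRep ω) f g ρ' ↔ ρ' = ρ) ∧
          (∀ ρ' : ComplexMeasure (Space d),
            IsCrossSpectralMeasure (translationRep μ) (θ f) (θ g) ρ' ↔ ρ' = ρ)) ∧
        -- the point spectrum
        ∀ k : Space d,
          ((∃ f, IsEigenfunction (multiplicationRep ω) k f) ↔ ω {k} ≠ 0) ∧
          (IsEigenfunction (translationRep μ) k (θ (pointIndicator ω (-k))) ↔ ω {k} ≠ 0) ∧
          (ω {k} ≠ 0 →
            (∀ f, IsEigenfunction (multiplicationRep ω) k f ↔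
              ∃ c : ℂ, c ≠ 0 ∧ f = c • pointIndicator ω (-k)) ∧
            (∀ F, IsEigenfunction (translationRep μ) k F ↔
              ∃ c : ℂ, c ≠ 0 ∧ F = c • θ (pointIndicator ω (-k))) ∧
            ‖θ (pointIndicator ω (-k))‖ = √((ω {k}).toReal)) := by
  have : Fact (0 < r) := ⟨hr⟩
  obtain ⟨ω, hint, hω⟩ := exists_isFourierTransform_palmMoment (μ := μ) w
  have := isLocallyFiniteMeasure_of_integrable_pos (continuous_decayWeight _)
    (decayWeight_pos _) hint
  have := hasTemperateGrowth_of_integrable_decayWeight hint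
  have hsymm := hω.map_neg (palmMoment_conj w)
  obtain ⟨θ, hθ⟩ := exists_isCountingEmbedding hω
  refine ⟨fun f => ?_, ω, inferInstance, hω, fun ω' _ h => h.unique hω, θ, hθ,
    fun θ' h => hθ.unique h, hθ.intertwines, fun f g => ⟨_,
      isCrossSpectralMeasure_multiplicationRep_iff f g, fun ρ =>
        (isCrossSpectralMeasure_map_iff hθ.intertwines f g ρ).trans
          (isCrossSpectralMeasure_multiplicationRep_iff f g ρ)⟩, fun k => ?_⟩
  · have hσ := hθ.isSpectralMeasure f.continuous f.hasCompactSupport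
    exact ⟨_, _, fun σ' => ⟨hσ.unique, fun h => h ▸ hσ⟩,
      hθ.ae_isDiffraction_iff hsymm f.continuous f.hasCompactSupport⟩
  · have hT := (isEigenfunction_map_iff hθ.intertwines k _).trans isEigenfunction_pointIndicator_iff
    rw [← measure_singleton_neg hsymm k]
    refine ⟨exists_isEigenfunction_multiplicationRep_iff, hT, fun h0 => ⟨fun f => ?_,
      fun F => isEigenfunction_translationRep_iff (hT.2 h0), ?_⟩⟩
    · exact isEigenfunction_multiplicationRep_iff.trans (and_iff_right h0)
    · rw [θ.norm_map, norm_pointIndicator]
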